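/- Let $\alpha\ge 0$ and, for $2\pi$-periodic $u\in H^1$ (identified with its continuous representative), let $$E(u)=\frac12\int_{-\pi}^{\pi}\bigl(u_\theta^2-\alpha^2u^2\bigr)\,d\theta-\int_{-\pi}^{\pi}u\cos\theta\,d\theta .$$ For $M>0$ let $C_M$ be the set of nonnegative $2\pi$-periodic functions $u\in H^1$ with $\int_{-\pi}^{\pi}u\,d\theta=M$. Put $$u^0(\theta)=-\tfrac12\,\theta\sin\theta\quad(\alpha=1),\qquad u^0(\theta)=\frac{1}{1-\alpha^2}\Bigl(\cos\theta-\frac{1+\alpha^2}{2\alpha}\cos(\alpha\theta)\Bigr)\quad(\alpha\neq 0,1),$$ $A(\tau)=\dfrac{u^0_\theta(\tau)}{\alpha\sin(\alpha\tau)}$, and $$w_\tau(\theta)=A(\tau)\bigl(\cos(\alpha\theta)-\cos(\alpha\tau)\bigr)+u^0(\theta)-u^0(\tau);$$ for $\alpha=0$, $w_\tau$ denotes the limit of this expression as $\alpha\to0$, that is, $w_\tau(\theta)=\cos\theta-\cos\tau-\frac{\sin\tau}{2\tau}(\tau^2-\theta^2)$. Then for each $M>0$ the energy $E$ has a unique minimizer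 $u_M$ on $C_M$, and the following hold. 1. $u_M$ is of class $C^{1,1}$, and it is symmetric about $\theta=0$ and strictly decreasing in $|\theta|\in[0,\pi]$ on its (closed) support. 2. $u_M$ depends continuously on $M$ in the following sense. For each $M_0>0$: $u_M\to u_{M_0}$ in $C^1$ as $M\to M_0$; the Lipschitz constants of $(u_M)_\theta$ are bounded uniformly for $M$ near $M_0$; and $u_M\to u_{M_0}$ in $C^{1,1}(K)$ (the Lipschitz constant on $K$ of $(u_M-u_{M_0})_\theta$ also tends to $0$) for every compact set $K\subset\mathbb R$ that does not meet the boundary of $\{u_{M_0}>0\}$. 3. If $0<M_1<M_2$, then $u_{M_1}(\theta)<u_{M_2}(\theta)$ for all $\theta$ in the (closed) support of $u_{M_1}$. 4. If $M(1-\alpha^2)>2\pi$, then $u_M(\theta)=\frac{M}{2\pi}+\frac{\cos\theta}{1-\alpha^2}$ for all $\theta$, and $u_M$ is strictly positive. 5. If $M(1-\alpha^2)<2\pi$, then there is $\tau>0$ with $\max\{\alpha,1\}\,\tau<\pi$ such that $u_M(\theta)=w_\tau(\theta)$ for $|\theta|\le\tau$, $u_M(\theta)>0$ for $|\theta|<\tau$,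 and $u_M(\theta)=0$ for $\tau\le|\theta|\le\pi$. The contact angle is zero: $(u_M)_\theta(\pm\tau)=0$. 6. If $M(1-\alpha^2)=2\pi$, then $u_M(\theta)=\frac{1+\cos\theta}{1-\alpha^2}=\frac{M}{2\pi}+\frac{\cos\theta}{1-\alpha^2}$ for all $\theta$, and $u_M(\theta)=w_\pi(\theta)$ for $|\theta|\le\pi$. It is positive for $|\theta|<\pi$ and has a touchdown zero $u_M(\pi)=0$. -/

import Mathlib

open Real Set MeasureTheory

/-- The set `C_M` of nonnegative `2π`-periodic `H¹` functions of mass `M`. In one dimension, a function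
is in `H¹` exactly if it has an absolutely continuous representative whose (a.e. defined) derivative
is square integrable; this derivative is then the weak derivative. A member of `H¹` is
represented by its unique continuous representative, extended periodically to the line. -/
def massClass (M : ℝ) : Set (ℝ → ℝ) :=
  {u | Function.Periodic u (2 * π) ∧
    AbsolutelyContinuousOnInterval u (-π) π ∧
    MemLp (deriv u) 2 (volume.restrict (Ioc (-π) π)) ∧
    (∀ θ, 0 ≤ u θ) ∧
    ∫ θ in (-π)..π, u θ = M}

/-- The energy `E(u) = ½ ∫ (u_θ² - α² u²) dθ - ∫ u cos θ dθ` over `(-π, π)`. -/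
noncomputable def filmEnergy (α : ℝ) (u : ℝ → ℝ) : ℝ :=
  (1 / 2) * (∫ θ in (-π)..π, ((deriv u θ) ^ 2 - α ^ 2 * (u θ) ^ 2))
    - ∫ θ in (-π)..π, u θ * cos θ

/-- `u` minimizes the energy on `C_M`. -/
def IsEnergyMinimizer (α M : ℝ) (u : ℝ → ℝ) : Prop :=
  u ∈ massClass M ∧ IsMinOn (filmEnergy α) (massClass M) u

/-- `u` is of class `C^{1,1}`. -/
def IsC11 (u : ℝ → ℝ) : Prop :=
  ContDiff ℝ 1 u ∧ ∃ K, LipschitzWith K (deriv u)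

/-- `u` is symmetric about `0` and, as a function of `|θ|`, strictly decreasing on its support. -/
def StrictSymmDecreasingOnSupport (u : ℝ → ℝ) : Prop :=
  (∀ θ, u (-θ) = u θ) ∧ StrictAntiOn u (tsupport u ∩ Icc 0 π)

/-- The special solution `u⁰` of `u'' + α² u + cos θ = const` (used for `α > 0`). -/
noncomputable def specialSolution (α θ : ℝ) : ℝ :=
  if α = 1 then -(1 / 2) * θ * sin θ
  else 1 / (1 - α ^ 2) * (cos θ - (1 + α ^ 2) / (2 * α) * cos (α * θ))

/-- The coefficient `A(τ) = u⁰_θ(τ) / (α sin (α τ))` (used for `α > 0`). -/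
noncomputable def profileCoeff (α τ : ℝ) : ℝ :=
  deriv (specialSolution α) τ / (α * sin (α * τ))

/-- The profile `A(τ) (cos αθ - cos ατ) + u⁰(θ) - u⁰(τ)`. For `α = 0`, where `u⁰` and `A`
are undefined, the profile is the limit of this expression as `α → 0`. -/
noncomputable def wetProfile (α τ θ : ℝ) : ℝ :=
  if α = 0 then cos θ - cos τ - sin τ / (2 * τ) * (τ ^ 2 - θ ^ 2)
  else profileCoeff α τ * (cos (α * θ) - cos (α * τ))
    + specialSolution α θ - specialSolution α τ

/-- Continuous dependence of the minimizers on the mass at `M₀`, where `u₀` is a minimizer of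
mass `M₀`: convergence in `C¹`, with a `C^{1,1}` bound that is uniform near `M₀`, and
convergence in `C^{1,1}(K)` for every compact `K` that contains no contact point of `u₀`. -/
def MinimizersContinuousAt (α M₀ : ℝ) (u₀ : ℝ → ℝ) : Prop :=
  (∀ ε > 0, ∃ δ > 0, ∀ M > 0, |M - M₀| < δ → ∀ u, IsEnergyMinimizer α M u →
    ∀ θ, |u θ - u₀ θ| ≤ ε ∧ |deriv u θ - deriv u₀ θ| ≤ ε) ∧
  (∃ δ > 0, ∃ L, ∀ M > 0, |M - M₀| < δ → ∀ u, IsEnergyMinimizer α M u →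
    LipschitzWith L (deriv u)) ∧
  (∀ K : Set ℝ, IsCompact K → Disjoint K (frontier (Function.support u₀)) →
    ∀ ε > 0, ∃ δ > 0, ∀ M > 0, |M - M₀| < δ → ∀ u, IsEnergyMinimizer α M u →
      LipschitzOnWith ε (fun θ => deriv u θ - deriv u₀ θ) K)

/-! Existence is the direct method. The destabilizing term is subcritical: at fixed mass `M`, the
integral of u² is at most `M` times sup u, and sup u grows only like the square root of the integral
of u_θ². So the energy is coercive for every α (`exists_energy_bound`). A minimizing sequence
converges uniformly along a subsequence, and comparison with midpoints upgrades this to L²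
convergence of the derivatives (`form_sub_le`).

For α > 1 the energy is not convex, so uniqueness comes from classifying minimizers. A minimizer
satisfies a variational inequality with a multiplier λ (`exists_multiplier`). Hence u'' + α²u + cos
θ + λ = 0 where u > 0, and testing with tents centred at a zero shows that u' vanishes there. The
second variation limits intervals of positivity to length 2π/α (`length_le_of_pos`). On a component
with centre c, the Wronskian of the odd part of u with sin(αs)/α would be strictly monotone and yet
vanish at both ends unless sin c = 0. A Sturm comparison for u' then excludes cos c = -1 and makes u
decrease away from c (`component_structure`). All components are thus centred at multiples of 2π, so
there is one per period: u is a droplet on [-τ, τ], or it is positive everywhere and the equation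
with periodicity gives it explicitly (`IsFilm.classification`).

Comparison rests on one observation: the derivatives of two even solutions, with possibly different
multipliers, differ by a multiple of sin(αθ)/α, which is positive on (0, τ] since ατ < π. The sign
of the factor is read off at the contact point. So droplets are strictly ordered by τ
(`IsDroplet.lt_of_contact`), the mass increases strictly with τ, and the mass determines the
profile. Comparison with the critical film (1 + cos θ)/(1 - α²), the case τ = π, gives the mass
thresholds.

For continuity in the mass, ordered profiles with a common Lipschitz bound and nearly equal masses
are uniformly close, and interpolation gives closeness of the derivatives. The multipliers then
converge, and away from the contact points the second derivatives differ by α²(u - u₀) + λ - λ₀ up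
to sign, or both vanish (`nearMass_C11`). -/

open Filter Topology

/-! ### Periodic `H¹` functions with a chosen weak derivative -/

/-- `u` is a `2π`-periodic `H¹` function with weak derivative `g`. -/
structure IsH1 (u g : ℝ → ℝ) : Prop where
  per : Function.Periodic u (2 * π)
  dper : Function.Periodic g (2 * π)
  meas : Measurable g
  sq : IntervalIntegrable (fun x => g x ^ 2) volume (-π) π
  ftc : ∀ x, u x = u 0 + ∫ t in (0 : ℝ)..x, g t

lemma intervalIntegrable_mul_of_sq {f g : ℝ → ℝ} {a b : ℝ} (hf : Measurable f) (hg : Measurable g)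
    (hf2 : IntervalIntegrable (fun x => f x ^ 2) volume a b)
    (hg2 : IntervalIntegrable (fun x => g x ^ 2) volume a b) :
    IntervalIntegrable (fun x => f x * g x) volume a b := by
  refine (hf2.add hg2).mono_fun (hf.mul hg).aestronglyMeasurable (Filter.Eventually.of_forall ?_)
  intro x
  simp only [norm_eq_abs]
  rw [abs_of_nonneg (a := f x ^ 2 + g x ^ 2) (by positivity), abs_mul]
  nlinarith [sq_nonneg (|f x| - |g x|), sq_abs (f x), sq_abs (g x), sq_nonneg (f x),
    sq_nonneg (g x)]

lemma intervalIntegrable_of_sq {f : ℝ → ℝ} {a b : ℝ} (hf : Measurable f)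
    (hf2 : IntervalIntegrable (fun x => f x ^ 2) volume a b) :
    IntervalIntegrable f volume a b := by
  simpa using intervalIntegrable_mul_of_sq hf (measurable_const (a := (1 : ℝ))) hf2 (by simp)

lemma intervalIntegrable_period {f : ℝ → ℝ} (hf : Function.Periodic f (2 * π))
    {c : ℝ} (h : IntervalIntegrable f volume c (c + 2 * π)) (a b : ℝ) :
    IntervalIntegrable f volume a b :=
  hf.intervalIntegrable (by positivity) h a b

namespace IsH1

variable {u g v k : ℝ → ℝ}

lemma sq_int (h : IsH1 u g) (a b : ℝ) : IntervalIntegrable (fun x => g x ^ 2) volume a b := by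
  refine intervalIntegrable_period (c := -π) (fun x => by simp [h.dper x]) ?_ a b
  have := h.sq
  rwa [show -π + 2 * π = π by ring]

lemma int (h : IsH1 u g) (a b : ℝ) : IntervalIntegrable g volume a b :=
  intervalIntegrable_of_sq h.meas (h.sq_int a b)

lemma ftc' (h : IsH1 u g) (x y : ℝ) : ∫ t in x..y, g t = u y - u x := by
  rw [h.ftc x, h.ftc y, ← intervalIntegral.integral_add_adjacent_intervals (h.int 0 x) (h.int x y)]
  ring

lemma cont (h : IsH1 u g) : Continuous u := by
  rw [funext h.ftc]
  exact continuous_const.add (intervalIntegral.continuous_primitive h.int 0)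

lemma mul_int (h : IsH1 u g) (h' : IsH1 v k) (a b : ℝ) :
    IntervalIntegrable (fun x => g x * k x) volume a b :=
  intervalIntegrable_mul_of_sq h.meas h'.meas (h.sq_int a b) (h'.sq_int a b)

lemma ac (h : IsH1 u g) (a b : ℝ) : AbsolutelyContinuousOnInterval u a b := by
  have h1 := (h.int a b).absolutelyContinuousOnInterval_intervalIntegral (c := a) (by simp)
  have h2 : AbsolutelyContinuousOnInterval (fun _ : ℝ => u a) a b :=
    (LipschitzWith.const (u a)).lipschitzOnWith.absolutelyContinuousOnInterval
  have h3 : u = (fun x => ∫ t in a..x, g t) + fun _ => u a := by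
    funext x
    simp [h.ftc' a x]
  rw [h3]
  exact h1.add h2

lemma deriv_ae (h : IsH1 u g) : deriv u =ᵐ[volume] g := by
  have key : ∀ n : ℕ, ∀ᵐ x : ℝ, x ∈ uIcc (-(n : ℝ)) n → deriv u x = g x := by
    intro n
    filter_upwards [(h.int (-(n : ℝ)) n).ae_hasDerivAt_integral] with x hx hxn
    have h1 := hx hxn (-(n : ℝ)) left_mem_uIcc
    have h2 : (fun x => ∫ t in (-(n : ℝ))..x, g t) = fun x => u x - u (-n) :=
      funext fun x => h.ftc' _ _
    rw [h2] at h1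
    have := h1.add_const (u (-n))
    simp only [sub_add_cancel] at this
    exact this.deriv
  filter_upwards [ae_all_iff.2 key] with x hx
  obtain ⟨n, hn⟩ := exists_nat_ge |x|
  refine hx n ?_
  rw [uIcc_of_le (by linarith [abs_nonneg x])]
  exact abs_le.1 hn

lemma add (h : IsH1 u g) (h' : IsH1 v k) : IsH1 (fun x => u x + v x) (fun x => g x + k x) where
  per x := by simp [h.per x, h'.per x]
  dper x := by simp [h.dper x, h'.dper x]
  meas := h.meas.add h'.meas
  sq := by
    have := ((h.sq_int (-π) π).add (h'.sq_int (-π) π)).add ((h.mul_int h' (-π) π).const_mul 2)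
    refine this.congr ?_
    intro x _
    ring
  ftc x := by
    rw [intervalIntegral.integral_add (h.int _ _) (h'.int _ _), h.ftc' 0 x, h'.ftc' 0 x]
    ring

lemma const_mul (h : IsH1 u g) (t : ℝ) : IsH1 (fun x => t * u x) (fun x => t * g x) where
  per x := by simp [h.per x]
  dper x := by simp [h.dper x]
  meas := h.meas.const_mul t
  sq := by
    refine ((h.sq_int (-π) π).const_mul (t ^ 2)).congr ?_
    intro x _
    ring
  ftc x := by
    rw [intervalIntegral.integral_const_mul, h.ftc' 0 x]
    ring

lemma const (c : ℝ) : IsH1 (fun _ => c) (fun _ => 0) where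
  per _ := rfl
  dper _ := rfl
  meas := measurable_const
  sq := by simp
  ftc x := by simp

/-- The class gives absolute continuity on one period only. The fundamental theorem extends to the
line because `u` minus the primitive of its derivative is periodic, the derivative having zero
integral over a period. -/
lemma of_mem {M : ℝ} (h : u ∈ massClass M) : IsH1 u (deriv u) := by
  obtain ⟨hper, hac, hL2, -, -⟩ := h
  have dper : Function.Periodic (deriv u) (2 * π) := fun x => by
    rw [← deriv_comp_add_const]
    congr 1
    exact funext hper
  have hle : -π ≤ π := by linarith [pi_pos]
  have hsq : IntervalIntegrable (fun x => deriv u x ^ 2) volume (-π) π := by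
    rw [intervalIntegrable_iff_integrableOn_Ioc_of_le hle]
    exact hL2.integrable_sq
  have hint : ∀ a b, IntervalIntegrable (deriv u) volume a b := by
    refine intervalIntegrable_period dper (c := -π) ?_
    rw [show -π + 2 * π = π by ring]
    exact hac.intervalIntegrable_deriv
  refine ⟨hper, dper, measurable_deriv u, hsq, ?_⟩
  have hend : u π = u (-π) := by
    have := hper (-π)
    rwa [show -π + 2 * π = π by ring] at this
  have h1 : ∀ x ∈ Icc (-π) π, ∫ t in (-π)..x, deriv u t = u x - u (-π) := fun x hx =>
    (hac.mono (by rw [uIcc_of_le hx.1, uIcc_of_le hle]; exact Icc_subset_Icc_right hx.2)).integral_deriv_eq_sub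
  have hD : Function.Periodic (fun x => u x - ∫ t in (-π)..x, deriv u t) (2 * π) := by
    intro x
    beta_reduce
    rw [hper x, ← intervalIntegral.integral_add_adjacent_intervals (hint (-π) x) (hint _ _),
      dper.intervalIntegral_add_eq x (-π), show -π + 2 * π = π by ring,
      h1 π (right_mem_Icc.2 hle), hend]
    ring
  have hall : ∀ x, ∫ t in (-π)..x, deriv u t = u x - u (-π) := by
    intro x
    obtain ⟨y, hy, hxy⟩ := hD.exists_mem_Ico (by positivity : (0 : ℝ) < 2 * π) x (-π)
    rw [show -π + 2 * π = π by ring] at hy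
    rw [h1 y (Ico_subset_Icc_self hy)] at hxy
    linarith
  intro x
  rw [← intervalIntegral.integral_interval_sub_left (hint (-π) x) (hint (-π) 0), hall, hall]
  ring

lemma mem {M : ℝ} (h : IsH1 u g) (h0 : ∀ x, 0 ≤ u x) (hM : ∫ θ in (-π)..π, u θ = M) :
    u ∈ massClass M := by
  refine ⟨h.per, h.ac _ _, ?_, h0, hM⟩
  have hle : -π ≤ π := by linarith [pi_pos]
  have h1 : MemLp g 2 (volume.restrict (Ioc (-π) π)) := by
    rw [memLp_two_iff_integrable_sq h.meas.aestronglyMeasurable]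
    exact (intervalIntegrable_iff_integrableOn_Ioc_of_le hle).1 h.sq
  exact h1.ae_eq (ae_restrict_of_ae h.deriv_ae.symm)

lemma energy_eq (h : IsH1 u g) (α : ℝ) : filmEnergy α u =
    (1 / 2) * (∫ θ in (-π)..π, ((g θ) ^ 2 - α ^ 2 * (u θ) ^ 2)) - ∫ θ in (-π)..π, u θ * cos θ := by
  unfold filmEnergy
  congr 2
  refine intervalIntegral.integral_congr_ae ?_
  filter_upwards [h.deriv_ae] with x hx _
  rw [hx]

end IsH1

/-! ### The energy as a quadratic functional -/

/-- The bilinear form of the energy. -/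
noncomputable def filmForm (α : ℝ) (u g v k : ℝ → ℝ) : ℝ :=
  ∫ θ in (-π)..π, (g θ * k θ - α ^ 2 * (u θ * v θ))

namespace IsH1
variable {u g v k : ℝ → ℝ}

lemma form_int (h : IsH1 u g) (h' : IsH1 v k) (α a b : ℝ) :
    IntervalIntegrable (fun θ => g θ * k θ - α ^ 2 * (u θ * v θ)) volume a b :=
  (h.mul_int h' a b).sub (by
    have := h.cont; have := h'.cont
    exact Continuous.intervalIntegrable (by fun_prop) _ _)

/-- The energy is quadratic, so this expansion is exact. It serves the first variation, the second
variation and the midpoint estimate. -/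
lemma energy_add (h : IsH1 u g) (h' : IsH1 v k) (α t : ℝ) :
    filmEnergy α (fun x => u x + t * v x) = filmEnergy α u
      + t * (filmForm α u g v k - ∫ θ in (-π)..π, v θ * cos θ)
      + t ^ 2 / 2 * filmForm α v k v k := by
  have hu := h.cont
  have hv := h'.cont
  rw [(h.add (h'.const_mul t)).energy_eq, h.energy_eq]
  have e1 : ∫ θ in (-π)..π, ((g θ + t * k θ) ^ 2 - α ^ 2 * (u θ + t * v θ) ^ 2)
      = ∫ θ in (-π)..π, ((g θ * g θ - α ^ 2 * (u θ * u θ))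
        + (2 * t) * (g θ * k θ - α ^ 2 * (u θ * v θ))
        + t ^ 2 * (k θ * k θ - α ^ 2 * (v θ * v θ))) :=
    intervalIntegral.integral_congr fun θ _ => by ring
  have e2 : ∫ θ in (-π)..π, (u θ + t * v θ) * cos θ
      = ∫ θ in (-π)..π, (u θ * cos θ + t * (v θ * cos θ)) :=
    intervalIntegral.integral_congr fun θ _ => by ring
  have e3 : ∫ θ in (-π)..π, ((g θ) ^ 2 - α ^ 2 * (u θ) ^ 2)
      = ∫ θ in (-π)..π, (g θ * g θ - α ^ 2 * (u θ * u θ)) :=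
    intervalIntegral.integral_congr fun θ _ => by ring
  rw [e1, e2, e3, intervalIntegral.integral_add
      ((h.form_int h α _ _).add ((h.form_int h' α _ _).const_mul _))
      ((h'.form_int h' α _ _).const_mul _),
    intervalIntegral.integral_add (h.form_int h α _ _) ((h.form_int h' α _ _).const_mul _),
    intervalIntegral.integral_add (Continuous.intervalIntegrable (by fun_prop) _ _)
      (Continuous.intervalIntegrable (by fun_prop) _ _)]
  simp only [intervalIntegral.integral_const_mul, filmForm]
  ring

end IsH1

/-! ### Cauchy–Schwarz and periodic extension -/

lemma sq_integral_mul_le {f g : ℝ → ℝ} {a b : ℝ} (hab : a ≤ b)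
    (hf : Measurable f) (hg : Measurable g)
    (hf2 : IntervalIntegrable (fun x => f x ^ 2) volume a b)
    (hg2 : IntervalIntegrable (fun x => g x ^ 2) volume a b) :
    (∫ x in a..b, f x * g x) ^ 2 ≤ (∫ x in a..b, f x ^ 2) * ∫ x in a..b, g x ^ 2 := by
  have hfg := intervalIntegrable_mul_of_sq hf hg hf2 hg2
  have key : ∀ t : ℝ, 0 ≤ (∫ x in a..b, f x ^ 2) * (t * t) + (2 * ∫ x in a..b, f x * g x) * t
      + ∫ x in a..b, g x ^ 2 := by
    intro t
    have h0 : 0 ≤ ∫ x in a..b, (f x * t + g x) ^ 2 :=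
      intervalIntegral.integral_nonneg hab fun x _ => sq_nonneg _
    have e : ∫ x in a..b, (f x * t + g x) ^ 2
        = ∫ x in a..b, ((t * t) * f x ^ 2 + (2 * t) * (f x * g x) + g x ^ 2) :=
      intervalIntegral.integral_congr fun x _ => by ring
    rw [e, intervalIntegral.integral_add ((hf2.const_mul _).add (hfg.const_mul _)) hg2,
      intervalIntegral.integral_add (hf2.const_mul _) (hfg.const_mul _)] at h0
    simp only [intervalIntegral.integral_const_mul] at h0
    linarith
  have := discrim_le_zero key
  unfold discrim at this
  nlinarith

/-- The representative of `x` modulo `2π` in `[c, c + 2π)`. -/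
noncomputable def reduceMod (c x : ℝ) : ℝ := c + 2 * π * Int.fract ((x - c) / (2 * π))

lemma reduceMod_periodic (c : ℝ) : Function.Periodic (reduceMod c) (2 * π) := by
  intro x
  have : (x + 2 * π - c) / (2 * π) = (x - c) / (2 * π) + 1 := by
    field_simp
    ring
  rw [reduceMod, this, Int.fract_add_one, reduceMod]

lemma reduceMod_of_mem {c x : ℝ} (hx : x ∈ Ico c (c + 2 * π)) : reduceMod c x = x := by
  have h2 : (0 : ℝ) < 2 * π := by positivity
  rw [reduceMod, Int.fract_eq_self.2]
  · field_simp
    ring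
  · exact ⟨div_nonneg (by linarith [hx.1]) h2.le, (div_lt_one h2).2 (by linarith [hx.2])⟩

lemma reduceMod_measurable (c : ℝ) : Measurable (reduceMod c) := by
  unfold reduceMod
  fun_prop

lemma reduceMod_mem (c x : ℝ) : reduceMod c x ∈ Ico c (c + 2 * π) := by
  have h2 : (0 : ℝ) < 2 * π := by positivity
  have h0 := Int.fract_nonneg ((x - c) / (2 * π))
  have h1 := Int.fract_lt_one ((x - c) / (2 * π))
  constructor
  · unfold reduceMod; nlinarith
  · unfold reduceMod; nlinarith

lemma exists_int_reduceMod (c x : ℝ) : ∃ n : ℤ, x = reduceMod c x + n * (2 * π) := by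
  refine ⟨⌊(x - c) / (2 * π)⌋, ?_⟩
  have := Int.floor_add_fract ((x - c) / (2 * π))
  have h2 : (0 : ℝ) < 2 * π := by positivity
  have h3 : (x - c) / (2 * π) * (2 * π) = x - c := by field_simp
  unfold reduceMod
  have h4 : Int.fract ((x - c) / (2 * π)) = (x - c) / (2 * π) - ⌊(x - c) / (2 * π)⌋ := by
    linarith
  rw [h4]
  linarith

lemma periodic_reduceMod {f : ℝ → ℝ} (hf : Function.Periodic f (2 * π)) (c x : ℝ) :
    f (reduceMod c x) = f x := by
  obtain ⟨n, hn⟩ := exists_int_reduceMod c x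
  conv_rhs => rw [hn]
  exact (hf.int_mul n _).symm

/-- A mean-zero square integrable function on a period is the derivative of a periodic `H¹`
function. -/
lemma exists_isH1_of_integral_eq_zero {k : ℝ → ℝ} {c : ℝ} (hk : Measurable k)
    (hk2 : IntervalIntegrable (fun x => k x ^ 2) volume c (c + 2 * π))
    (h0 : ∫ x in c..(c + 2 * π), k x = 0) :
    ∃ ψ g, IsH1 ψ g ∧ (∀ x ∈ Icc c (c + 2 * π), ψ x = ∫ t in c..x, k t) ∧
      ∀ x ∈ Ico c (c + 2 * π), g x = k x := by
  have h2 : (0 : ℝ) < 2 * π := by positivity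
  have hle : c ≤ c + 2 * π := by linarith
  set g : ℝ → ℝ := fun x => k (reduceMod c x) with hg
  have hgk : ∀ x ∈ Ico c (c + 2 * π), g x = k x := fun x hx => by rw [hg]; simp [reduceMod_of_mem hx]
  have gper : Function.Periodic g (2 * π) := fun x => by simp [hg, reduceMod_periodic c x]
  have gmeas : Measurable g := hk.comp (reduceMod_measurable c)
  have gsq : ∀ a b, IntervalIntegrable (fun x => g x ^ 2) volume a b := by
    refine intervalIntegrable_period (c := c) (fun x => by simp [gper x]) ?_
    refine hk2.congr_uIoo ?_
    intro x hx
    rw [uIoo_of_le hle] at hx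
    simp [hgk x (Ioo_subset_Ico_self hx)]
  have gint : ∀ a b, IntervalIntegrable g volume a b := fun a b =>
    intervalIntegrable_of_sq gmeas (gsq a b)
  have hprim : ∀ x ∈ Icc c (c + 2 * π), ∫ t in c..x, g t = ∫ t in c..x, k t := by
    intro x hx
    refine intervalIntegral.integral_congr_uIoo ?_
    intro t ht
    rw [uIoo_of_le hx.1] at ht
    exact hgk t ⟨ht.1.le, ht.2.trans_le hx.2⟩
  refine ⟨fun x => ∫ t in c..x, g t, g, ⟨?_, gper, gmeas, gsq _ _, ?_⟩, hprim, hgk⟩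
  · intro x
    beta_reduce
    rw [← intervalIntegral.integral_add_adjacent_intervals (gint c x) (gint _ _),
      gper.intervalIntegral_add_eq x c, hprim _ (right_mem_Icc.2 hle), h0, add_zero]
  · intro x
    exact (intervalIntegral.integral_add_adjacent_intervals (gint _ _) (gint _ _)).symm

lemma integral_eq_of_periodic {f : ℝ → ℝ} (hf : Function.Periodic f (2 * π)) (c : ℝ) :
    ∫ x in (-π)..π, f x = ∫ x in c..(c + 2 * π), f x := by
  have := hf.intervalIntegral_add_eq (-π) c
  rwa [show -π + 2 * π = π by ring] at this

/-! ### Coercivity of the energy at fixed mass -/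

lemma sq_sub_le_of_isH1 {u g : ℝ → ℝ} (h : IsH1 u g) {x y : ℝ} (hxy : x ≤ y)
    (hy : y ≤ x + 2 * π) : (u y - u x) ^ 2 ≤ (y - x) * ∫ t in (-π)..π, g t ^ 2 := by
  have h1 := sq_integral_mul_le hxy h.meas (measurable_const (a := (1 : ℝ))) (h.sq_int x y) (by simp)
  simp only [mul_one, one_pow, intervalIntegral.integral_const, smul_eq_mul, h.ftc' x y] at h1
  have h2 : ∫ t in x..y, g t ^ 2 ≤ ∫ t in (-π)..π, g t ^ 2 := by
    rw [integral_eq_of_periodic (f := fun t => g t ^ 2) (fun t => by simp [h.dper t]) x]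
    exact intervalIntegral.integral_mono_interval le_rfl hxy hy
      (Filter.Eventually.of_forall fun t => sq_nonneg _) (h.sq_int _ _)
  nlinarith

lemma abs_sub_le_of_isH1 {u g : ℝ → ℝ} (h : IsH1 u g) (x y : ℝ) :
    |u y - u x| ≤ √(2 * π * ∫ t in (-π)..π, g t ^ 2) := by
  have hN : 0 ≤ ∫ t in (-π)..π, g t ^ 2 :=
    intervalIntegral.integral_nonneg (by linarith [pi_pos]) fun _ _ => sq_nonneg _
  refine abs_le_sqrt ?_
  rw [← periodic_reduceMod h.per x y]
  have hm := reduceMod_mem x y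
  have := sq_sub_le_of_isH1 h hm.1 hm.2.le
  nlinarith [hm.2]

/-- The mean of `u` is `M / (2 * π)`, and its oscillation is bounded by the root of the Dirichlet
integral. -/
lemma le_of_mem_massClass {M : ℝ} {u g : ℝ → ℝ} (hu : u ∈ massClass M) (h : IsH1 u g) (x : ℝ) :
    u x ≤ M / (2 * π) + √(2 * π * ∫ t in (-π)..π, g t ^ 2) := by
  have hint : ∫ θ in (-π)..π, u θ = M := hu.2.2.2.2
  have h1 : ∫ y in (-π)..π, (u x - √(2 * π * ∫ t in (-π)..π, g t ^ 2)) ≤ ∫ y in (-π)..π, u y := by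
    refine intervalIntegral.integral_mono_on (by linarith [pi_pos]) (by simp)
      (h.cont.intervalIntegrable _ _) fun y _ => ?_
    linarith [(abs_le.1 (abs_sub_le_of_isH1 h x y)).1]
  rw [hint, intervalIntegral.integral_const, smul_eq_mul] at h1
  have h2 : (0 : ℝ) < 2 * π := by positivity
  have h3 : u x - √(2 * π * ∫ t in (-π)..π, g t ^ 2) ≤ M / (2 * π) := by
    rw [le_div_iff₀ h2]
    nlinarith
  linarith

lemma integral_mul_cos_le {M : ℝ} {u : ℝ → ℝ} (hc : Continuous u) (h0 : ∀ x, 0 ≤ u x)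
    (hM : ∫ θ in (-π)..π, u θ = M) : ∫ θ in (-π)..π, u θ * cos θ ≤ M := by
  rw [← hM]
  refine intervalIntegral.integral_mono_on (by linarith [pi_pos])
    (Continuous.intervalIntegrable (by fun_prop) _ _) (hc.intervalIntegrable _ _) fun y _ => ?_
  nlinarith [cos_le_one y, h0 y]

lemma integral_sq_le {M R : ℝ} {u : ℝ → ℝ} (hc : Continuous u) (h0 : ∀ x, 0 ≤ u x)
    (hM : ∫ θ in (-π)..π, u θ = M) (hR : ∀ x, u x ≤ R) :
    ∫ θ in (-π)..π, u θ ^ 2 ≤ R * M := by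
  rw [← hM, ← intervalIntegral.integral_const_mul]
  refine intervalIntegral.integral_mono_on (by linarith [pi_pos])
    (Continuous.intervalIntegrable (by fun_prop) _ _)
    (Continuous.intervalIntegrable (by fun_prop) _ _) fun y _ => ?_
  nlinarith [hR y, h0 y]

lemma energy_lower {α M R : ℝ} {u g : ℝ → ℝ} (hu : u ∈ massClass M) (h : IsH1 u g)
    (hR : ∀ x, u x ≤ R) :
    (1 / 2) * (∫ θ in (-π)..π, g θ ^ 2) - α ^ 2 / 2 * (R * M) - M ≤ filmEnergy α u := by
  rw [h.energy_eq, intervalIntegral.integral_sub (h.sq_int _ _) (by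
      have := h.cont; exact Continuous.intervalIntegrable (by fun_prop) _ _),
    intervalIntegral.integral_const_mul]
  have h1 := integral_mul_cos_le h.cont hu.2.2.2.1 hu.2.2.2.2
  have h2 := integral_sq_le h.cont hu.2.2.2.1 hu.2.2.2.2 hR
  nlinarith [sq_nonneg α]

/-- The negative terms grow at most like the square root of the Dirichlet integral, so an energy
bound controls that integral and then the supremum. -/
lemma exists_energy_bound {α M : ℝ} (hM : 0 < M) (e : ℝ) : ∃ R, 0 ≤ R ∧ ∀ u ∈ massClass M,
    filmEnergy α u ≤ e → (∫ θ in (-π)..π, deriv u θ ^ 2) ≤ R ∧ ∀ x, u x ≤ R := by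
  -- With `s = √(2 * π * N)` the energy bound reads `s ^ 2 ≤ P + Q * s`, which forces `s ≤ P + Q +
  -- 1`.
  set Q := 2 * π * α ^ 2 * M with hQ
  set P := 2 * π * (2 * |e| + α ^ 2 * M * (M / (2 * π)) + 2 * M) with hP
  have hQ0 : 0 ≤ Q := by positivity
  have hP0 : 0 ≤ P := by positivity
  set s₀ := P + Q + 1 with hs₀
  refine ⟨M / (2 * π) + s₀ + s₀ ^ 2, by positivity, fun u hu he => ?_⟩
  have h := IsH1.of_mem hu
  set N := ∫ θ in (-π)..π, deriv u θ ^ 2 with hN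
  have hN0 : 0 ≤ N :=
    intervalIntegral.integral_nonneg (by linarith [pi_pos]) fun _ _ => sq_nonneg _
  set s := √(2 * π * N) with hs
  have hs2 : s ^ 2 = 2 * π * N := sq_sqrt (by positivity)
  have hs0 : 0 ≤ s := sqrt_nonneg _
  have h1 := energy_lower (α := α) hu h (le_of_mem_massClass hu h)
  rw [← hN, ← hs] at h1
  have hNle : N ≤ 2 * |e| + α ^ 2 * M * (M / (2 * π)) + 2 * M + α ^ 2 * M * s := by
    nlinarith [le_abs_self e]
  have hsq : s ^ 2 ≤ P + Q * s := by
    rw [hs2, hP, hQ]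
    have : 2 * π * N ≤ 2 * π * (2 * |e| + α ^ 2 * M * (M / (2 * π)) + 2 * M + α ^ 2 * M * s) := by
      gcongr
    linarith
  have hss : s ≤ s₀ := by
    by_contra! hlt
    nlinarith [mul_nonneg hP0 hs0]
  have hpos : 0 ≤ M / (2 * π) := by positivity
  constructor
  · have h2 : N ≤ s ^ 2 := by
      rw [hs2]
      nlinarith [pi_gt_three]
    nlinarith
  · intro x
    have := le_of_mem_massClass hu h x
    rw [← hN, ← hs] at this
    nlinarith [sq_nonneg s₀]

lemma const_mem_massClass {M : ℝ} (hM : 0 < M) : (fun _ => M / (2 * π)) ∈ massClass M := by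
  refine (IsH1.const _).mem (fun _ => by positivity) ?_
  rw [intervalIntegral.integral_const, smul_eq_mul]
  field_simp
  ring

lemma bddBelow_energy {α M : ℝ} (hM : 0 < M) : BddBelow (filmEnergy α '' massClass M) := by
  obtain ⟨R, hR0, hR⟩ := exists_energy_bound (α := α) hM 0
  refine ⟨min 0 (-(α ^ 2 / 2 * (R * M)) - M), ?_⟩
  rintro _ ⟨u, hu, rfl⟩
  by_cases h : filmEnergy α u ≤ 0
  · have h1 := energy_lower (α := α) hu (IsH1.of_mem hu) (hR u hu h).2
    have h2 : 0 ≤ ∫ θ in (-π)..π, deriv u θ ^ 2 :=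
      intervalIntegral.integral_nonneg (by linarith [pi_pos]) fun _ _ => sq_nonneg _
    exact (min_le_right _ _).trans (by linarith)
  · exact (min_le_left _ _).trans (by linarith)

/-! ### Existence of a minimizer -/

lemma IsH1.sub {u g v k : ℝ → ℝ} (h : IsH1 u g) (h' : IsH1 v k) :
    IsH1 (fun x => u x + (-1) * v x) (fun x => g x + (-1) * k x) := h.add (h'.const_mul (-1))

lemma mem_massClass_convex {M t : ℝ} {u v : ℝ → ℝ} (hu : u ∈ massClass M) (hv : v ∈ massClass M)
    (h0 : 0 ≤ t) (h1 : t ≤ 1) : (fun x => u x + t * (v x + (-1) * u x)) ∈ massClass M := by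
  have hu' := IsH1.of_mem hu
  have hv' := IsH1.of_mem hv
  refine (hu'.add ((hv'.sub hu').const_mul t)).mem (fun x => ?_) ?_
  · have := hu.2.2.2.1 x
    have := hv.2.2.2.1 x
    nlinarith
  · have := hu'.cont
    have := hv'.cont
    rw [intervalIntegral.integral_add (hu'.cont.intervalIntegrable _ _)
      (Continuous.intervalIntegrable (by fun_prop) _ _), intervalIntegral.integral_const_mul,
      intervalIntegral.integral_add (hv'.cont.intervalIntegrable _ _)
      (Continuous.intervalIntegrable (by fun_prop) _ _), intervalIntegral.integral_const_mul,
      hu.2.2.2.2, hv.2.2.2.2]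
    ring

/-- The parallelogram identity: the energy of the midpoint is the mean of the two energies minus one
eighth of the form of the difference, and it is at least `I`. No sign of the form is needed. -/
lemma form_sub_le {α M I : ℝ} {u v : ℝ → ℝ} (hu : u ∈ massClass M) (hv : v ∈ massClass M)
    (hI : ∀ w ∈ massClass M, I ≤ filmEnergy α w) :
    filmForm α (fun x => v x + (-1) * u x) (fun x => deriv v x + (-1) * deriv u x)
      (fun x => v x + (-1) * u x) (fun x => deriv v x + (-1) * deriv u x)
      ≤ 4 * ((filmEnergy α u - I) + (filmEnergy α v - I)) := by
  have hu' := IsH1.of_mem hu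
  have hv' := IsH1.of_mem hv
  have h1 := hI _ (mem_massClass_convex hu hv (t := 1 / 2) (by norm_num) (by norm_num))
  have e1 := hu'.energy_add (hv'.sub hu') α (1 / 2)
  have e2 := hu'.energy_add (hv'.sub hu') α 1
  have e3 : (fun x => u x + 1 * (v x + (-1) * u x)) = v := by
    funext x
    ring
  rw [e3] at e2
  linarith

/-- The only indefinite part of the form is the `α ^ 2` term, which uniform closeness controls.
Hence nearly minimizing, uniformly close functions have derivatives close in `L²`. -/
lemma integral_deriv_sub_sq_le {α M I η : ℝ} {u v : ℝ → ℝ} (hu : u ∈ massClass M)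
    (hv : v ∈ massClass M) (hI : ∀ w ∈ massClass M, I ≤ filmEnergy α w)
    (hη : ∀ x ∈ Icc (-π) π, |v x - u x| ≤ η) :
    ∫ x in (-π)..π, (deriv v x - deriv u x) ^ 2
      ≤ 4 * ((filmEnergy α u - I) + (filmEnergy α v - I)) + α ^ 2 * (2 * π * η ^ 2) := by
  have hu' := IsH1.of_mem hu
  have hv' := IsH1.of_mem hv
  have hc := (hv'.sub hu').cont
  have h1 := form_sub_le hu hv hI
  rw [filmForm, intervalIntegral.integral_sub ((hv'.sub hu').mul_int (hv'.sub hu') _ _)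
    (Continuous.intervalIntegrable (by fun_prop) _ _), intervalIntegral.integral_const_mul] at h1
  have h2 : ∫ θ in (-π)..π, (v θ + (-1) * u θ) * (v θ + (-1) * u θ) ≤ ∫ θ in (-π)..π, η ^ 2 := by
    refine intervalIntegral.integral_mono_on (by linarith [pi_pos])
      (Continuous.intervalIntegrable (by fun_prop) _ _) (by simp) fun x hx => ?_
    have := hη x hx
    have h3 : (v x + (-1) * u x) * (v x + (-1) * u x) = |v x - u x| ^ 2 := by
      rw [sq_abs]; ring
    rw [h3]
    exact pow_le_pow_left₀ (abs_nonneg _) this 2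
  rw [intervalIntegral.integral_const, smul_eq_mul] at h2
  have h4 : ∫ x in (-π)..π, (deriv v x - deriv u x) ^ 2
      = ∫ θ in (-π)..π, (deriv v θ + (-1) * deriv u θ) * (deriv v θ + (-1) * deriv u θ) :=
    intervalIntegral.integral_congr fun x _ => by ring
  rw [h4]
  nlinarith [sq_nonneg α]

lemma L2_norm_sub_sq {μ : Measure ℝ} {f g : ℝ → ℝ} (hf : MemLp f 2 μ) (hg : MemLp g 2 μ) :
    ‖hf.toLp f - hg.toLp g‖ ^ 2 = ∫ x, (f x - g x) ^ 2 ∂μ := by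
  rw [← MemLp.toLp_sub, ← real_inner_self_eq_norm_sq, L2.inner_def]
  refine integral_congr_ae ?_
  filter_upwards [(hf.sub hg).coeFn_toLp] with x hx
  rw [hx]
  simp [pow_two]

lemma exists_L2_limit {g : ℕ → ℝ → ℝ} {a b : ℝ} (hab : a ≤ b) (hm : ∀ n, Measurable (g n))
    (hs : ∀ n, IntervalIntegrable (fun x => g n x ^ 2) volume a b)
    (hC : ∀ ε > 0, ∃ N, ∀ m ≥ N, ∀ n ≥ N, ∫ x in a..b, (g m x - g n x) ^ 2 ≤ ε) :
    ∃ k : ℝ → ℝ, Measurable k ∧ IntervalIntegrable (fun x => k x ^ 2) volume a b ∧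
      Tendsto (fun n => ∫ x in a..b, (g n x - k x) ^ 2) atTop (𝓝 0) := by
  set μ := volume.restrict (Ioc a b) with hμ
  have hL : ∀ n, MemLp (g n) 2 μ := fun n => by
    rw [memLp_two_iff_integrable_sq (hm n).aestronglyMeasurable]
    exact (intervalIntegrable_iff_integrableOn_Ioc_of_le hab).1 (hs n)
  have hcauchy : CauchySeq fun n => (hL n).toLp (g n) := by
    rw [Metric.cauchySeq_iff]
    intro ε hε
    obtain ⟨N, hN⟩ := hC (ε ^ 2 / 2) (by positivity)
    refine ⟨N, fun m hm n hn => ?_⟩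
    have h1 := hN m hm n hn
    rw [intervalIntegral.integral_of_le hab, ← L2_norm_sub_sq (hL m) (hL n)] at h1
    rw [dist_eq_norm]
    refine lt_of_pow_lt_pow_left₀ 2 hε.le (h1.trans_lt ?_)
    linarith [pow_pos hε 2]
  obtain ⟨G, hG⟩ := cauchySeq_tendsto_of_complete hcauchy
  have hGm : StronglyMeasurable (G : ℝ → ℝ) := Lp.stronglyMeasurable G
  have hGL : MemLp (G : ℝ → ℝ) 2 μ := Lp.memLp G
  refine ⟨G, hGm.measurable, ?_, ?_⟩
  · rw [intervalIntegrable_iff_integrableOn_Ioc_of_le hab]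
    exact hGL.integrable_sq
  · have h1 : Tendsto (fun n => ‖(hL n).toLp (g n) - G‖ ^ 2) atTop (𝓝 (0 ^ 2)) :=
      (tendsto_iff_norm_sub_tendsto_zero.1 hG).pow 2
    rw [zero_pow two_ne_zero] at h1
    refine h1.congr fun n => ?_
    rw [intervalIntegral.integral_of_le hab, ← L2_norm_sub_sq (hL n) hGL, Lp.toLp_coeFn]

/-- Uniformly bounded sequences with uniformly bounded `H¹` energy have uniformly Cauchy
subsequences on a period. -/
lemma exists_uniformCauchy_subseq {u g : ℕ → ℝ → ℝ} {R : ℝ} (h : ∀ n, IsH1 (u n) (g n))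
    (h0 : ∀ n x, 0 ≤ u n x) (hR : ∀ n x, u n x ≤ R)
    (hg : ∀ n, (∫ θ in (-π)..π, g n θ ^ 2) ≤ R) :
    ∃ φ : ℕ → ℕ, StrictMono φ ∧ ∀ ε > 0, ∃ N, ∀ m ≥ N, ∀ n ≥ N, ∀ x ∈ Icc (-π) π,
      |u (φ m) x - u (φ n) x| ≤ ε := by
  let F : ℕ → BoundedContinuousFunction (Icc (-π) π) ℝ := fun n =>
    BoundedContinuousFunction.mkOfCompact ⟨fun x => u n x, (h n).cont.comp continuous_subtype_val⟩
  have hcomp : IsCompact (closure (range F)) := by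
    refine BoundedContinuousFunction.arzela_ascoli (Icc 0 R) isCompact_Icc _ ?_ ?_
    · rintro _ x ⟨n, rfl⟩
      exact ⟨h0 n x, hR n x⟩
    · refine Metric.equicontinuous_of_continuity_modulus (fun d => √(d * R)) ?_ _ ?_
      · have : Continuous fun d : ℝ => √(d * R) := by fun_prop
        simpa using this.tendsto 0
      · rintro x y ⟨_, n, rfl⟩
        change dist (u n x) (u n y) ≤ √(dist (x : ℝ) y * R)
        have key : ∀ s ∈ Icc (-π) π, ∀ t ∈ Icc (-π) π, s ≤ t → |u n t - u n s| ≤ √(|t - s| * R) := by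
          intro s hs t ht hst
          refine abs_le_sqrt ((sq_sub_le_of_isH1 (h n) hst (by linarith [hs.1, ht.2])).trans ?_)
          rw [abs_of_nonneg (by linarith)]
          exact mul_le_mul_of_nonneg_left (hg n) (by linarith)
        rw [Real.dist_eq, Real.dist_eq]
        rcases le_total (x : ℝ) y with hxy | hxy
        · rw [abs_sub_comm, abs_sub_comm (x : ℝ)]
          exact key x x.2 y y.2 hxy
        · exact key y y.2 x x.2 hxy
  obtain ⟨a, -, φ, hφ, hlim⟩ := hcomp.tendsto_subseq (fun n => subset_closure (mem_range_self n))
  refine ⟨φ, hφ, fun ε hε => ?_⟩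
  obtain ⟨N, hN⟩ := (Metric.cauchySeq_iff.1 hlim.cauchySeq) ε hε
  refine ⟨N, fun m hm n hn x hx => ?_⟩
  have h1 := (F (φ m)).dist_coe_le_dist (g := F (φ n)) ⟨x, hx⟩
  have h2 := hN m hm n hn
  exact h1.trans h2.le

/-- Strong convergence of the derivatives makes the energy converge along the sequence, so weak
lower semicontinuity is not needed. -/
lemma exists_minimizer {α M : ℝ} (hM : 0 < M) : ∃ u, IsEnergyMinimizer α M u := by
  have hle : -π ≤ π := by linarith [pi_pos]
  have hper2 : -π + 2 * π = π := by ring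
  set I := sInf (filmEnergy α '' massClass M) with hIdef
  have hbdd := bddBelow_energy (α := α) hM
  have hI : ∀ w ∈ massClass M, I ≤ filmEnergy α w := fun w hw => csInf_le hbdd (mem_image_of_mem _ hw)
  obtain ⟨s, -, hslim, hsmem⟩ := exists_seq_tendsto_sInf
    (⟨_, mem_image_of_mem (filmEnergy α) (const_mem_massClass hM)⟩ :
      (filmEnergy α '' massClass M).Nonempty) hbdd
  choose u hu hus using hsmem
  obtain ⟨e, he⟩ := hslim.bddAbove_range
  obtain ⟨R, hR0, hR⟩ := exists_energy_bound (α := α) hM e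
  have hRn := fun n => hR (u n) (hu n) ((hus n).trans_le (he (mem_range_self n)))
  obtain ⟨φ, hφ, hcau⟩ := exists_uniformCauchy_subseq (fun n => IsH1.of_mem (hu n))
    (fun n => (hu n).2.2.2.1) (fun n => (hRn n).2) (fun n => (hRn n).1)
  set v : ℕ → ℝ → ℝ := fun n => u (φ n) with hv
  have hvm : ∀ n, v n ∈ massClass M := fun n => hu (φ n)
  have hvH : ∀ n, IsH1 (v n) (deriv (v n)) := fun n => IsH1.of_mem (hvm n)
  have hElim : Tendsto (fun n => filmEnergy α (v n)) atTop (𝓝 I) := by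
    refine (hslim.comp hφ.tendsto_atTop).congr fun n => ?_
    exact (hus (φ n)).symm
  -- the derivatives converge in `L²`
  obtain ⟨k, hkm, hk2, hklim⟩ := exists_L2_limit (g := fun n => deriv (v n)) hle
    (fun n => measurable_deriv _) (fun n => (hvH n).sq) (by
      intro ε hε
      obtain ⟨η, hη0, hη⟩ : ∃ η > 0, α ^ 2 * (2 * π * η ^ 2) ≤ ε / 2 := by
        refine ⟨√(ε / (2 * (α ^ 2 * (2 * π) + 1))), by positivity, ?_⟩
        rw [sq_sqrt (by positivity)]
        have : α ^ 2 * (2 * π) / (α ^ 2 * (2 * π) + 1) ≤ 1 := by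
          rw [div_le_one (by positivity)]
          linarith
        calc α ^ 2 * (2 * π * (ε / (2 * (α ^ 2 * (2 * π) + 1))))
            = α ^ 2 * (2 * π) / (α ^ 2 * (2 * π) + 1) * (ε / 2) := by field_simp
          _ ≤ 1 * (ε / 2) := by gcongr
          _ = ε / 2 := one_mul _
      obtain ⟨N₁, hN₁⟩ := hcau η hη0
      obtain ⟨N₂, hN₂⟩ := eventually_atTop.1 (hElim.eventually (gt_mem_nhds (show I < I + ε / 16 by linarith)))
      refine ⟨max N₁ N₂, fun m hm n hn => ?_⟩
      have := integral_deriv_sub_sq_le (hvm n) (hvm m) hI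
        (hN₁ m ((le_max_left _ _).trans hm) n ((le_max_left _ _).trans hn))
      have h1 := hN₂ m ((le_max_right _ _).trans hm)
      have h2 := hN₂ n ((le_max_right _ _).trans hn)
      linarith)
  -- pointwise convergence
  have hpt : ∀ x, ∃ l, Tendsto (fun n => v n x) atTop (𝓝 l) := by
    intro x
    refine cauchySeq_tendsto_of_complete (Metric.cauchySeq_iff.2 fun ε hε => ?_)
    obtain ⟨N, hN⟩ := hcau (ε / 2) (by linarith)
    refine ⟨N, fun m hm n hn => ?_⟩
    rw [Real.dist_eq]
    have hx := reduceMod_mem (-π) x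
    rw [hper2] at hx
    have h1 := hN m hm n hn _ (Ico_subset_Icc_self hx)
    change |v m _ - v n _| ≤ _ at h1
    rw [periodic_reduceMod (hvH m).per, periodic_reduceMod (hvH n).per] at h1
    linarith
  choose w hw using hpt
  -- By Cauchy–Schwarz the fundamental theorem passes to the limit, so `k` is the weak derivative of
  -- the pointwise limit `w`.
  have hprim : ∀ x ∈ Icc (-π) π, ∫ t in (-π)..x, k t = w x - w (-π) := by
    intro x hx
    have hsub : uIcc (-π) x ⊆ uIcc (-π) π := by
      rw [uIcc_of_le hx.1, uIcc_of_le hle]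
      exact Icc_subset_Icc_right hx.2
    have hk2x := hk2.mono_set hsub
    have hdx : ∀ n, IntervalIntegrable (fun t => (deriv (v n) t - k t) ^ 2) volume (-π) π := by
      intro n
      have := ((((hvH n).sq).add hk2).sub
        ((intervalIntegrable_mul_of_sq (hvH n).meas hkm (hvH n).sq hk2).const_mul 2))
      refine this.congr fun t _ => ?_
      ring
    have h1 : ∀ n, ((v n x - v n (-π)) - ∫ t in (-π)..x, k t) ^ 2
        ≤ (∫ t in (-π)..π, (deriv (v n) t - k t) ^ 2) * (2 * π) := by
      intro n
      rw [← (hvH n).ftc' (-π) x, ← intervalIntegral.integral_sub ((hvH n).int _ _)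
        (intervalIntegrable_of_sq hkm hk2x)]
      have h2 := sq_integral_mul_le hx.1 ((hvH n).meas.sub hkm) (measurable_const (a := (1 : ℝ)))
        ((hdx n).mono_set hsub) (by simp)
      simp only [Pi.sub_apply, mul_one, one_pow, intervalIntegral.integral_const, smul_eq_mul] at h2
      have h3 : ∫ t in (-π)..x, (deriv (v n) t - k t) ^ 2
          ≤ ∫ t in (-π)..π, (deriv (v n) t - k t) ^ 2 :=
        intervalIntegral.integral_mono_interval le_rfl hx.1 hx.2
          (Eventually.of_forall fun t => sq_nonneg _) (hdx n)
      have h4 : 0 ≤ ∫ t in (-π)..x, (deriv (v n) t - k t) ^ 2 :=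
        intervalIntegral.integral_nonneg hx.1 fun _ _ => sq_nonneg _
      nlinarith [hx.1, hx.2]
    have h5 : Tendsto (fun n => ((v n x - v n (-π)) - ∫ t in (-π)..x, k t) ^ 2) atTop (𝓝 0) := by
      refine squeeze_zero (fun n => sq_nonneg _) h1 ?_
      simpa using hklim.mul_const (2 * π)
    have h6 := (((hw x).sub (hw (-π))).sub_const (∫ t in (-π)..x, k t)).pow 2
    have h7 := tendsto_nhds_unique h5 h6
    have := pow_eq_zero_iff (two_ne_zero) |>.1 h7.symm
    linarith
  have hwper : Function.Periodic w (2 * π) := fun x =>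
    tendsto_nhds_unique (hw (x + 2 * π)) ((hw x).congr fun n => ((hvH n).per x).symm)
  obtain ⟨ψ, g, hψ, hψe, hgk⟩ := exists_isH1_of_integral_eq_zero (c := -π) hkm
    (by rwa [hper2]) (by
      rw [hper2, hprim π (right_mem_Icc.2 hle)]
      have := hwper (-π)
      rw [hper2] at this
      linarith)
  rw [hper2] at hψe hgk
  have hwH : IsH1 w g := by
    have e : w = fun x => w (-π) + ψ x := by
      funext x
      have hx := reduceMod_mem (-π) x
      rw [hper2] at hx
      rw [← periodic_reduceMod hwper (-π) x, ← periodic_reduceMod hψ.per (-π) x,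
        hψe _ (Ico_subset_Icc_self hx), hprim _ (Ico_subset_Icc_self hx)]
      ring
    rw [e]
    simpa using (IsH1.const (w (-π))).add hψ
  have hw0 : ∀ x, 0 ≤ w x := fun x => ge_of_tendsto' (hw x) fun n => (hvm n).2.2.2.1 x
  have hvb : ∀ n x, ‖v n x‖ ≤ R := fun n x => by
    rw [norm_eq_abs, abs_of_nonneg ((hvm n).2.2.2.1 x)]
    exact (hRn (φ n)).2 x
  -- One dominated convergence statement, with weights `q` and `p`, covers both the mass and the
  -- lower order part of the energy.
  have hdom : ∀ p q : ℝ → ℝ, Continuous p → (∀ n, Continuous (v n)) → Continuous q →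
      Tendsto (fun n => ∫ x in (-π)..π, (v n x * v n x * q x + v n x * p x)) atTop
        (𝓝 (∫ x in (-π)..π, (w x * w x * q x + w x * p x))) := by
    intro p q hp hvc hq
    refine intervalIntegral.tendsto_integral_filter_of_dominated_convergence
      (fun x => R * R * ‖q x‖ + R * ‖p x‖) (Eventually.of_forall fun n => ?_)
      (Eventually.of_forall fun n => Eventually.of_forall fun x _ => ?_) ?_
      (Eventually.of_forall fun x _ => ?_)
    · have := hvc n
      exact Continuous.aestronglyMeasurable (by fun_prop)
    · refine (norm_add_le _ _).trans ?_
      rw [norm_mul, norm_mul, norm_mul]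
      have := hvb n x
      gcongr
    · exact Continuous.intervalIntegrable (by fun_prop) _ _
    · exact (((hw x).mul (hw x)).mul_const _).add ((hw x).mul_const _)
  have hvc : ∀ n, Continuous (v n) := fun n => (hvH n).cont
  have hwmem : w ∈ massClass M := by
    refine hwH.mem hw0 ?_
    have h1 := hdom (fun _ => 1) (fun _ => 0) continuous_const hvc continuous_const
    simp only [mul_zero, mul_one, zero_add] at h1
    refine tendsto_nhds_unique h1 (tendsto_const_nhds.congr fun n => ?_)
    exact (hvm n).2.2.2.2.symm
  have hkn : Tendsto (fun n => ∫ x in (-π)..π, (deriv (v n) x + (-1) * g x) ^ 2) atTop (𝓝 0) := by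
    refine hklim.congr fun n => intervalIntegral.integral_congr_uIoo fun t ht => ?_
    rw [uIoo_of_le hle] at ht
    simp only [hgk t (Ioo_subset_Ico_self ht)]
    ring
  -- Expanding the square of `g` plus the error leaves this cross term, which Cauchy–Schwarz sends
  -- to zero.
  have hcross : Tendsto (fun n => ∫ x in (-π)..π, g x * (deriv (v n) x + (-1) * g x)) atTop
      (𝓝 0) := by
    have h1 : Tendsto (fun n => (∫ x in (-π)..π, g x * (deriv (v n) x + (-1) * g x)) ^ 2) atTop
        (𝓝 0) := by
      refine squeeze_zero (fun n => sq_nonneg _) (fun n => sq_integral_mul_le hle hwH.meas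
        ((hvH n).sub hwH).meas hwH.sq ((hvH n).sub hwH).sq) ?_
      simpa using hkn.const_mul (∫ x in (-π)..π, g x ^ 2)
    rw [tendsto_zero_iff_abs_tendsto_zero]
    have h2 := (continuous_sqrt.tendsto 0).comp h1
    rw [sqrt_zero] at h2
    exact h2.congr fun n => sqrt_sq_eq_abs _
  have hgsq : Tendsto (fun n => ∫ x in (-π)..π, deriv (v n) x ^ 2) atTop
      (𝓝 (∫ x in (-π)..π, g x ^ 2)) := by
    have h1 := ((hcross.const_mul 2).add hkn).const_add (∫ x in (-π)..π, g x ^ 2)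
    simp only [mul_zero, add_zero] at h1
    refine h1.congr fun n => ?_
    rw [← intervalIntegral.integral_const_mul, ← intervalIntegral.integral_add
      ((hwH.mul_int ((hvH n).sub hwH) _ _).const_mul 2) ((hvH n).sub hwH).sq,
      ← intervalIntegral.integral_add hwH.sq
      (((hwH.mul_int ((hvH n).sub hwH) _ _).const_mul 2).add ((hvH n).sub hwH).sq)]
    exact intervalIntegral.integral_congr fun x _ => by ring
  have hsplit : ∀ (z p : ℝ → ℝ), IsH1 z p → filmEnergy α z = (1 / 2) * (∫ x in (-π)..π, p x ^ 2)
      - ∫ x in (-π)..π, (z x * z x * (α ^ 2 / 2) + z x * cos x) := by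
    intro z p hz
    have := hz.cont
    rw [hz.energy_eq, intervalIntegral.integral_sub hz.sq
      (Continuous.intervalIntegrable (by fun_prop) _ _), intervalIntegral.integral_add
      (Continuous.intervalIntegrable (by fun_prop) _ _)
      (Continuous.intervalIntegrable (by fun_prop) _ _)]
    have e : ∫ x in (-π)..π, z x * z x * (α ^ 2 / 2) = (1 / 2) * ∫ x in (-π)..π, α ^ 2 * z x ^ 2 := by
      rw [← intervalIntegral.integral_const_mul]
      exact intervalIntegral.integral_congr fun x _ => by ring
    rw [e]
    ring
  have hE : filmEnergy α w = I := by
    refine tendsto_nhds_unique ?_ hElim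
    rw [hsplit w g hwH]
    refine ((hgsq.const_mul (1 / 2)).sub (hdom cos (fun _ => α ^ 2 / 2) continuous_cos hvc
      continuous_const)).congr fun n => ?_
    exact (hsplit _ _ (hvH n)).symm
  refine ⟨w, hwmem, fun z hz => ?_⟩
  change filmEnergy α w ≤ filmEnergy α z
  rw [hE]
  exact hI z hz

/-! ### First variation and the Lagrange multiplier -/

/-- The first variation of the energy with Lagrange multiplier `lam`. -/
noncomputable def elForm (α lam : ℝ) (u g ψ k : ℝ → ℝ) : ℝ :=
  ∫ θ in (-π)..π, (g θ * k θ - (α ^ 2 * u θ + cos θ + lam) * ψ θ)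

section
variable {α M lam : ℝ} {u g ψ k φ l : ℝ → ℝ}

lemma IsH1.elForm_int (h : IsH1 u g) (h' : IsH1 ψ k) (α lam a b : ℝ) :
    IntervalIntegrable (fun θ => g θ * k θ - (α ^ 2 * u θ + cos θ + lam) * ψ θ) volume a b :=
  (h.mul_int h' a b).sub (by
    have := h.cont; have := h'.cont
    exact Continuous.intervalIntegrable (by fun_prop) _ _)

lemma IsH1.elForm_eq (h : IsH1 u g) (h' : IsH1 ψ k) (α lam : ℝ) :
    elForm α lam u g ψ k = (filmForm α u g ψ k - ∫ θ in (-π)..π, ψ θ * cos θ)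
      - lam * ∫ θ in (-π)..π, ψ θ := by
  have := h'.cont
  rw [filmForm, elForm, ← intervalIntegral.integral_const_mul, ← intervalIntegral.integral_sub
    (h.form_int h' _ _ _) (Continuous.intervalIntegrable (by fun_prop) _ _),
    ← intervalIntegral.integral_sub ((h.form_int h' _ _ _).sub
      (Continuous.intervalIntegrable (by fun_prop) _ _))
      (Continuous.intervalIntegrable (by fun_prop) _ _)]
  exact intervalIntegral.integral_congr fun θ _ => by ring

lemma IsH1.elForm_add_mul (h : IsH1 u g) (h₁ : IsH1 ψ k) (h₂ : IsH1 φ l) (α lam s t : ℝ) :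
    elForm α lam u g (fun x => s * ψ x + t * φ x) (fun x => s * k x + t * l x)
      = s * elForm α lam u g ψ k + t * elForm α lam u g φ l := by
  rw [elForm, elForm, elForm, ← intervalIntegral.integral_const_mul,
    ← intervalIntegral.integral_const_mul, ← intervalIntegral.integral_add
    ((h.elForm_int h₁ _ _ _ _).const_mul _) ((h.elForm_int h₂ _ _ _ _).const_mul _)]
  exact intervalIntegral.integral_congr fun θ _ => by ring

lemma nonneg_of_forall_small {b q t₀ : ℝ} (h0 : 0 < t₀)
    (h : ∀ t, 0 < t → t ≤ t₀ → 0 ≤ t * b + t ^ 2 / 2 * q) : 0 ≤ b := by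
  by_contra! hb
  have hq : 0 ≤ |q| := abs_nonneg q
  set t := min t₀ (-b / (|q| + 1)) with ht
  have hpos : 0 < t := lt_min h0 (div_pos (by linarith) (by linarith))
  have h1 := h t hpos (min_le_left _ _)
  have h2 : t * (|q| + 1) ≤ -b := by
    rw [← le_div_iff₀ (by linarith)]
    exact min_le_right _ _
  have h3 : 0 ≤ b + t / 2 * q := by
    by_contra! h4
    nlinarith
  nlinarith [le_abs_self q]

lemma first_variation_nonneg (hu : IsEnergyMinimizer α M u) (h : IsH1 u g) (hφ : IsH1 φ l)
    {t₀ : ℝ} (h0 : 0 < t₀) (hφ0 : ∫ θ in (-π)..π, φ θ = 0)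
    (hpos : ∀ t, 0 < t → t ≤ t₀ → ∀ x, 0 ≤ u x + t * φ x) :
    0 ≤ filmForm α u g φ l - ∫ θ in (-π)..π, φ θ * cos θ := by
  refine nonneg_of_forall_small (q := filmForm α φ l φ l) h0 fun t ht ht' => ?_
  have hmem : (fun x => u x + t * φ x) ∈ massClass M := by
    refine (h.add (hφ.const_mul t)).mem (hpos t ht ht') ?_
    rw [intervalIntegral.integral_add (h.cont.intervalIntegrable _ _)
      ((hφ.const_mul t).cont.intervalIntegrable _ _), intervalIntegral.integral_const_mul, hφ0,
      hu.1.2.2.2.2]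
    ring
  have h1 : filmEnergy α u ≤ filmEnergy α (fun x => u x + t * φ x) := hu.2 hmem
  rw [h.energy_add hφ] at h1
  linarith

/-- The direction `ψ - (m / M) * u` has mean zero and is admissible for small positive times,
because subtracting a small multiple of `u` from `u` keeps it nonnegative. The multiplier is chosen
to make the variation along `u` vanish. -/
lemma exists_multiplier (hM : 0 < M) (hu : IsEnergyMinimizer α M u) (h : IsH1 u g) :
    ∃ lam, (∀ ψ k, IsH1 ψ k → (∀ x, 0 ≤ ψ x) → 0 ≤ elForm α lam u g ψ k) ∧
      elForm α lam u g u g = 0 := by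
  have hmass : ∫ θ in (-π)..π, u θ = M := hu.1.2.2.2.2
  set lam := (filmForm α u g u g - ∫ θ in (-π)..π, u θ * cos θ) / M with hlam
  have hlu : elForm α lam u g u g = 0 := by
    rw [h.elForm_eq h, hmass, hlam]
    field_simp
    ring
  refine ⟨lam, fun ψ k hψ hψ0 => ?_, hlu⟩
  have hpos : ∀ x, 0 ≤ u x := hu.1.2.2.2.1
  set m := ∫ θ in (-π)..π, ψ θ with hm
  have hm0 : 0 ≤ m := intervalIntegral.integral_nonneg (by linarith [pi_pos]) fun x _ => hψ0 x
  have hφ := (hψ.const_mul 1).add (h.const_mul (-(m / M)))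
  have h0 : ∫ θ in (-π)..π, (1 * ψ θ + -(m / M) * u θ) = 0 := by
    rw [intervalIntegral.integral_add ((hψ.const_mul 1).cont.intervalIntegrable _ _)
      ((h.const_mul _).cont.intervalIntegrable _ _), intervalIntegral.integral_const_mul,
      intervalIntegral.integral_const_mul, hmass, ← hm]
    field_simp
    ring
  have h1 := first_variation_nonneg hu h hφ (t₀ := M / (m + 1)) (by positivity) h0 (by
    intro t ht ht' x
    have h2 : t * (m / M) ≤ 1 := by
      rw [le_div_iff₀ (by positivity)] at ht'
      rw [mul_div_assoc', div_le_one hM]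
      nlinarith
    nlinarith [hpos x, hψ0 x, mul_nonneg ht.le (hψ0 x)])
  have h2 := h.elForm_eq hφ α lam
  rw [h0] at h2
  have h3 := h.elForm_add_mul hψ h α lam 1 (-(m / M))
  rw [hlu] at h3
  linarith

/-- Both `C * u + φ` and `C * u - φ` are nonnegative test functions, and the variation along `u` is
zero, so the two inequalities give equality. -/
lemma elForm_eq_zero (h : IsH1 u g) (hφ : IsH1 φ l)
    (hnn : ∀ ψ k, IsH1 ψ k → (∀ x, 0 ≤ ψ x) → 0 ≤ elForm α lam u g ψ k)
    (h0 : elForm α lam u g u g = 0) {C : ℝ} (hC : ∀ x, |φ x| ≤ C * u x) :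
    elForm α lam u g φ l = 0 := by
  have h1 := hnn _ _ ((h.const_mul C).add (hφ.const_mul 1)) fun x => by
    linarith [(abs_le.1 (hC x)).1]
  have h2 := hnn _ _ ((h.const_mul C).add (hφ.const_mul (-1))) fun x => by
    linarith [(abs_le.1 (hC x)).2]
  rw [h.elForm_add_mul h hφ, h0] at h1 h2
  linarith

/-! ### Local test functions: regularity and length of wet intervals -/

lemma integral_period_eq_of_zero {f : ℝ → ℝ} (hf : Function.Periodic f (2 * π)) {x y : ℝ}
    (hy : y ≤ x + 2 * π) (hi : ∀ a b, IntervalIntegrable f volume a b)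
    (h0 : ∀ t ∈ Ioo y (x + 2 * π), f t = 0) :
    ∫ t in (-π)..π, f t = ∫ t in x..y, f t := by
  rw [integral_eq_of_periodic hf x, ← intervalIntegral.integral_add_adjacent_intervals (hi x y)
    (hi y _)]
  have : ∫ t in y..(x + 2 * π), f t = ∫ t in y..(x + 2 * π), (0 : ℝ) := by
    refine intervalIntegral.integral_congr_uIoo fun t ht => ?_
    rw [uIoo_of_le hy] at ht
    exact h0 t ht
  rw [this]
  simp

/-- Periodic `H¹` functions with prescribed derivative on `[x, y]`, vanishing on the rest of the
period. -/
lemma exists_test {x y : ℝ} (hxy : x ≤ y) (hy : y ≤ x + 2 * π) {k₀ : ℝ → ℝ} (hk : Measurable k₀)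
    (hk2 : IntervalIntegrable (fun t => k₀ t ^ 2) volume x y) (h0 : ∫ t in x..y, k₀ t = 0) :
    ∃ ψ k, IsH1 ψ k ∧ (∀ t ∈ Icc x y, ψ t = ∫ s in x..t, k₀ s) ∧
      (∀ t ∈ Icc y (x + 2 * π), ψ t = 0) ∧ (∀ t ∈ Ico x y, k t = k₀ t) ∧
      ∀ t ∈ Ico y (x + 2 * π), k t = 0 := by
  set K := (Ico x y).indicator k₀ with hK
  have hKm : Measurable K := hk.indicator measurableSet_Ico
  have hKin : ∀ t ∈ Ico x y, K t = k₀ t := fun t ht => indicator_of_mem ht _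
  have hKout : ∀ t, y ≤ t → K t = 0 := fun t ht => indicator_of_notMem (fun h => by linarith [h.2]) _
  have i1 : IntervalIntegrable (fun t => K t ^ 2) volume x y := by
    refine hk2.congr_uIoo fun t ht => ?_
    rw [uIoo_of_le hxy] at ht
    simp only [hKin t (Ioo_subset_Ico_self ht)]
  have i2 : IntervalIntegrable (fun t => K t ^ 2) volume y (x + 2 * π) := by
    refine (intervalIntegrable_const (c := (0 : ℝ))).congr_uIoo fun t ht => ?_
    rw [uIoo_of_le hy] at ht
    simp [hKout t ht.1.le]
  have e1 : ∀ t ∈ Icc x y, ∫ s in x..t, K s = ∫ s in x..t, k₀ s := by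
    intro t ht
    refine intervalIntegral.integral_congr_uIoo fun s hs => ?_
    rw [uIoo_of_le ht.1] at hs
    exact hKin s ⟨hs.1.le, hs.2.trans_le ht.2⟩
  have e2 : ∀ t ∈ Icc y (x + 2 * π), ∫ s in x..t, K s = 0 := by
    intro t ht
    have i2' : IntervalIntegrable (fun t => K t ^ 2) volume y t := i2.mono_set (by
      rw [uIcc_of_le ht.1, uIcc_of_le hy]; exact Icc_subset_Icc_right ht.2)
    rw [← intervalIntegral.integral_add_adjacent_intervals (intervalIntegrable_of_sq hKm i1)
      (intervalIntegrable_of_sq hKm i2'), e1 y (right_mem_Icc.2 hxy), h0]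
    have : ∫ s in y..t, K s = ∫ s in y..t, (0 : ℝ) := by
      refine intervalIntegral.integral_congr_uIoo fun s hs => ?_
      rw [uIoo_of_le ht.1] at hs
      exact hKout s hs.1.le
    rw [this]
    simp
  obtain ⟨ψ, k, hψ, h1, h2⟩ := exists_isH1_of_integral_eq_zero hKm (i1.trans i2)
    (e2 _ (right_mem_Icc.2 hy))
  refine ⟨ψ, k, hψ, fun t ht => ?_, fun t ht => ?_, fun t ht => ?_, fun t ht => ?_⟩
  · rw [h1 t ⟨ht.1, ht.2.trans hy⟩, e1 t ht]
  · rw [h1 t ⟨hxy.trans ht.1, ht.2⟩, e2 t ht]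
  · rw [h2 t ⟨ht.1, ht.2.trans_le hy⟩, hKin t ht]
  · rw [h2 t ⟨hxy.trans ht.1, ht.2⟩, hKout t ht.1]

lemma forall_of_periodic {P : ℝ → Prop} (x : ℝ) (hP : ∀ t, P (t + 2 * π) ↔ P t)
    (h : ∀ t ∈ Ico x (x + 2 * π), P t) (t : ℝ) : P t := by
  have hper : Function.Periodic P (2 * π) := fun t => propext (hP t)
  obtain ⟨s, hs, hst⟩ := hper.exists_mem_Ico (by positivity : (0 : ℝ) < 2 * π) t x
  rw [hst]
  exact h s hs

lemma elForm_test {x y : ℝ} (hxy : x ≤ y) (hy : y ≤ x + 2 * π) (h : IsH1 u g) (hψ : IsH1 ψ k)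
    {k₀ : ℝ → ℝ} (hψ0 : ∀ t ∈ Icc y (x + 2 * π), ψ t = 0) (hk : ∀ t ∈ Ico x y, k t = k₀ t)
    (hk0 : ∀ t ∈ Ico y (x + 2 * π), k t = 0) (α lam : ℝ) :
    elForm α lam u g ψ k = ∫ t in x..y, (g t * k₀ t - (α ^ 2 * u t + cos t + lam) * ψ t) := by
  rw [elForm, integral_period_eq_of_zero (fun t => ?_) hy (h.elForm_int hψ α lam) fun t ht => ?_]
  · refine intervalIntegral.integral_congr_uIoo fun t ht => ?_
    rw [uIoo_of_le hxy] at ht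
    simp only [hk t (Ioo_subset_Ico_self ht)]
  · simp [h.dper t, h.per t, hψ.per t, hψ.dper t]
  · simp [hk0 t (Ioo_subset_Ico_self ht), hψ0 t (Ioo_subset_Icc_self ht)]

/-- At a zero, a minimizer is bounded by a parabola. -/
lemma quadratic_bound_at_zero (h : IsH1 u g)
    (hnn : ∀ ψ k, IsH1 ψ k → (∀ x, 0 ≤ ψ x) → 0 ≤ elForm α lam u g ψ k) {a : ℝ} (ha : u a = 0)
    {C : ℝ} (hC : ∀ t, |α ^ 2 * u t + cos t + lam| ≤ C) {s : ℝ} (hs0 : 0 < s) (hs : s ≤ π) :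
    u (a - s) + u (a + s) ≤ 2 * C * s ^ 2 := by
  -- The slope of the tent of height one over `[a - s, a + s]`.
  set k₀ : ℝ → ℝ := fun t => if t < a then 1 / s else -(1 / s) with hk₀
  have hkm : Measurable k₀ := Measurable.ite measurableSet_Iio measurable_const measurable_const
  have hsq : (fun t => k₀ t ^ 2) = fun _ => (1 / s) ^ 2 := by
    funext t
    simp only [hk₀]
    split_ifs <;> ring
  have hki : ∀ x y, IntervalIntegrable k₀ volume x y := fun x y =>
    intervalIntegrable_of_sq hkm (by rw [hsq]; simp)
  have hleft : ∀ (p : ℝ → ℝ), ∀ t ≤ a, ∫ r in (a - s)..t, p r * k₀ r = ∫ r in (a - s)..t, p r * (1 / s) := by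
    intro p t ht
    refine intervalIntegral.integral_congr_uIoo fun r hr => ?_
    have : r < a := hr.2.trans_le (max_le (by linarith) ht)
    simp [hk₀, this]
  have hright : ∀ (p : ℝ → ℝ), ∀ t, a ≤ t → ∫ r in a..t, p r * k₀ r = ∫ r in a..t, p r * (-(1 / s)) := by
    intro p t ht
    refine intervalIntegral.integral_congr_uIoo fun r hr => ?_
    rw [uIoo_of_le ht] at hr
    simp [hk₀, not_lt.2 hr.1.le]
  have hpl : ∀ t ≤ a, ∫ r in (a - s)..t, k₀ r = (t - (a - s)) * (1 / s) := by
    intro t ht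
    have := hleft (fun _ => 1) t ht
    simpa using this
  have hpr : ∀ t, a ≤ t → ∫ r in a..t, k₀ r = (t - a) * (-(1 / s)) := by
    intro t ht
    have := hright (fun _ => 1) t ht
    simpa using this
  have hval : ∀ t, a ≤ t → ∫ r in (a - s)..t, k₀ r = 1 - (t - a) * (1 / s) := by
    intro t ht
    rw [← intervalIntegral.integral_add_adjacent_intervals (hki (a - s) a) (hki a t), hpl a le_rfl,
      hpr t ht]
    field_simp
    ring
  obtain ⟨ψ, k, hψ, h1, h2, h3, h4⟩ := exists_test (x := a - s) (y := a + s) (by linarith)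
    (by linarith) hkm (by rw [hsq]; simp) (by
      rw [hval _ (by linarith)]
      field_simp
      ring)
  have hb : ∀ t ∈ Icc (a - s) (a + s), 0 ≤ ψ t ∧ ψ t ≤ 1 := by
    intro t ht
    rw [h1 t ht]
    rcases le_total t a with hta | hta
    · rw [hpl t hta, mul_one_div]
      exact ⟨div_nonneg (by linarith [ht.1]) hs0.le, (div_le_one hs0).2 (by linarith)⟩
    · rw [hval t hta, mul_one_div]
      have e1 : (t - a) / s ≤ 1 := (div_le_one hs0).2 (by linarith [ht.2])
      have e2 : 0 ≤ (t - a) / s := div_nonneg (by linarith) hs0.le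
      constructor <;> linarith
  have hψ0 : ∀ t, 0 ≤ ψ t := by
    refine forall_of_periodic (a - s) (fun t => by rw [hψ.per t]) fun t ht => ?_
    rcases le_total t (a + s) with hta | hta
    · exact (hb t ⟨ht.1, hta⟩).1
    · exact (h2 t ⟨hta, ht.2.le⟩).ge
  have h5 := hnn ψ k hψ hψ0
  have hcu := h.cont
  have hcψ := hψ.cont
  have i1 : ∀ x y, IntervalIntegrable (fun t => g t * k₀ t) volume x y := fun x y =>
    intervalIntegrable_mul_of_sq h.meas hkm (h.sq_int _ _) (by rw [hsq]; simp)
  have i2 : IntervalIntegrable (fun t => (α ^ 2 * u t + cos t + lam) * ψ t) volume (a - s) (a + s) :=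
    Continuous.intervalIntegrable (by fun_prop) _ _
  -- Since `u a = 0`, the gradient term against the tent is `-(u (a - s) + u (a + s)) / s`, while
  -- the force term is at most `2 * C * s` in absolute value.
  rw [elForm_test (by linarith) (by linarith) h hψ h2 h3 h4,
    intervalIntegral.integral_sub (i1 _ _) i2,
    ← intervalIntegral.integral_add_adjacent_intervals (i1 (a - s) a) (i1 a (a + s)),
    hleft g a le_rfl, hright g _ (by linarith), intervalIntegral.integral_mul_const,
    intervalIntegral.integral_mul_const, h.ftc', h.ftc', ha] at h5
  have h6 := intervalIntegral.norm_integral_le_of_norm_le_const (a := a - s) (b := a + s) (C := C)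
    (f := fun t => (α ^ 2 * u t + cos t + lam) * ψ t) (by
      intro t ht
      rw [uIoc_of_le (by linarith)] at ht
      have hbt := hb t (Ioc_subset_Icc_self ht)
      rw [norm_mul, norm_eq_abs, norm_eq_abs, abs_of_nonneg hbt.1]
      nlinarith [hC t, abs_nonneg (α ^ 2 * u t + cos t + lam)])
  rw [norm_eq_abs, abs_of_nonneg (by linarith : (0 : ℝ) ≤ a + s - (a - s))] at h6
  have h7 := (abs_le.1 h6).1
  have h8 : (u (a - s) + u (a + s)) * (1 / s) ≤ C * (a + s - (a - s)) := by linarith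
  rw [mul_one_div, div_le_iff₀ hs0] at h8
  linarith

end

section
variable {α M lam : ℝ} {u g : ℝ → ℝ}

lemma hasDerivAt_primitive {r : ℝ → ℝ} (hr : Continuous r) (a t : ℝ) :
    HasDerivAt (fun x => ∫ s in a..x, r s) (r t) t :=
  intervalIntegral.integral_hasDerivAt_right (hr.intervalIntegrable _ _)
    (hr.stronglyMeasurableAtFilter _ _) hr.continuousAt

/-- By compactness `ψ / u` is bounded on `[x, y]`, and `ψ` vanishes on the rest of the period. This
is the domination that `elForm_eq_zero` asks for. -/
lemma abs_test_le {ψ : ℝ → ℝ} {k : ℝ → ℝ} {x y : ℝ}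
    (h : IsH1 u g) (h0 : ∀ t, 0 ≤ u t) (hpos : ∀ t ∈ Icc x y, 0 < u t) (hψ : IsH1 ψ k)
    (hψ0 : ∀ t ∈ Icc y (x + 2 * π), ψ t = 0) : ∃ C, 0 ≤ C ∧ ∀ t, |ψ t| ≤ C * u t := by
  obtain ⟨C, hC⟩ := isCompact_Icc.exists_bound_of_continuousOn (s := Icc x y)
    (f := fun t => ψ t / u t)
    (hψ.cont.continuousOn.div h.cont.continuousOn fun t ht => (hpos t ht).ne')
  refine ⟨max C 0, le_max_right _ _, ?_⟩
  refine forall_of_periodic x (fun t => by rw [hψ.per t, h.per t]) fun t ht => ?_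
  rcases le_total t y with hty | hty
  · have hp := hpos t ⟨ht.1, hty⟩
    have h1 := hC t ⟨ht.1, hty⟩
    rw [norm_eq_abs, abs_div, abs_of_pos hp, div_le_iff₀ hp] at h1
    exact h1.trans (mul_le_mul_of_nonneg_right (le_max_left _ _) hp.le)
  · rw [hψ0 t ⟨hty, ht.2.le⟩, abs_zero]
    exact mul_nonneg (le_max_right _ _) (h0 t)

/-- The du Bois-Reymond argument: a minimizer is `C²` where it is positive. -/
lemma exists_slope_of_pos (h : IsH1 u g) (h0 : ∀ t, 0 ≤ u t)
    (hnn : ∀ ψ k, IsH1 ψ k → (∀ x, 0 ≤ ψ x) → 0 ≤ elForm α lam u g ψ k)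
    (hz : elForm α lam u g u g = 0) {x y : ℝ} (hxy : x < y) (hy : y ≤ x + 2 * π)
    (hpos : ∀ t ∈ Icc x y, 0 < u t) :
    ∃ p, ∀ t ∈ Icc x y,
      u t - u x = ∫ s in x..t, (p - ∫ r in (0 : ℝ)..s, (α ^ 2 * u r + cos r + lam)) := by
  have hcu := h.cont
  set r : ℝ → ℝ := fun t => α ^ 2 * u t + cos t + lam with hr
  have hrc : Continuous r := by fun_prop
  set G : ℝ → ℝ := fun s => ∫ t in (0 : ℝ)..s, r t with hG
  have hGd : ∀ t, HasDerivAt G (r t) t := hasDerivAt_primitive hrc 0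
  have hGc : Continuous G := continuous_iff_continuousAt.2 fun t => (hGd t).continuousAt
  have hGi : ∀ a b, IntervalIntegrable G volume a b := fun a b => hGc.intervalIntegrable a b
  -- The mean of `g + G`, so that `g + G - p` has mean zero on `[x, y]` and is the derivative of a
  -- test function supported there.
  set p := (∫ t in x..y, (g t + G t)) / (y - x) with hp
  set k₀ : ℝ → ℝ := fun t => g t + (G t - p) with hk₀
  have hk₀m : Measurable k₀ := h.meas.add (hGc.measurable.sub_const p)
  have hq2 : IntervalIntegrable (fun t => (G t - p) ^ 2) volume x y :=
    Continuous.intervalIntegrable (by fun_prop) _ _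
  have hk2 : IntervalIntegrable (fun t => k₀ t ^ 2) volume x y := by
    refine (((h.sq_int x y).add hq2).add
      ((intervalIntegrable_mul_of_sq h.meas (hGc.measurable.sub_const p) (h.sq_int x y)
        hq2).const_mul 2)).congr fun t _ => ?_
    simp only [hk₀]
    ring
  have hk1 := intervalIntegrable_of_sq hk₀m hk2
  have hmean : ∫ t in x..y, k₀ t = 0 := by
    have e : ∀ t, k₀ t = (g t + G t) - p := fun t => by simp only [hk₀]; ring
    simp only [e]
    rw [intervalIntegral.integral_sub ((h.int _ _).add (hGi _ _)) (by simp),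
      intervalIntegral.integral_const, smul_eq_mul, hp]
    field_simp [(sub_pos.2 hxy).ne']
    ring
  obtain ⟨ψ, k, hψ, h1, h2, h3, h4⟩ := exists_test hxy.le hy hk₀m hk2 hmean
  obtain ⟨C, -, hC⟩ := abs_test_le h h0 hpos hψ h2
  have hzero := elForm_eq_zero h hψ hnn hz hC
  rw [elForm_test hxy.le hy h hψ h2 h3 h4] at hzero
  have hψx : ψ x = 0 := by rw [h1 x (left_mem_Icc.2 hxy.le)]; simp
  have hψy : ψ y = 0 := h2 y ⟨le_rfl, hy⟩
  have hparts : ∫ t in x..y, G t * k₀ t = - ∫ t in x..y, r t * ψ t := by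
    have hGac : AbsolutelyContinuousOnInterval G x y := by
      have hGC1 : ContDiff ℝ 1 G := by
        rw [contDiff_one_iff_deriv]
        refine ⟨fun t => (hGd t).differentiableAt, ?_⟩
        rwa [show deriv G = r from funext fun t => (hGd t).deriv]
      exact hGC1.contDiffOn.absolutelyContinuousOnInterval
    have e := hGac.integral_mul_deriv_eq_deriv_mul (hψ.ac x y)
    rw [hψx, hψy] at e
    have e1 : ∫ t in x..y, G t * deriv ψ t = ∫ t in x..y, G t * k₀ t := by
      refine intervalIntegral.integral_congr_ae ?_
      have hne : ∀ᵐ t : ℝ, t ≠ y := by simp [ae_iff]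
      filter_upwards [hψ.deriv_ae, hne] with t ht hty hm
      rw [uIoc_of_le hxy.le] at hm
      rw [ht, h3 t ⟨hm.1.le, lt_of_le_of_ne hm.2 hty⟩]
    have e2 : ∫ t in x..y, deriv G t * ψ t = ∫ t in x..y, r t * ψ t :=
      intervalIntegral.integral_congr fun t _ => by rw [(hGd t).deriv]
    rw [← e1, e, e2]
    ring
  have igk := intervalIntegrable_mul_of_sq h.meas hk₀m (h.sq_int x y) hk2
  have iGk : IntervalIntegrable (fun t => G t * k₀ t) volume x y :=
    hk1.continuousOn_mul hGc.continuousOn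
  have hcψ := hψ.cont
  rw [intervalIntegral.integral_sub igk (Continuous.intervalIntegrable (by fun_prop) _ _)] at hzero
  -- Testing with the primitive of `k₀` itself turns the weak equation into the vanishing of the
  -- `L²` norm of `k₀`.
  have hsq0 : ∫ t in x..y, k₀ t ^ 2 = 0 := by
    have e : ∫ t in x..y, k₀ t ^ 2 = ∫ t in x..y, ((g t * k₀ t + G t * k₀ t) - p * k₀ t) :=
      intervalIntegral.integral_congr fun t _ => by
        simp only [hk₀]
        ring
    rw [e, intervalIntegral.integral_sub (igk.add iGk) (hk1.const_mul p),
      intervalIntegral.integral_add igk iGk, intervalIntegral.integral_const_mul, hmean, hparts]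
    linarith
  refine ⟨p, fun t ht => ?_⟩
  have hsub : uIcc x t ⊆ uIcc x y := by
    rw [uIcc_of_le ht.1, uIcc_of_le hxy.le]
    exact Icc_subset_Icc_right ht.2
  have h5 : ∫ s in x..t, k₀ s = 0 := by
    have h6 := sq_integral_mul_le ht.1 hk₀m (measurable_const (a := (1 : ℝ)))
      (hk2.mono_set hsub) (by simp)
    have h7 : ∫ s in x..t, k₀ s ^ 2 ≤ ∫ s in x..y, k₀ s ^ 2 :=
      intervalIntegral.integral_mono_interval le_rfl ht.1 ht.2
        (Eventually.of_forall fun s => sq_nonneg _) hk2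
    simp only [mul_one, one_pow, intervalIntegral.integral_const, smul_eq_mul] at h6
    rw [hsq0] at h7
    have h8 : (∫ s in x..t, k₀ s) ^ 2 ≤ 0 := by nlinarith [ht.1]
    exact pow_eq_zero_iff two_ne_zero |>.1 (le_antisymm h8 (sq_nonneg _))
  have h9 : ∫ s in x..t, k₀ s = (∫ s in x..t, g s) - ∫ s in x..t, (p - G s) := by
    rw [← intervalIntegral.integral_sub (h.int _ _) (Continuous.intervalIntegrable (by fun_prop) _ _)]
    exact intervalIntegral.integral_congr fun s _ => by
      simp only [hk₀]
      ring
  rw [h.ftc' x t, h5] at h9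
  linarith

/-- Second variation: an interval of positivity is not longer than `2π/α`. -/
lemma length_le_of_pos (hα : 0 ≤ α) (hu : IsEnergyMinimizer α M u) (h : IsH1 u g)
    (hnn : ∀ ψ k, IsH1 ψ k → (∀ x, 0 ≤ ψ x) → 0 ≤ elForm α lam u g ψ k)
    (hz : elForm α lam u g u g = 0) {x y : ℝ} (hxy : x < y) (hy : y ≤ x + 2 * π)
    (hpos : ∀ t ∈ Icc x y, 0 < u t) : α * (y - x) ≤ 2 * π := by
  have hd : 0 < y - x := sub_pos.2 hxy
  -- The test function is one full sine wave on `[x, y]`. It has mean zero, so the mass is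
  -- preserved, and its form is `(w ^ 2 - α ^ 2) * (y - x) / 2`.
  set w := 2 * π / (y - x) with hw
  have hw0 : 0 < w := by positivity
  have hwd : w * (y - x) = 2 * π := by rw [hw]; field_simp
  set k₀ : ℝ → ℝ := fun t => w * cos (w * (t - x)) with hk₀
  have hk₀c : Continuous k₀ := by fun_prop
  have hprim : ∀ t, ∫ s in x..t, k₀ s = sin (w * (t - x)) := by
    intro t
    have hder : ∀ s ∈ uIcc x t, HasDerivAt (fun s => sin (w * (s - x))) (k₀ s) s := by
      intro s _
      have := (((hasDerivAt_id s).sub_const x).const_mul w).sin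
      simp only [id_eq, mul_one] at this
      exact this.congr_deriv (mul_comm _ _)
    rw [intervalIntegral.integral_eq_sub_of_hasDerivAt hder (hk₀c.intervalIntegrable _ _)]
    simp
  obtain ⟨ψ, k, hψ, h1, h2, h3, h4⟩ := exists_test hxy.le hy hk₀c.measurable
    (Continuous.intervalIntegrable (by fun_prop) _ _) (by rw [hprim, hwd, sin_two_pi])
  obtain ⟨C, hC0, hC⟩ := abs_test_le h hu.1.2.2.2.1 hpos hψ h2
  have hzero := elForm_eq_zero h hψ hnn hz hC
  have hψm : ∫ θ in (-π)..π, ψ θ = 0 := by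
    rw [integral_period_eq_of_zero hψ.per hy (fun a b => hψ.cont.intervalIntegrable a b)
      fun t ht => h2 t (Ioo_subset_Icc_self ht)]
    have e : ∫ t in x..y, ψ t = ∫ t in x..y, sin (w * (t - x)) := by
      refine intervalIntegral.integral_congr fun t ht => ?_
      rw [uIcc_of_le hxy.le] at ht
      rw [h1 t ht, hprim]
    have hder : ∀ s ∈ uIcc x y, HasDerivAt (fun s => -cos (w * (s - x)) / w) (sin (w * (s - x))) s := by
      intro s _
      have := ((((hasDerivAt_id s).sub_const x).const_mul w).cos).neg.div_const w
      simp only [id_eq, mul_one] at this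
      exact this.congr_deriv (by field_simp)
    rw [e, intervalIntegral.integral_eq_sub_of_hasDerivAt hder
      (Continuous.intervalIntegrable (by fun_prop) _ _), hwd]
    simp
  rw [h.elForm_eq hψ, hψm, mul_zero, sub_zero] at hzero
  have hform : filmForm α ψ k ψ k = (w ^ 2 - α ^ 2) * (y - x) / 2 := by
    rw [filmForm, integral_period_eq_of_zero (fun t => by simp [hψ.per t, hψ.dper t]) hy
      (hψ.form_int hψ α) fun t ht => by
        simp [h4 t (Ioo_subset_Ico_self ht), h2 t (Ioo_subset_Icc_self ht)]]
    have e : ∫ t in x..y, (k t * k t - α ^ 2 * (ψ t * ψ t))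
        = ∫ t in x..y, ((w ^ 2 - α ^ 2) / 2 + (w ^ 2 + α ^ 2) / 2 * cos (2 * w * (t - x))) := by
      refine intervalIntegral.integral_congr_uIoo fun t ht => ?_
      rw [uIoo_of_le hxy.le] at ht
      simp only [h3 t (Ioo_subset_Ico_self ht), h1 t (Ioo_subset_Icc_self ht), hprim]
      simp only [hk₀]
      rw [show 2 * w * (t - x) = 2 * (w * (t - x)) by ring, cos_two_mul]
      have := sin_sq_add_cos_sq (w * (t - x))
      linear_combination (-α ^ 2) * this
    have hder : ∀ s ∈ uIcc x y, HasDerivAt (fun s => (w ^ 2 - α ^ 2) / 2 * s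
        + (w ^ 2 + α ^ 2) / 2 * (sin (2 * w * (s - x)) / (2 * w)))
        ((w ^ 2 - α ^ 2) / 2 + (w ^ 2 + α ^ 2) / 2 * cos (2 * w * (s - x))) s := by
      intro s _
      have := ((hasDerivAt_id s).const_mul ((w ^ 2 - α ^ 2) / 2)).add
        ((((((hasDerivAt_id s).sub_const x).const_mul (2 * w)).sin).div_const (2 * w)).const_mul
          ((w ^ 2 + α ^ 2) / 2))
      simp only [id_eq, mul_one] at this
      exact this.congr_deriv (by field_simp)
    rw [e, intervalIntegral.integral_eq_sub_of_hasDerivAt hder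
      (Continuous.intervalIntegrable (by fun_prop) _ _),
      show 2 * w * (y - x) = 2 * π + 2 * π by rw [← hwd]; ring, sin_add_two_pi, sin_two_pi]
    simp
    ring
  -- The amplitude is small enough for nonnegativity. The first order term vanishes, so minimality
  -- gives the sign of the form of `ψ`.
  have hmem : (fun t => u t + (1 / (C + 1)) * ψ t) ∈ massClass M := by
    refine (h.add (hψ.const_mul _)).mem (fun t => ?_) ?_
    · have e1 := (abs_le.1 (hC t)).1
      have e2 : 0 ≤ u t := hu.1.2.2.2.1 t
      have e3 : -((C + 1) * u t) ≤ ψ t := by linarith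
      rw [one_div_mul_eq_div, ← neg_le_iff_add_nonneg', le_div_iff₀ (by linarith)]
      linarith
    · rw [intervalIntegral.integral_add (h.cont.intervalIntegrable _ _)
        ((hψ.const_mul _).cont.intervalIntegrable _ _), intervalIntegral.integral_const_mul, hψm,
        hu.1.2.2.2.2]
      ring
  have hmin : filmEnergy α u ≤ filmEnergy α (fun t => u t + (1 / (C + 1)) * ψ t) := hu.2 hmem
  rw [h.energy_add hψ, hzero, hform] at hmin
  have hC1 : 0 < (1 / (C + 1)) ^ 2 / 2 := by positivity
  have h6 : 0 ≤ (w ^ 2 - α ^ 2) * (y - x) / 2 := by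
    by_contra! hneg
    nlinarith
  have h7 : α ^ 2 ≤ w ^ 2 := by
    by_contra! hneg
    nlinarith
  have h8 : α ≤ w := by
    rw [← abs_of_nonneg hα, ← abs_of_pos hw0]
    exact sq_le_sq.1 h7
  rw [← hwd]
  exact mul_le_mul_of_nonneg_right h8 hd.le

end

/-! ### Films: the Euler–Lagrange equation and zero contact angle -/

/-- The regularity properties of minimizers of mass `M`, with Lagrange multiplier `lam`. -/
structure IsFilm (α lam M : ℝ) (u : ℝ → ℝ) : Prop where
  per : Function.Periodic u (2 * π)
  nonneg : ∀ t, 0 ≤ u t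
  mass : ∫ t in (-π)..π, u t = M
  diff : ∀ t, HasDerivAt u (deriv u t) t
  zero : ∀ t, u t = 0 → deriv u t = 0
  ode : ∀ a b, a < b → (∀ t ∈ Ioo a b, 0 < u t) → ∀ t ∈ Icc a b,
    deriv u t = deriv u a - ∫ s in a..t, (α ^ 2 * u s + cos s + lam)
  len : ∀ x y, x < y → y ≤ x + 2 * π → (∀ t ∈ Icc x y, 0 < u t) → α * (y - x) ≤ 2 * π

section
variable {α M lam : ℝ} {u g : ℝ → ℝ}

/-- Near a zero `u` lies between `0` and a parabola, because each of the two nonnegative terms in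
`quadratic_bound_at_zero` is bounded by their sum. -/
lemma IsH1.hasDerivAt_zero_of_zero (h : IsH1 u g) (h0 : ∀ t, 0 ≤ u t)
    (hnn : ∀ ψ k, IsH1 ψ k → (∀ x, 0 ≤ ψ x) → 0 ≤ elForm α lam u g ψ k) {a : ℝ} (ha : u a = 0) :
    HasDerivAt u 0 a := by
  obtain ⟨B, hB⟩ := isCompact_Icc.exists_bound_of_continuousOn (s := Icc (0 : ℝ) (0 + 2 * π))
    (f := u) h.cont.continuousOn
  have hB' : ∀ t, |u t| ≤ B :=
    forall_of_periodic 0 (fun t => by rw [h.per t]) fun t ht => hB t (Ico_subset_Icc_self ht)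
  set C := α ^ 2 * B + 1 + |lam| with hC
  have hCb : ∀ t, |α ^ 2 * u t + cos t + lam| ≤ C := by
    intro t
    refine (abs_add_le _ _).trans (add_le_add_left ((abs_add_le _ _).trans
      (add_le_add ?_ (abs_cos_le_one t))) _)
    rw [abs_mul, abs_of_nonneg (sq_nonneg α)]
    exact mul_le_mul_of_nonneg_left (hB' t) (sq_nonneg α)
  have hC0 : 0 ≤ C := (abs_nonneg _).trans (hCb 0)
  have hquad : ∀ s, 0 < |s| → |s| ≤ π → u (a + s) ≤ 2 * C * s ^ 2 := by
    intro s hs hs'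
    have h1 := quadratic_bound_at_zero h hnn ha hCb hs hs'
    rw [sq_abs] at h1
    rcases abs_choice s with h2 | h2 <;> rw [h2] at h1
    · linarith [h0 (a - s)]
    · rw [sub_neg_eq_add] at h1
      linarith [h0 (a + -s)]
  rw [hasDerivAt_iff_isLittleO_nhds_zero, Asymptotics.isLittleO_iff]
  intro c hc
  have h1 : ∀ᶠ s : ℝ in 𝓝 0, |s| < min π (c / (2 * C + 1)) := by
    have : ContinuousAt (fun s : ℝ => |s|) 0 := continuous_abs.continuousAt
    refine this.eventually (gt_mem_nhds ?_)
    simp only [abs_zero]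
    exact lt_min pi_pos (by positivity)
  filter_upwards [h1] with s hs
  rw [ha, norm_eq_abs, norm_eq_abs, smul_zero, sub_zero, sub_zero, abs_of_nonneg (h0 _)]
  rcases eq_or_ne s 0 with rfl | hs0
  · simp [ha]
  · have h2 := hquad s (abs_pos.2 hs0) (hs.le.trans (min_le_left _ _))
    have h3 : |s| ≤ c / (2 * C + 1) := hs.le.trans (min_le_right _ _)
    rw [le_div_iff₀ (by linarith)] at h3
    rw [← sq_abs] at h2
    nlinarith [abs_nonneg s]

lemma IsH1.exists_nhds_slope (h : IsH1 u g) (h0 : ∀ t, 0 ≤ u t)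
    (hnn : ∀ ψ k, IsH1 ψ k → (∀ x, 0 ≤ ψ x) → 0 ≤ elForm α lam u g ψ k)
    (hz : elForm α lam u g u g = 0) {t : ℝ} (ht : 0 < u t) :
    ∃ p, ∀ᶠ s in 𝓝 t, HasDerivAt u (p - ∫ r in (0 : ℝ)..s, (α ^ 2 * u r + cos r + lam)) s := by
  have hcu := h.cont
  have h1 : ∀ᶠ s in 𝓝 t, 0 < u s := hcu.continuousAt.eventually (lt_mem_nhds ht)
  obtain ⟨δ, hδ, hball⟩ := Metric.eventually_nhds_iff.1 h1
  set ρ := min (δ / 2) 1 with hρ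
  have hρ0 : 0 < ρ := lt_min (by linarith) one_pos
  have hpos : ∀ s ∈ Icc (t - ρ) (t + ρ), 0 < u s := by
    intro s hs
    refine hball ?_
    rw [Real.dist_eq, abs_lt]
    have : ρ ≤ δ / 2 := min_le_left _ _
    constructor <;> linarith [hs.1, hs.2]
  obtain ⟨p, hp⟩ := exists_slope_of_pos h h0 hnn hz (x := t - ρ) (y := t + ρ) (by linarith)
    (by linarith [min_le_right (δ / 2) 1, pi_gt_three]) hpos
  refine ⟨p, ?_⟩
  have hGc : Continuous fun s => p - ∫ r in (0 : ℝ)..s, (α ^ 2 * u r + cos r + lam) := by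
    have hrc : Continuous fun r => α ^ 2 * u r + cos r + lam := by fun_prop
    exact continuous_const.sub (intervalIntegral.continuous_primitive
      (fun a b => hrc.intervalIntegrable a b) 0)
  filter_upwards [Ioo_mem_nhds (show t - ρ < t by linarith) (show t < t + ρ by linarith)] with s hs
  have h2 := (hasDerivAt_primitive hGc (t - ρ) s).add_const (u (t - ρ))
  refine h2.congr_of_eventuallyEq ?_
  filter_upwards [Ioo_mem_nhds hs.1 hs.2] with r hr
  have := hp r (Ioo_subset_Icc_self hr)
  linarith

lemma exists_isFilm (hα : 0 ≤ α) (hM : 0 < M) (hu : IsEnergyMinimizer α M u) :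
    ∃ lam, IsFilm α lam M u := by
  have h := IsH1.of_mem hu.1
  have h0 : ∀ t, 0 ≤ u t := hu.1.2.2.2.1
  have hcu := h.cont
  obtain ⟨lam, hnn, hz⟩ := exists_multiplier hM hu h
  have hzero : ∀ t, u t = 0 → HasDerivAt u 0 t := fun t ht => h.hasDerivAt_zero_of_zero h0 hnn ht
  have hdiff : ∀ t, HasDerivAt u (deriv u t) t := by
    intro t
    rcases (h0 t).eq_or_lt with ht | ht
    · exact (hzero t ht.symm).differentiableAt.hasDerivAt
    · obtain ⟨p, hp⟩ := h.exists_nhds_slope h0 hnn hz ht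
      exact hp.self_of_nhds.differentiableAt.hasDerivAt
  have hrc : Continuous fun r => α ^ 2 * u r + cos r + lam := by fun_prop
  have hsecond : ∀ t, 0 < u t → HasDerivAt (deriv u) (-(α ^ 2 * u t + cos t + lam)) t := by
    intro t ht
    obtain ⟨p, hp⟩ := h.exists_nhds_slope h0 hnn hz ht
    have h1 := (hasDerivAt_primitive hrc 0 t).const_sub p
    refine h1.congr_of_eventuallyEq ?_
    filter_upwards [hp] with s hs
    exact hs.deriv
  refine ⟨lam, h.per, h0, hu.1.2.2.2.2, hdiff, fun t ht => (hzero t ht).deriv, ?_,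
    fun x y hxy hy hpos => length_le_of_pos hα hu h hnn hz hxy hy hpos⟩
  intro a b hab hpos
  -- the derivative plus the primitive of the force is constant on the open interval
  set G : ℝ → ℝ := fun t => ∫ s in a..t, (α ^ 2 * u s + cos s + lam) with hG
  have hGc : Continuous G := intervalIntegral.continuous_primitive
      (fun a b => hrc.intervalIntegrable a b) a
  obtain ⟨p, hp⟩ : ∃ p, ∀ t ∈ Ioo a b, deriv u t + G t = p := by
    refine isOpen_Ioo.exists_is_const_of_deriv_eq_zero isPreconnected_Ioo (fun t ht => ?_)
      fun t ht => ?_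
    · exact ((hsecond t (hpos t ht)).add
        (hasDerivAt_primitive hrc a t)).differentiableAt.differentiableWithinAt
    · have := (hsecond t (hpos t ht)).add (hasDerivAt_primitive hrc a t)
      rw [neg_add_cancel] at this
      exact this.deriv
  have hin : ∀ t ∈ Ioo a b, deriv u t = p - G t := fun t ht => by linarith [hp t ht]
  have hdiffon : DifferentiableOn ℝ u (Ioo a b) := fun t _ =>
    (hdiff t).differentiableAt.differentiableWithinAt
  have hlimc : Continuous fun t => p - G t := continuous_const.sub hGc
  -- At an endpoint the limit of the derivative from inside is the one-sided derivative, which is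
  -- `deriv u` there since `u` is differentiable.
  have ha : deriv u a = p - G a := by
    have h1 : HasDerivWithinAt u (p - G a) (Ici a) a := by
      refine hasDerivWithinAt_Ici_of_tendsto_deriv hdiffon hcu.continuousAt.continuousWithinAt
        (Ioo_mem_nhdsGT hab) ?_
      refine ((hlimc.tendsto a).mono_left nhdsWithin_le_nhds).congr' ?_
      filter_upwards [Ioo_mem_nhdsGT hab] with t ht
      exact (hin t ht).symm
    exact (uniqueDiffWithinAt_Ici a).eq_deriv _ (hdiff a).hasDerivWithinAt h1
  have hb : deriv u b = p - G b := by
    have h1 : HasDerivWithinAt u (p - G b) (Iic b) b := by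
      refine hasDerivWithinAt_Iic_of_tendsto_deriv hdiffon hcu.continuousAt.continuousWithinAt
        (Ioo_mem_nhdsLT hab) ?_
      refine ((hlimc.tendsto b).mono_left nhdsWithin_le_nhds).congr' ?_
      filter_upwards [Ioo_mem_nhdsLT hab] with t ht
      exact (hin t ht).symm
    exact (uniqueDiffWithinAt_Iic b).eq_deriv _ (hdiff b).hasDerivWithinAt h1
  have hGa : G a = 0 := by simp [hG]
  intro t ht
  change deriv u t = deriv u a - G t
  rw [ha, hGa, sub_zero]
  rcases eq_or_lt_of_le ht.1 with rfl | h1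
  · rw [ha]
  rcases eq_or_lt_of_le ht.2 with rfl | h2
  · rw [hb]
  exact hin t ⟨h1, h2⟩

end

namespace IsFilm
variable {α M lam : ℝ} {u : ℝ → ℝ}

lemma cont (h : IsFilm α lam M u) : Continuous u :=
  continuous_iff_continuousAt.2 fun t => (h.diff t).continuousAt

lemma deriv_per (h : IsFilm α lam M u) : Function.Periodic (deriv u) (2 * π) := fun x => by
  rw [← deriv_comp_add_const]
  congr 1
  exact funext h.per

/-- Between two points there are a first and a last zero, unless `u` is positive. -/
lemma exists_zeros (h : IsFilm α lam M u) {x y z : ℝ} (hz : z ∈ Icc x y) (hz0 : u z = 0) :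
    ∃ a b, x ≤ a ∧ a ≤ z ∧ z ≤ b ∧ b ≤ y ∧ u a = 0 ∧ u b = 0 ∧ (∀ t ∈ Ico x a, 0 < u t) ∧
      ∀ t ∈ Ioc b y, 0 < u t := by
  have hcl : IsCompact (Icc x y ∩ u ⁻¹' {0}) :=
    isCompact_Icc.inter_right (isClosed_singleton.preimage h.cont)
  have hne : (Icc x y ∩ u ⁻¹' {0}).Nonempty := ⟨z, hz, hz0⟩
  obtain ⟨a, ⟨ha, ha0⟩, hamin⟩ := hcl.exists_isLeast hne
  obtain ⟨b, ⟨hb, hb0⟩, hbmax⟩ := hcl.exists_isGreatest hne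
  refine ⟨a, b, ha.1, hamin ⟨hz, hz0⟩, hbmax ⟨hz, hz0⟩, hb.2, ha0, hb0, fun t ht => ?_,
    fun t ht => ?_⟩
  · refine (h.nonneg t).lt_of_ne fun h0 => ?_
    have := hamin ⟨⟨ht.1, ht.2.le.trans ha.2⟩, h0.symm⟩
    linarith [ht.2]
  · refine (h.nonneg t).lt_of_ne fun h0 => ?_
    have := hbmax ⟨⟨hb.1.trans ht.1.le, ht.2⟩, h0.symm⟩
    linarith [ht.1]

lemma abs_deriv_sub_le (h : IsFilm α lam M u) {K : ℝ}
    (hK : ∀ t, |α ^ 2 * u t + cos t + lam| ≤ K) {a b : ℝ} (hab : a ≤ b)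
    (hpos : ∀ t ∈ Ioo a b, 0 < u t) : |deriv u b - deriv u a| ≤ K * (b - a) := by
  rcases hab.eq_or_lt with rfl | hab
  · simp
  · have h1 := intervalIntegral.norm_integral_le_of_norm_le_const (a := a) (b := b) (C := K)
      (f := fun s => α ^ 2 * u s + cos s + lam) fun t _ => hK t
    rw [h.ode a b hab hpos b (right_mem_Icc.2 hab.le), sub_sub_cancel_left, abs_neg]
    rwa [norm_eq_abs, abs_of_pos (sub_pos.2 hab)] at h1

/-- If there are zeros between two points, the derivative vanishes at the first and the last of
them. Only the two outer positive pieces count, whatever happens in between. -/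
lemma lipschitz (h : IsFilm α lam M u) {K : NNReal}
    (hK : ∀ t, |α ^ 2 * u t + cos t + lam| ≤ K) : LipschitzWith K (deriv u) := by
  have key : ∀ x y, x ≤ y → |deriv u y - deriv u x| ≤ K * (y - x) := by
    intro x y hxy
    by_cases hz : ∃ z ∈ Icc x y, u z = 0
    · obtain ⟨z, hz, hz0⟩ := hz
      obtain ⟨a, b, hxa, haz, hzb, hby, ha0, hb0, h1, h2⟩ := h.exists_zeros hz hz0
      have e1 := h.abs_deriv_sub_le hK hxa fun t ht => h1 t (Ioo_subset_Ico_self ht)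
      have e2 := h.abs_deriv_sub_le hK hby fun t ht => h2 t (Ioo_subset_Ioc_self ht)
      rw [h.zero a ha0, zero_sub, abs_neg] at e1
      rw [h.zero b hb0, sub_zero] at e2
      have h3 : (K : ℝ) * (a - x) + K * (y - b) ≤ K * (y - x) := by
        rw [← mul_add]
        exact mul_le_mul_of_nonneg_left (by linarith) K.coe_nonneg
      exact (abs_sub _ _).trans (by linarith)
    · push Not at hz
      exact h.abs_deriv_sub_le hK hxy fun t ht =>
        (h.nonneg t).lt_of_ne (hz t (Ioo_subset_Icc_self ht)).symm
  refine LipschitzWith.of_dist_le_mul fun x y => ?_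
  rw [Real.dist_eq, Real.dist_eq]
  rcases le_total x y with hxy | hxy
  · rw [abs_sub_comm, abs_sub_comm x, abs_of_nonneg (sub_nonneg.2 hxy)]
    exact key x y hxy
  · rw [abs_of_nonneg (sub_nonneg.2 hxy)]
    exact key y x hxy

end IsFilm

/-! ### The homogeneous equation and Sturm comparison -/

/-- The solution of `y'' + α² y = 0` with `y(0) = 0`, `y'(0) = 1`. -/
noncomputable def sinKernel (α t : ℝ) : ℝ := if α = 0 then t else sin (α * t) / α

lemma sinKernel_zero (α : ℝ) : sinKernel α 0 = 0 := by
  unfold sinKernel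
  split_ifs <;> simp

lemma sinKernel_neg (α t : ℝ) : sinKernel α (-t) = -sinKernel α t := by
  unfold sinKernel
  split_ifs
  · rfl
  · rw [mul_neg, sin_neg, neg_div]

lemma hasDerivAt_sinKernel (α t : ℝ) : HasDerivAt (sinKernel α) (cos (α * t)) t := by
  unfold sinKernel
  split_ifs with h
  · subst h
    simpa using hasDerivAt_id' t
  · have := (((hasDerivAt_id t).const_mul α).sin).div_const α
    simp only [id_eq, mul_one] at this
    exact this.congr_deriv (by field_simp)

lemma hasDerivAt_cosKernel (α t : ℝ) :
    HasDerivAt (fun t => cos (α * t)) (-(α ^ 2 * sinKernel α t)) t := by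
  have := ((hasDerivAt_id t).const_mul α).cos
  simp only [id_eq, mul_one] at this
  refine this.congr_deriv ?_
  unfold sinKernel
  split_ifs with h
  · simp [h]
  · field_simp

lemma cosKernel_sq_add (α t : ℝ) : cos (α * t) ^ 2 + α ^ 2 * sinKernel α t ^ 2 = 1 := by
  unfold sinKernel
  split_ifs with h
  · simp [h]
  · rw [div_pow, mul_div_cancel₀ _ (pow_ne_zero 2 h)]
    exact cos_sq_add_sin_sq _

lemma sinKernel_pos {α t : ℝ} (hα : 0 ≤ α) (ht : 0 < t) (h : α * t < π) : 0 < sinKernel α t := by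
  unfold sinKernel
  split_ifs with h0
  · exact ht
  · have hα' : 0 < α := lt_of_le_of_ne hα (Ne.symm h0)
    exact div_pos (sin_pos_of_pos_of_lt_pi (by positivity) h) hα'

lemma eq_of_hasDerivAt_zero {F : ℝ → ℝ} {s : Set ℝ} (hs : Convex ℝ s)
    (hF : ∀ t ∈ s, HasDerivAt F 0 t) {x y : ℝ} (hx : x ∈ s) (hy : y ∈ s) : F x = F y := by
  have := hs.norm_image_sub_le_of_norm_hasDerivWithin_le (C := 0)
    (fun t ht => (hF t ht).hasDerivWithinAt) (fun t _ => by simp) hx hy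
  rw [zero_mul, norm_le_zero_iff, sub_eq_zero] at this
  exact this.symm

lemma strictMonoOn_of_hasDerivAt_pos {F F' : ℝ → ℝ} {a b : ℝ}
    (hF : ∀ t ∈ Icc a b, HasDerivAt F (F' t) t) (hpos : ∀ t ∈ Ioo a b, 0 < F' t) :
    StrictMonoOn F (Icc a b) := by
  refine strictMonoOn_of_deriv_pos (convex_Icc a b)
    (fun t ht => (hF t ht).continuousAt.continuousWithinAt) fun t ht => ?_
  rw [interior_Icc] at ht
  rw [(hF t (Ioo_subset_Icc_self ht)).deriv]
  exact hpos t ht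

lemma strictAntiOn_of_hasDerivAt_neg {F F' : ℝ → ℝ} {a b : ℝ}
    (hF : ∀ t ∈ Icc a b, HasDerivAt F (F' t) t) (hneg : ∀ t ∈ Ioo a b, F' t < 0) :
    StrictAntiOn F (Icc a b) := by
  have := strictMonoOn_of_hasDerivAt_pos (F := fun t => -F t) (F' := fun t => -F' t)
    (fun t ht => (hF t ht).neg) fun t ht => neg_pos.2 (hneg t ht)
  intro x hx y hy hxy
  exact neg_lt_neg_iff.1 (this hx hy hxy)

/-- Solutions of `y'' + α² y = 0`. -/
lemma eq_of_homogeneous_ode {α : ℝ} {y y₁ : ℝ → ℝ} {s : Set ℝ} (hs : Convex ℝ s)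
    (hy : ∀ t ∈ s, HasDerivAt y (y₁ t) t) (hy₁ : ∀ t ∈ s, HasDerivAt y₁ (-(α ^ 2 * y t)) t)
    (h0 : (0 : ℝ) ∈ s) {t : ℝ} (ht : t ∈ s) :
    y t = cos (α * t) * y 0 + sinKernel α t * y₁ 0 ∧
      y₁ t = cos (α * t) * y₁ 0 - α ^ 2 * sinKernel α t * y 0 := by
  -- Two conserved quantities, which form an invertible linear system for `y` and `y₁` by the
  -- Pythagorean identity.
  have e1 := eq_of_hasDerivAt_zero (F := fun t => y t * cos (α * t) - y₁ t * sinKernel α t) hs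
    (fun t ht => (((hy t ht).mul (hasDerivAt_cosKernel α t)).sub
      ((hy₁ t ht).mul (hasDerivAt_sinKernel α t))).congr_deriv (by ring)) ht h0
  have e2 := eq_of_hasDerivAt_zero
    (F := fun t => α ^ 2 * (y t * sinKernel α t) + y₁ t * cos (α * t)) hs
    (fun t ht => ((((hy t ht).mul (hasDerivAt_sinKernel α t)).const_mul (α ^ 2)).add
      ((hy₁ t ht).mul (hasDerivAt_cosKernel α t))).congr_deriv (by ring)) ht h0
  simp only [mul_zero, cos_zero, mul_one, sinKernel_zero, sub_zero, zero_add] at e1 e2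
  have hp := cosKernel_sq_add α t
  constructor
  · rw [← e1, ← e2]
    linear_combination (-y t) * hp
  · rw [← e1, ← e2]
    linear_combination (-y₁ t) * hp

/-- The solution of `z'' + α² z = sin` with zero boundary values is negative. -/
lemma neg_of_forced_ode {α l : ℝ} (hα : 0 ≤ α) {z z₁ : ℝ → ℝ} (hl : 0 < l) (hlπ : l ≤ π)
    (hαl : α * l ≤ π) (hz : ∀ t ∈ Icc 0 l, HasDerivAt z (z₁ t) t)
    (hz₁ : ∀ t ∈ Icc 0 l, HasDerivAt z₁ (-(α ^ 2 * z t) + sin t) t) (h0 : z 0 = 0)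
    (hl0 : z l = 0) : α * l < π ∧ ∀ t ∈ Ioo 0 l, z t < 0 := by
  have hS : ∀ t ∈ Ioo 0 l, 0 < sinKernel α t := fun t ht =>
    sinKernel_pos hα ht.1 (by
      rcases hα.eq_or_lt with rfl | hα'
      · simpa using pi_pos
      · nlinarith [ht.2])
  -- The Wronskian of `z` with `sinKernel` has derivative `sin * sinKernel`, and it starts from
  -- zero.
  have hW : StrictMonoOn (fun t => z₁ t * sinKernel α t - z t * cos (α * t)) (Icc 0 l) := by
    refine strictMonoOn_of_hasDerivAt_pos (F' := fun t => sin t * sinKernel α t) (fun t ht => ?_)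
      fun t ht => mul_pos (sin_pos_of_pos_of_lt_pi ht.1 (ht.2.trans_le hlπ)) (hS t ht)
    exact (((hz₁ t ht).mul (hasDerivAt_sinKernel α t)).sub
      ((hz t ht).mul (hasDerivAt_cosKernel α t))).congr_deriv (by ring)
  have hW0 : ∀ t ∈ Ioc 0 l, 0 < z₁ t * sinKernel α t - z t * cos (α * t) := by
    intro t ht
    have := hW (left_mem_Icc.2 hl.le) (Ioc_subset_Icc_self ht) ht.1
    simpa [sinKernel_zero, h0] using this
  -- If `α * l` were `π`, both `z` and `sinKernel` would vanish at `l`, and so would the positive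
  -- Wronskian.
  have hlt : α * l < π := by
    refine hαl.lt_of_ne fun heq => ?_
    have h1 := hW0 l (right_mem_Ioc.2 hl)
    have h2 : sinKernel α l = 0 := by
      have : α ≠ 0 := by
        rintro rfl
        rw [zero_mul] at heq
        exact pi_ne_zero heq.symm
      rw [sinKernel, if_neg this, heq, sin_pi, zero_div]
    rw [h2, hl0] at h1
    simp at h1
  have hSl : ∀ t ∈ Ioc 0 l, 0 < sinKernel α t := fun t ht =>
    sinKernel_pos hα ht.1 ((mul_le_mul_of_nonneg_left ht.2 hα).trans_lt hlt)
  refine ⟨hlt, fun t ht => ?_⟩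
  -- The Wronskian is the numerator of the derivative of this quotient, which therefore increases to
  -- its value `0` at `l`.
  have hq : StrictMonoOn (fun t => z t / sinKernel α t) (Icc t l) := by
    refine strictMonoOn_of_hasDerivAt_pos
      (F' := fun t => (z₁ t * sinKernel α t - z t * cos (α * t)) / sinKernel α t ^ 2)
      (fun s hs => ?_) fun s hs => ?_
    · exact (hz s ⟨ht.1.le.trans hs.1, hs.2⟩).div (hasDerivAt_sinKernel α s)
        (hSl s ⟨ht.1.trans_le hs.1, hs.2⟩).ne'
    · have hs' : s ∈ Ioc 0 l := ⟨ht.1.trans hs.1, hs.2.le⟩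
      have := hSl s hs'
      exact div_pos (hW0 s hs') (by positivity)
  have h1 := hq (left_mem_Icc.2 ht.2.le) (right_mem_Icc.2 ht.2.le) ht.2
  simp only [hl0, zero_div] at h1
  have h2 := hS t ht
  by_contra! h3
  exact absurd h1 (not_lt.2 (div_nonneg h3 h2.le))

/-! ### Shape of a wet component -/

/-- A component of the wet region is centred at a multiple of `2π`, `u` is symmetric about
the centre, and `u` decreases away from it. -/
lemma component_structure {α lam a b : ℝ} (hα : 0 ≤ α) {u q : ℝ → ℝ} (hab : a < b)
    (hu : ∀ t ∈ Icc a b, HasDerivAt u (q t) t)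
    (hq : ∀ t ∈ Icc a b, HasDerivAt q (-(α ^ 2 * u t + cos t + lam)) t)
    (hpos : ∀ t ∈ Ioo a b, 0 < u t) (ha : u a = 0) (hb : u b = 0) (hqa : q a = 0) (hqb : q b = 0)
    (hlen : b - a ≤ 2 * π) (hαlen : α * (b - a) ≤ 2 * π) :
    cos ((a + b) / 2) = 1 ∧ α * ((b - a) / 2) < π ∧
      (∀ s ∈ Icc 0 ((b - a) / 2), u ((a + b) / 2 + s) = u ((a + b) / 2 - s)) ∧
      ∀ s ∈ Ioo 0 ((b - a) / 2), q ((a + b) / 2 + s) < 0 := by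
  set c := (a + b) / 2 with hc
  set l := (b - a) / 2 with hl
  have hl0 : 0 < l := by rw [hl]; linarith
  have hcl : c + l = b := by rw [hc, hl]; ring
  have hcl' : c - l = a := by rw [hc, hl]; ring
  have hlπ : l ≤ π := by rw [hl]; linarith
  have hαl : α * l ≤ π := by rw [hl]; linarith
  have hS : ∀ t ∈ Ioo 0 l, 0 < sinKernel α t := fun t ht =>
    sinKernel_pos hα ht.1 (by
      rcases hα.eq_or_lt with rfl | hα'
      · simpa using pi_pos
      · nlinarith [ht.2])
  have hmem1 : ∀ s ∈ Icc 0 l, c + s ∈ Icc a b := fun s hs =>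
    ⟨by linarith [hs.1], by linarith [hs.2]⟩
  have hmem2 : ∀ s ∈ Icc 0 l, c - s ∈ Icc a b := fun s hs =>
    ⟨by linarith [hs.2], by linarith [hs.1]⟩
  have du1 : ∀ s ∈ Icc 0 l, HasDerivAt (fun s => u (c + s)) (q (c + s)) s := fun s hs =>
    (hu _ (hmem1 s hs)).comp_const_add c s
  have du2 : ∀ s ∈ Icc 0 l, HasDerivAt (fun s => u (c - s)) (-q (c - s)) s := fun s hs =>
    (hu _ (hmem2 s hs)).comp_const_sub c s
  have dq1 : ∀ s ∈ Icc 0 l, HasDerivAt (fun s => q (c + s))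
      (-(α ^ 2 * u (c + s) + cos (c + s) + lam)) s := fun s hs =>
    (hq _ (hmem1 s hs)).comp_const_add c s
  have dq2 : ∀ s ∈ Icc 0 l, HasDerivAt (fun s => q (c - s))
      (-(-(α ^ 2 * u (c - s) + cos (c - s) + lam))) s := fun s hs =>
    (hq _ (hmem2 s hs)).comp_const_sub c s
  -- the centre
  have hsin : sin c = 0 := by
    by_contra hne
    -- Twice the odd part of `u` about `c` is forced by `2 * sin c * sin s`. Its Wronskian with
    -- `sinKernel`, multiplied by `sin c`, would strictly increase, but it is zero at `0` and at
    -- `l`.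
    have hV : StrictMonoOn (fun s => sin c * (((q (c + s) + q (c - s)) * sinKernel α s)
        - (u (c + s) - u (c - s)) * cos (α * s))) (Icc 0 l) := by
      refine strictMonoOn_of_hasDerivAt_pos
        (F' := fun s => 2 * sin c ^ 2 * sin s * sinKernel α s) (fun s hs => ?_) fun s hs => ?_
      · refine (((((dq1 s hs).add (dq2 s hs)).mul (hasDerivAt_sinKernel α s)).sub
          (((du1 s hs).sub (du2 s hs)).mul (hasDerivAt_cosKernel α s))).const_mul
          (sin c)).congr_deriv ?_
        simp only [Pi.add_apply, Pi.sub_apply]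
        rw [cos_add, cos_sub]
        ring
      · have h1 := sin_pos_of_pos_of_lt_pi hs.1 (hs.2.trans_le hlπ)
        have h2 := hS s hs
        positivity
    have := hV (left_mem_Icc.2 hl0.le) (right_mem_Icc.2 hl0.le) hl0
    simp [hcl, hcl', ha, hb, hqa, hqb, sinKernel_zero] at this
  -- symmetry
  have heven : ∀ s ∈ Icc 0 l, u (c + s) - u (c - s) = 0 ∧ q (c + s) + q (c - s) = 0 := by
    have key : ∀ s ∈ Icc 0 l, _ := fun s hs => eq_of_homogeneous_ode (α := α)
      (y := fun s => u (c + s) - u (c - s)) (y₁ := fun s => q (c + s) + q (c - s)) (convex_Icc 0 l)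
      (fun s hs => ((du1 s hs).sub (du2 s hs)).congr_deriv (by ring))
      (fun s hs => ((dq1 s hs).add (dq2 s hs)).congr_deriv (by
        rw [cos_add, cos_sub, hsin]
        ring)) (left_mem_Icc.2 hl0.le) hs
    have h1 := key l (right_mem_Icc.2 hl0.le)
    simp only [add_zero, sub_zero, sub_self, mul_zero, zero_add, hcl, hcl', ha, hb, hqa, hqb] at h1
    -- Once `sin c = 0` the odd part solves the homogeneous equation and has zero data at `l`, so
    -- its data at `0` vanish too.
    have h2 : q c + q c = 0 := by
      have hp := cosKernel_sq_add α l
      linear_combination (-(q c + q c)) * hp - cos (α * l) * h1.2 - α ^ 2 * sinKernel α l * h1.1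
    intro s hs
    have h3 := key s hs
    simp only [add_zero, sub_zero, sub_self, mul_zero, h2] at h3
    exact h3
  have hqc : q c = 0 := by
    have := (heven 0 (left_mem_Icc.2 hl0.le)).2
    simp only [add_zero, sub_zero] at this
    linarith
  have hcos : cos c = 1 ∨ cos c = -1 := by
    have := sin_sq_add_cos_sq c
    rw [hsin] at this
    rw [← sq_eq_one_iff]
    linarith
  have hzero : ∀ s ∈ Icc 0 l, u (c + s) = u (c - s) := fun s hs => by linarith [(heven s hs).1]
  rcases hcos with h1 | h1
  · obtain ⟨h2, h3⟩ := neg_of_forced_ode hα (z := fun s => q (c + s)) hl0 hlπ hαl dq1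
      (fun s hs => (((((du1 s hs).const_mul (α ^ 2)).add
        ((hasDerivAt_cos (c + s)).comp_const_add c s)).add_const lam).neg).congr_deriv (by
          rw [sin_add, hsin, h1]
          ring)) (by simpa using hqc) (by simpa [hcl] using hqb)
    exact ⟨h1, h2, hzero, h3⟩
  -- With `cos c = -1` the forcing changes sign, so `u` would increase from its positive value at
  -- the centre to `0` at `b`.
  · exfalso
    obtain ⟨-, h3⟩ := neg_of_forced_ode hα (z := fun s => -q (c + s)) hl0 hlπ hαl
      (fun s hs => (dq1 s hs).neg)
      (fun s hs => (((((du1 s hs).const_mul (α ^ 2)).add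
        ((hasDerivAt_cos (c + s)).comp_const_add c s)).add_const lam).neg.neg).congr_deriv (by
          rw [sin_add, hsin, h1]
          ring)) (by simpa using hqc) (by simpa [hcl] using hqb)
    have hmono := strictMonoOn_of_hasDerivAt_pos du1 fun s hs => by linarith [h3 s hs]
    have h4 := hmono (left_mem_Icc.2 hl0.le) (right_mem_Icc.2 hl0.le) hl0
    simp only [add_zero, hcl, hb] at h4
    have h5 := hpos c ⟨by rw [hc]; linarith, by rw [hc]; linarith⟩
    linarith

lemma exists_int_abs_le (t : ℝ) : ∃ n : ℤ, |t - n * (2 * π)| ≤ π := by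
  obtain ⟨n, hn⟩ := exists_int_reduceMod (-π) t
  have hm := reduceMod_mem (-π) t
  refine ⟨n, ?_⟩
  rw [abs_le]
  constructor <;> linarith [hm.1, hm.2]

namespace IsFilm
variable {α M lam : ℝ} {u : ℝ → ℝ}

lemma int_shift (h : IsFilm α lam M u) (n : ℤ) (t : ℝ) : u (t - n * (2 * π)) = u t :=
  h.per.sub_int_mul_eq n

lemma force_cont (h : IsFilm α lam M u) : Continuous fun s => α ^ 2 * u s + cos s + lam := by
  have := h.cont
  fun_prop

/-- On an interval of positivity the derivative of `u` agrees with a `C¹` function. -/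
lemma exists_extension (h : IsFilm α lam M u) {a b : ℝ} (hab : a < b)
    (hpos : ∀ t ∈ Ioo a b, 0 < u t) : ∃ q : ℝ → ℝ,
      (∀ t, HasDerivAt q (-(α ^ 2 * u t + cos t + lam)) t) ∧
      (∀ t ∈ Icc a b, deriv u t = q t) ∧ ∀ t ∈ Icc a b, HasDerivAt u (q t) t := by
  refine ⟨fun t => deriv u a - ∫ s in a..t, (α ^ 2 * u s + cos s + lam),
    fun t => (hasDerivAt_primitive h.force_cont a t).const_sub _, h.ode a b hab hpos, ?_⟩
  intro t ht
  exact (h.diff t).congr_deriv (h.ode a b hab hpos t ht)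

lemma hasDerivAt_deriv (h : IsFilm α lam M u) {t : ℝ} (ht : 0 < u t) :
    HasDerivAt (deriv u) (-(α ^ 2 * u t + cos t + lam)) t := by
  have h1 : ∀ᶠ s in 𝓝 t, 0 < u s := h.cont.continuousAt.eventually (lt_mem_nhds ht)
  obtain ⟨δ, hδ, hball⟩ := Metric.eventually_nhds_iff_ball.1 h1
  rw [Real.ball_eq_Ioo] at hball
  obtain ⟨q, hq, hqu, -⟩ := h.exists_extension (by linarith : t - δ < t + δ) hball
  refine (hq t).congr_of_eventuallyEq ?_
  filter_upwards [Ioo_mem_nhds (show t - δ < t by linarith) (show t < t + δ by linarith)] with s hs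
  exact hqu s (Ioo_subset_Icc_self hs)

/-- A component of the wet region around a point of positivity. -/
lemma exists_component (hα : 0 ≤ α) (h : IsFilm α lam M u) {x z : ℝ} (hx : 0 < u x)
    (hz : u z = 0) : ∃ (n : ℤ) (τ : ℝ), 0 < τ ∧ τ ≤ π ∧ α * τ < π ∧ |x - n * (2 * π)| < τ ∧
      u τ = 0 ∧ u (-τ) = 0 ∧ (∀ t, |t| < τ → 0 < u t) ∧
      (∀ t, |t| ≤ τ → u (-t) = u t) ∧ ∀ t ∈ Ioo 0 τ, deriv u t < 0 := by
  -- A translate of the zero lies in the period before `x`. Take `a` as the last zero before `x` and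
  -- `b` as the first after it; `a + 2 * π` is a zero as well, so `b - a` is at most a period.
  obtain ⟨z', hz', hzz⟩ := h.per.exists_mem_Ico (by positivity : (0 : ℝ) < 2 * π) z (x - 2 * π)
  rw [hz] at hzz
  obtain ⟨-, a, -, -, hza, hax, -, ha0, -, hapos⟩ :=
    h.exists_zeros (x := x - 2 * π) (y := x) (z := z') ⟨hz'.1, by linarith [hz'.2]⟩ hzz.symm
  have hax' : a < x := lt_of_le_of_ne hax (by rintro rfl; linarith)
  have ha2 : u (a + 2 * π) = 0 := by rw [h.per, ha0]
  obtain ⟨b, -, hxb, hba, -, -, hb0, -, hbpos, -⟩ :=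
    h.exists_zeros (x := x) (y := x + 2 * π) (z := a + 2 * π)
      ⟨by linarith [hz'.1], by linarith⟩ ha2
  have hxb' : x < b := lt_of_le_of_ne hxb (by rintro rfl; linarith)
  have hab : a < b := hax'.trans hxb'
  have hpos : ∀ t ∈ Ioo a b, 0 < u t := by
    intro t ht
    rcases le_total t x with htx | htx
    · exact hapos t ⟨ht.1, htx⟩
    · exact hbpos t ⟨htx, ht.2⟩
  have hlen : b - a ≤ 2 * π := by linarith
  -- The length bound concerns closed intervals of positivity, so it is applied to `[a + ε, b - ε]`.
  have hαlen : α * (b - a) ≤ 2 * π := by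
    by_contra! hlt
    have hα0 : 0 < α := by
      refine hα.lt_of_ne ?_
      rintro rfl
      linarith [pi_pos]
    set ε := (b - a - 2 * π / α) / 4 with hε
    have hαε : α * ε = (α * (b - a) - 2 * π) / 4 := by
      rw [hε]
      field_simp
    have hε0 : 0 < ε := by
      by_contra! hneg
      nlinarith
    have hε4 : 4 * ε < b - a := by
      have : 0 < 2 * π / α := by positivity
      rw [hε]
      linarith
    have := h.len (a + ε) (b - ε) (by linarith) (by linarith) fun t ht =>
      hpos t ⟨by linarith [ht.1], by linarith [ht.2]⟩
    nlinarith
  obtain ⟨q, hq, hqu, hdu⟩ := h.exists_extension hab hpos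
  obtain ⟨hc, hαl, heven, hneg⟩ := component_structure hα hab hdu (fun t _ => hq t) hpos ha0 hb0
    (by rw [← hqu a (left_mem_Icc.2 hab.le), h.zero a ha0])
    (by rw [← hqu b (right_mem_Icc.2 hab.le), h.zero b hb0]) hlen hαlen
  obtain ⟨n, hn⟩ := (cos_eq_one_iff _).1 hc
  set τ := (b - a) / 2 with hτ
  have hb : n * (2 * π) + τ = b := by rw [hn, hτ]; ring
  have ha : n * (2 * π) - τ = a := by rw [hn, hτ]; ring
  have hshift : ∀ t, u (n * (2 * π) + t) = u t := fun t => by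
    rw [← h.int_shift n (n * (2 * π) + t)]
    congr 1
    ring
  have hshift' : ∀ t, deriv u (n * (2 * π) + t) = deriv u t := fun t => by
    rw [← h.deriv_per.sub_int_mul_eq n (x := n * (2 * π) + t)]
    congr 1
    ring
  have heven' : ∀ t ∈ Icc 0 τ, u (-t) = u t := by
    intro t ht
    have := heven t ht
    rw [← hn, sub_eq_add_neg, hshift, hshift] at this
    exact this.symm
  refine ⟨n, τ, by rw [hτ]; linarith, by rw [hτ]; linarith, hαl, ?_, ?_, ?_, ?_, ?_, ?_⟩
  · rw [abs_lt]
    constructor <;> linarith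
  · rw [← hshift, hb, hb0]
  · rw [← hshift, ← sub_eq_add_neg, ha, ha0]
  · intro t ht
    rw [abs_lt] at ht
    rw [← hshift]
    exact hpos _ ⟨by linarith, by linarith⟩
  · intro t ht
    rw [abs_le] at ht
    rcases le_total 0 t with h0 | h0
    · exact heven' t ⟨h0, ht.2⟩
    · have := heven' (-t) ⟨by linarith, by linarith⟩
      rw [neg_neg] at this
      exact this.symm
  · intro t ht
    have := hneg t ht
    rw [← hn, ← hqu _ ⟨by linarith [ht.1], by linarith [ht.2]⟩, hshift'] at this
    exact this

end IsFilm

/-! ### Droplets, full films and the classification -/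

/-- A film consisting of a single droplet on `[-τ, τ]`. -/
structure IsDroplet (α lam M τ : ℝ) (u : ℝ → ℝ) : Prop extends IsFilm α lam M u where
  tau_pos : 0 < τ
  tau_le : τ ≤ π
  alpha_tau : α * τ < π
  even : ∀ t, u (-t) = u t
  zero_out : ∀ t, τ ≤ |t| → |t| ≤ π → u t = 0
  pos : ∀ t, |t| < τ → 0 < u t
  deriv_neg : ∀ t ∈ Ioo 0 τ, deriv u t < 0

/-- A positive film covering the circle. -/
structure IsFull (α lam M : ℝ) (u : ℝ → ℝ) : Prop extends IsFilm α lam M u where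
  alpha_lt : α < 1
  pos : ∀ t, 0 < u t
  eq : ∀ t, u t = M / (2 * π) + 1 / (1 - α ^ 2) * cos t

namespace IsFilm
variable {α M lam : ℝ} {u : ℝ → ℝ}

/-- Every component, shifted by a multiple of `2 * π`, is the component around `0`, so all have the
same half-width `τ ≤ π`. One centred at a nonzero multiple cannot contain a point of `[-π, π]`. -/
lemma exists_isDroplet (hα : 0 ≤ α) (h : IsFilm α lam M u) {x z : ℝ} (hx : 0 < u x)
    (hz : u z = 0) : ∃ τ, IsDroplet α lam M τ u := by
  obtain ⟨n, τ, h0, hπ, hατ, hxn, hτ, hτ', hpos, heven, hneg⟩ := h.exists_component hα hx hz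
  have hout : ∀ t, τ ≤ |t| → |t| ≤ π → u t = 0 := by
    intro t ht ht'
    by_contra hne
    obtain ⟨m, σ, hσ0, hσπ, -, htm, hσ, -, hσpos, -, -⟩ :=
      h.exists_component hα ((h.nonneg t).lt_of_ne (Ne.symm hne)) hz
    have hστ : σ = τ := by
      rcases lt_trichotomy σ τ with hlt | heq | hgt
      · have := hpos σ (by rwa [abs_of_pos hσ0])
        linarith
      · exact heq
      · have := hσpos τ (by rwa [abs_of_pos h0])
        linarith
    rw [hστ] at htm
    rcases eq_or_ne m 0 with rfl | hm
    · simp only [Int.cast_zero, zero_mul, sub_zero] at htm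
      linarith
    · have h1 : (1 : ℝ) ≤ |(m : ℝ)| := by
        rw [← Int.cast_abs]
        exact_mod_cast Int.one_le_abs hm
      have h2 : 2 * π ≤ |(m : ℝ) * (2 * π)| := by
        rw [abs_mul, abs_of_pos (by positivity : (0 : ℝ) < 2 * π)]
        nlinarith [pi_pos]
      have h3 := abs_sub_abs_le_abs_sub ((m : ℝ) * (2 * π)) t
      rw [abs_sub_comm] at h3
      linarith
  have heven' : ∀ t, |t| ≤ π → u (-t) = u t := by
    intro t ht
    rcases le_total |t| τ with h1 | h1
    · exact heven t h1
    · rw [hout t h1 ht, hout (-t) (by rwa [abs_neg]) (by rwa [abs_neg])]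
  refine ⟨τ, h, h0, hπ, hατ, fun t => ?_, hout, hpos, hneg⟩
  obtain ⟨m, hm⟩ := exists_int_abs_le t
  have h1 := heven' _ hm
  rw [h.int_shift] at h1
  rw [← h1, ← h.int_shift (-m) (-t)]
  congr 1
  push_cast
  ring

/-- The length bound on a whole period gives `α ≤ 1`, and `α = 1` is excluded by resonance. For `α <
1`, subtracting the particular solution from the derivative leaves the homogeneous equation with
periodic boundary conditions. -/
lemma isFull (hα : 0 ≤ α) (h : IsFilm α lam M u) (hpos : ∀ t, 0 < u t) : IsFull α lam M u := by
  have hf : ∀ t, HasDerivAt (deriv u) (-(α ^ 2 * u t + cos t + lam)) t := fun t =>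
    h.hasDerivAt_deriv (hpos t)
  have hα1 : α ≤ 1 := by
    have := h.len (-π) π (by linarith [pi_pos]) (by linarith) fun t _ => hpos t
    nlinarith [pi_pos]
  have hend : ∀ {f : ℝ → ℝ}, Function.Periodic f (2 * π) → f (-π) = f π := fun {f} hf => by
    rw [← hf (-π)]
    congr 1
    ring
  have hlt : α < 1 := by
    refine hα1.lt_of_ne ?_
    rintro rfl
    -- The equation multiplied by `cos` integrates to a constant quantity, but its term `t / 2`
    -- changes by `π` over a period.
    have e := eq_of_hasDerivAt_zero (F := fun t => deriv u t * cos t + u t * sin t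
      + (t + sin t * cos t) / 2 + lam * sin t) convex_univ (fun t _ =>
        (((((hf t).mul (hasDerivAt_cos t)).add ((h.diff t).mul (hasDerivAt_sin t))).add
          (((hasDerivAt_id' t).add ((hasDerivAt_sin t).mul (hasDerivAt_cos t))).div_const 2)).add
          ((hasDerivAt_sin t).const_mul lam)).congr_deriv (by
            have := sin_sq_add_cos_sq t
            linear_combination (-1 / 2) * this)) (mem_univ π) (mem_univ (-π))
    simp only [cos_neg, sin_neg, sin_pi, cos_pi, hend h.deriv_per] at e
    linarith [pi_pos]
  have hd : 0 < 1 - α ^ 2 := by nlinarith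
  have hπα : 0 < sinKernel α π := sinKernel_pos hα pi_pos (by nlinarith [pi_pos])
  have key := fun t => eq_of_homogeneous_ode (α := α)
    (y := fun t => deriv u t + 1 / (1 - α ^ 2) * sin t)
    (y₁ := fun t => -(α ^ 2 * u t + cos t + lam) + 1 / (1 - α ^ 2) * cos t) convex_univ
    (fun t _ => (hf t).add ((hasDerivAt_sin t).const_mul _))
    (fun t _ => ((((((h.diff t).const_mul (α ^ 2)).add (hasDerivAt_cos t)).add_const lam).neg).add
      ((hasDerivAt_cos t).const_mul _)).congr_deriv (by
        field_simp
        ring)) (mem_univ 0) (mem_univ t)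
  obtain ⟨k1, k2⟩ := key π
  obtain ⟨k3, k4⟩ := key (-π)
  simp only [mul_neg, cos_neg, sin_neg, sin_pi, sinKernel_neg, hend h.deriv_per, hend h.per, neg_mul,
    sin_zero, mul_zero, add_zero, neg_zero] at k1 k2 k3 k4
  set z₁ := -(α ^ 2 * u 0 + cos 0 + lam) + 1 / (1 - α ^ 2) * cos 0 with hz₁
  set z₀ := deriv u 0 with hz₀
  have e1 : z₁ = 0 := by
    have : sinKernel α π * z₁ = 0 := by linarith
    exact (mul_eq_zero.1 this).resolve_left hπα.ne'
  have e2 : α ^ 2 * z₀ = 0 := by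
    have : sinKernel α π * (α ^ 2 * z₀) = 0 := by linarith
    exact (mul_eq_zero.1 this).resolve_left hπα.ne'
  have hz : ∀ t, deriv u t + 1 / (1 - α ^ 2) * sin t = z₀ := by
    intro t
    have := (key t).1
    simp only [sin_zero, mul_zero, add_zero] at this
    rw [this, e1, mul_zero, add_zero]
    rcases mul_eq_zero.1 e2 with h0 | h0
    · simp [pow_eq_zero_iff (two_ne_zero) |>.1 h0]
    · rw [h0, mul_zero]
  have hcst : ∀ t, u t - 1 / (1 - α ^ 2) * cos t - z₀ * t = u 0 - 1 / (1 - α ^ 2) := by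
    intro t
    have := eq_of_hasDerivAt_zero (F := fun t => u t - 1 / (1 - α ^ 2) * cos t - z₀ * t) convex_univ
      (fun t _ => (((h.diff t).sub ((hasDerivAt_cos t).const_mul _)).sub
        ((hasDerivAt_id' t).const_mul z₀)).congr_deriv (by rw [← hz t]; ring)) (mem_univ t) (mem_univ 0)
    simpa using this
  -- For `α = 0` the boundary conditions for the derivative allow a constant slope; periodicity of
  -- `u` itself removes it.
  have e3 : z₀ = 0 := by
    have h1 := hcst π
    have h2 := hcst (-π)
    rw [hend h.per, cos_neg] at h2
    have : z₀ * π = 0 := by linarith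
    exact (mul_eq_zero.1 this).resolve_right pi_ne_zero
  have hform : ∀ t, u t = (u 0 - 1 / (1 - α ^ 2)) + 1 / (1 - α ^ 2) * cos t := by
    intro t
    have := hcst t
    rw [e3] at this
    linarith
  have hm : M = 2 * π * (u 0 - 1 / (1 - α ^ 2)) := by
    rw [← h.mass, intervalIntegral.integral_congr fun t _ => hform t,
      intervalIntegral.integral_add (by simp) (Continuous.intervalIntegrable (by fun_prop) _ _),
      intervalIntegral.integral_const_mul, integral_cos]
    simp
    ring
  refine ⟨h, hlt, hpos, fun t => ?_⟩
  rw [hform t, hm]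
  field_simp

/-- A nontrivial film is a droplet or covers the circle. -/
lemma classification (hα : 0 ≤ α) (hM : 0 < M) (h : IsFilm α lam M u) :
    IsFull α lam M u ∨ ∃ τ, IsDroplet α lam M τ u := by
  by_cases hz : ∃ z, u z = 0
  · obtain ⟨z, hz⟩ := hz
    have hx : ∃ x, 0 < u x := by
      by_contra! hle
      have h1 : ∀ t, u t = 0 := fun t => le_antisymm (hle t) (h.nonneg t)
      have := h.mass
      simp [h1] at this
      linarith
    obtain ⟨x, hx⟩ := hx
    exact Or.inr (h.exists_isDroplet hα hx hz)
  · push Not at hz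
    exact Or.inl (h.isFull hα fun t => (h.nonneg t).lt_of_ne (hz t).symm)

end IsFilm

/-! ### Comparison of droplets -/

lemma abs_le_of_cos_le {s τ : ℝ} (hs : |s| ≤ π) (h0 : 0 ≤ τ) (hτ : τ ≤ π) (h : cos τ ≤ cos s) :
    |s| ≤ τ := by
  by_contra! hlt
  rw [← cos_abs s] at h
  exact absurd (strictAntiOn_cos ⟨h0, hτ⟩ ⟨abs_nonneg _, hs⟩ hlt) (not_lt.2 h)

lemma abs_lt_of_cos_lt {s τ : ℝ} (hs : |s| ≤ π) (h0 : 0 ≤ τ) (hτ : τ ≤ π) (h : cos τ < cos s) :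
    |s| < τ := by
  refine (abs_le_of_cos_le hs h0 hτ h.le).lt_of_ne fun heq => ?_
  rw [← cos_abs s, heq] at h
  exact lt_irrefl _ h

lemma integral_lt_of_le_of_lt {u v : ℝ → ℝ} (hu : Continuous u) (hv : Continuous v)
    (hle : ∀ t, u t ≤ v t) (h0 : u 0 < v 0) : ∫ t in (-π)..π, u t < ∫ t in (-π)..π, v t :=
  intervalIntegral.integral_lt_integral_of_continuousOn_of_le_of_exists_lt
    (by linarith [pi_pos]) hu.continuousOn hv.continuousOn (fun t _ => hle t)
    ⟨0, ⟨by linarith [pi_pos], pi_pos.le⟩, h0⟩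

namespace IsFilm
variable {α M lam : ℝ} {u : ℝ → ℝ}

lemma deriv_odd (h : IsFilm α lam M u) (he : ∀ t, u (-t) = u t) (t : ℝ) :
    deriv u (-t) = -deriv u t := by
  have h1 : HasDerivAt (fun s => u (-s)) (-deriv u (-t)) t := by
    have := (h.diff (0 - t)).comp_const_sub 0 t
    simpa only [zero_sub] using this
  rw [funext he] at h1
  rw [h1.deriv, neg_neg]

lemma deriv_zero (h : IsFilm α lam M u) (he : ∀ t, u (-t) = u t) : deriv u 0 = 0 := by
  have := h.deriv_odd he 0
  rw [neg_zero] at this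
  linarith

end IsFilm

namespace IsDroplet
variable {α lam M τ : ℝ} {u : ℝ → ℝ}

lemma alpha_lt_of_tau_eq (h : IsDroplet α lam M τ u) (hτ : τ = π) : α < 1 := by
  have := h.alpha_tau
  rw [hτ] at this
  nlinarith [pi_pos]

lemma contact (h : IsDroplet α lam M τ u) : u τ = 0 :=
  h.zero_out τ (by rw [abs_of_pos h.tau_pos]) (by rw [abs_of_pos h.tau_pos]; exact h.tau_le)

/-- The cosine encodes the distance to the nearest multiple of `2 * π`, so this describes the wet
region on the whole line. -/
lemma pos_iff (h : IsDroplet α lam M τ u) (t : ℝ) : 0 < u t ↔ cos τ < cos t := by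
  obtain ⟨n, hn⟩ := exists_int_abs_le t
  rw [← h.int_shift n t, ← cos_sub_int_mul_two_pi t n]
  set s := t - n * (2 * π)
  constructor
  · intro hpos
    have hs : |s| < τ := by
      by_contra! hle
      rw [h.zero_out s hle hn] at hpos
      exact lt_irrefl _ hpos
    rw [← cos_abs s]
    exact strictAntiOn_cos ⟨abs_nonneg _, hn⟩ ⟨h.tau_pos.le, h.tau_le⟩ hs
  · intro hcos
    exact h.pos s (abs_lt_of_cos_lt hn h.tau_pos.le h.tau_le hcos)

lemma cos_le_of_mem_tsupport (h : IsDroplet α lam M τ u) {t : ℝ} (ht : t ∈ tsupport u) :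
    cos τ ≤ cos t := by
  have hcl : IsClosed {t : ℝ | cos τ ≤ cos t} := isClosed_le continuous_const continuous_cos
  refine closure_minimal (fun s hs => ?_) hcl ht
  exact ((h.pos_iff s).1 ((h.nonneg s).lt_of_ne (Ne.symm hs))).le

/-- At the contact point `deriv u` need not be differentiable. The extension `q` from inside is, so
both ends of `[0, τ]` can be treated like interior points. -/
lemma exists_ode (h : IsDroplet α lam M τ u) : ∃ q : ℝ → ℝ,
    (∀ t, HasDerivAt q (-(α ^ 2 * u t + cos t + lam)) t) ∧
    (∀ t ∈ Icc 0 τ, HasDerivAt u (q t) t) ∧ (∀ t ∈ Icc 0 τ, deriv u t = q t) ∧ q 0 = 0 ∧ q τ = 0 := by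
  have hτ := h.tau_pos
  obtain ⟨q, hq, hqu, hu⟩ := h.exists_extension (a := 0) (b := τ) hτ
    fun t ht => h.pos t (abs_lt.2 ⟨by linarith [ht.1], by linarith [ht.2]⟩)
  refine ⟨q, hq, hu, hqu, ?_, ?_⟩
  · rw [← hqu 0 (left_mem_Icc.2 hτ.le), h.deriv_zero h.even]
  · rw [← hqu τ (right_mem_Icc.2 hτ.le), h.zero τ h.contact]

lemma sinKernel_pos' (h : IsDroplet α lam M τ u) (hα : 0 ≤ α) {t : ℝ} (ht : t ∈ Ioc 0 τ) :
    0 < sinKernel α t :=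
  sinKernel_pos hα ht.1 ((mul_le_mul_of_nonneg_left ht.2 hα).trans_lt h.alpha_tau)

/-- Differentiating the equations removes the multipliers. The difference of the derivatives solves
the homogeneous equation and vanishes at `0`, hence is a multiple of `sinKernel`. -/
lemma exists_diff_slope (h : IsDroplet α lam M τ u) {v p : ℝ → ℝ} {mu : ℝ}
    (hv : ∀ t ∈ Icc 0 τ, HasDerivAt v (p t) t)
    (hp : ∀ t ∈ Icc 0 τ, HasDerivAt p (-(α ^ 2 * v t + cos t + mu)) t) (hp0 : p 0 = 0) :
    ∃ B, sinKernel α τ * B = p τ ∧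
      ∀ t ∈ Icc 0 τ, HasDerivAt (fun t => v t - u t) (sinKernel α t * B) t := by
  obtain ⟨q, hq, hu, -, hq0, hqτ⟩ := h.exists_ode
  have key : ∀ t ∈ Icc 0 τ, _ := fun t ht => eq_of_homogeneous_ode (α := α)
    (y := fun t => p t - q t)
    (y₁ := fun t => -(α ^ 2 * v t + cos t + mu) - -(α ^ 2 * u t + cos t + lam)) (convex_Icc 0 τ)
    (fun t ht => (hp t ht).sub (hq t))
    (fun t ht => (((((hv t ht).const_mul (α ^ 2)).add (hasDerivAt_cos t)).add_const mu).neg.sub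
      (((((hu t ht).const_mul (α ^ 2)).add (hasDerivAt_cos t)).add_const lam).neg)).congr_deriv
      (by ring)) (left_mem_Icc.2 h.tau_pos.le) ht
  have key' : ∀ t ∈ Icc 0 τ, p t - q t = sinKernel α t * _ := fun t ht => by
    have := (key t ht).1
    simp only [hp0, hq0, sub_zero, mul_zero, zero_add] at this
    exact this
  refine ⟨_, ?_, fun t ht => ((hv t ht).sub (hu t ht)).congr_deriv (key' t ht)⟩
  rw [← key' τ (right_mem_Icc.2 h.tau_pos.le), hqτ, sub_zero]

/-- Comparison of a droplet with a solution that is positive and decreasing at the contact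
point. -/
lemma lt_of_contact (h : IsDroplet α lam M τ u) (hα : 0 ≤ α) {v p : ℝ → ℝ} {mu : ℝ}
    (hv : ∀ t ∈ Icc 0 τ, HasDerivAt v (p t) t)
    (hp : ∀ t ∈ Icc 0 τ, HasDerivAt p (-(α ^ 2 * v t + cos t + mu)) t) (hp0 : p 0 = 0)
    (hvτ : 0 < v τ) (hpτ : p τ < 0) (hve : ∀ t, v (-t) = v t) {t : ℝ} (ht : |t| ≤ τ) :
    u t < v t := by
  obtain ⟨B, hB, hd⟩ := h.exists_diff_slope hv hp hp0
  have hτ := h.tau_pos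
  have hB0 : B < 0 := by
    have := h.sinKernel_pos' hα (right_mem_Ioc.2 hτ)
    by_contra! hle
    nlinarith
  have hanti : StrictAntiOn (fun t => v t - u t) (Icc 0 τ) :=
    strictAntiOn_of_hasDerivAt_neg hd fun s hs =>
      mul_neg_of_pos_of_neg (h.sinKernel_pos' hα (Ioo_subset_Ioc_self hs)) hB0
  have h1 : 0 < v |t| - u |t| := by
    have h2 := hanti.antitoneOn (a := |t|) (b := τ) ⟨abs_nonneg t, ht⟩ (right_mem_Icc.2 hτ.le) ht
    simp only [h.contact, sub_zero] at h2
    linarith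
  rcases abs_choice t with h2 | h2 <;> rw [h2] at h1
  · linarith
  · rw [hve, h.even] at h1
    linarith

/-- A droplet is determined by its contact point. -/
lemma eq_of_contact (h : IsDroplet α lam M τ u) (hα : 0 ≤ α) {v p : ℝ → ℝ} {mu : ℝ}
    (hv : ∀ t ∈ Icc 0 τ, HasDerivAt v (p t) t)
    (hp : ∀ t ∈ Icc 0 τ, HasDerivAt p (-(α ^ 2 * v t + cos t + mu)) t) (hp0 : p 0 = 0)
    (hvτ : v τ = 0) (hpτ : p τ = 0) (hve : ∀ t, v (-t) = v t) {t : ℝ} (ht : |t| ≤ τ) :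
    u t = v t := by
  obtain ⟨B, hB, hd⟩ := h.exists_diff_slope hv hp hp0
  have hτ := h.tau_pos
  have hB0 : B = 0 := by
    have := h.sinKernel_pos' hα (right_mem_Ioc.2 hτ)
    rw [hpτ] at hB
    exact (mul_eq_zero.1 hB).resolve_left this.ne'
  have h1 : v |t| - u |t| = 0 := by
    have h2 := eq_of_hasDerivAt_zero (convex_Icc 0 τ)
      (fun s hs => (hd s hs).congr_deriv (by rw [hB0, mul_zero])) (x := |t|) ⟨abs_nonneg t, ht⟩
      (right_mem_Icc.2 hτ.le)
    simpa [h.contact, hvτ] using h2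
  rcases abs_choice t with h2 | h2 <;> rw [h2] at h1
  · linarith
  · rw [hve, h.even] at h1
    linarith

/-- The comparison with a larger periodic function extends from the wet region to the line. -/
lemma le_of_forall_lt (h : IsDroplet α lam M τ u) {v : ℝ → ℝ} (hv0 : ∀ t, 0 ≤ v t)
    (hvper : Function.Periodic v (2 * π)) (hlt : ∀ t, |t| ≤ τ → u t < v t) (t : ℝ) :
    u t ≤ v t := by
  obtain ⟨n, hn⟩ := exists_int_abs_le t
  rw [← h.int_shift n t, ← hvper.sub_int_mul_eq n (x := t)]
  rcases le_total |t - n * (2 * π)| τ with h1 | h1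
  · exact (hlt _ h1).le
  · rw [h.zero_out _ h1 hn]
    exact hv0 _

lemma lt_of_mem_tsupport (h : IsDroplet α lam M τ u) {v : ℝ → ℝ}
    (hvper : Function.Periodic v (2 * π)) (hlt : ∀ t, |t| ≤ τ → u t < v t) {t : ℝ}
    (ht : t ∈ tsupport u) : u t < v t := by
  obtain ⟨n, hn⟩ := exists_int_abs_le t
  rw [← h.int_shift n t, ← hvper.sub_int_mul_eq n (x := t)]
  refine hlt _ (abs_le_of_cos_le hn h.tau_pos.le h.tau_le ?_)
  rw [cos_sub_int_mul_two_pi]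
  exact h.cos_le_of_mem_tsupport ht

lemma eq_of_eqOn_wet (h : IsDroplet α lam M τ u) {lam' M' : ℝ} {v : ℝ → ℝ}
    (h' : IsDroplet α lam' M' τ v) (heq : ∀ t, |t| ≤ τ → u t = v t) : u = v := by
  funext t
  obtain ⟨n, hn⟩ := exists_int_abs_le t
  rw [← h.int_shift n t, ← h'.int_shift n t]
  rcases le_total |t - n * (2 * π)| τ with h1 | h1
  · exact heq _ h1
  · rw [h.zero_out _ h1 hn, h'.zero_out _ h1 hn]

/-- At the contact point of the smaller droplet the larger one is still positive and decreasing, so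
`lt_of_contact` applies. -/
lemma lt_of_tau_lt (h : IsDroplet α lam M τ u) (hα : 0 ≤ α) {lam' M' τ' : ℝ} {v : ℝ → ℝ}
    (h' : IsDroplet α lam' M' τ' v) (hτ : τ < τ') {t : ℝ} (ht : |t| ≤ τ) : u t < v t := by
  obtain ⟨q, hq, hv, hqv, hq0, -⟩ := h'.exists_ode
  have h0 := h.tau_pos
  refine h.lt_of_contact hα (fun s hs => hv s ⟨hs.1, hs.2.trans hτ.le⟩) (fun s _ => hq s) hq0
    (h'.pos τ (by rwa [abs_of_pos h0])) ?_ h'.even ht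
  rw [← hqv τ ⟨h0.le, hτ.le⟩]
  exact h'.deriv_neg τ ⟨h0, hτ⟩

lemma mass_lt_of_forall_lt (h : IsDroplet α lam M τ u) {v : ℝ → ℝ} (hv0 : ∀ t, 0 ≤ v t)
    (hvc : Continuous v) (hvper : Function.Periodic v (2 * π)) (hlt : ∀ t, |t| ≤ τ → u t < v t) :
    M < ∫ t in (-π)..π, v t := by
  rw [← h.mass]
  exact integral_lt_of_le_of_lt h.cont hvc (h.le_of_forall_lt hv0 hvper hlt)
    (hlt 0 (by rw [abs_zero]; exact h.tau_pos.le))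

lemma eq_of_tau_eq (h : IsDroplet α lam M τ u) (hα : 0 ≤ α) {lam' M' : ℝ} {v : ℝ → ℝ}
    (h' : IsDroplet α lam' M' τ v) : u = v := by
  obtain ⟨q, hq, hv, -, hq0, hqτ⟩ := h'.exists_ode
  exact h.eq_of_eqOn_wet h' fun t ht =>
    h.eq_of_contact hα hv (fun s _ => hq s) hq0 h'.contact hqτ h'.even ht

lemma tau_lt_of_mass_lt (h : IsDroplet α lam M τ u) (hα : 0 ≤ α) {lam' M' τ' : ℝ} {v : ℝ → ℝ}
    (h' : IsDroplet α lam' M' τ' v) (hM : M < M') : τ < τ' := by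
  by_contra! hle
  rcases hle.eq_or_lt with heq | hlt
  · subst heq
    have := h.eq_of_tau_eq hα h'
    rw [← h.mass, ← h'.mass, this] at hM
    exact lt_irrefl _ hM
  · have := h'.mass_lt_of_forall_lt h.nonneg h.cont h.per fun t ht => h'.lt_of_tau_lt hα h hlt ht
    rw [h.mass] at this
    linarith

lemma eq_of_mass_eq (h : IsDroplet α lam M τ u) (hα : 0 ≤ α) {lam' τ' : ℝ} {v : ℝ → ℝ}
    (h' : IsDroplet α lam' M τ' v) : u = v := by
  rcases lt_trichotomy τ τ' with hlt | heq | hgt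
  · have := h.mass_lt_of_forall_lt h'.nonneg h'.cont h'.per fun t ht => h.lt_of_tau_lt hα h' hlt ht
    rw [h'.mass] at this
    exact absurd this (lt_irrefl _)
  · subst heq
    exact h.eq_of_tau_eq hα h'
  · have := h'.mass_lt_of_forall_lt h.nonneg h.cont h.per fun t ht => h'.lt_of_tau_lt hα h hgt ht
    rw [h.mass] at this
    exact absurd this (lt_irrefl _)

/-- For every `m` this solves the equation with multiplier `-(α ^ 2 * m)`. The choice `m = 1 / (1 -
α ^ 2)` is the critical film, which touches zero at `π`. -/
lemma critical_ode {α : ℝ} (h : 1 - α ^ 2 ≠ 0) (t : ℝ) (m : ℝ) :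
    HasDerivAt (fun t => m + cos t / (1 - α ^ 2)) (-sin t / (1 - α ^ 2)) t ∧
    HasDerivAt (fun t => -sin t / (1 - α ^ 2))
      (-(α ^ 2 * (m + cos t / (1 - α ^ 2)) + cos t + -(α ^ 2 * m))) t := by
  constructor
  · exact ((hasDerivAt_cos t).div_const _).const_add m
  · refine ((hasDerivAt_sin t).neg.div_const _).congr_deriv ?_
    field_simp
    ring

lemma integral_critical (α m : ℝ) :
    ∫ t in (-π)..π, (m + cos t / (1 - α ^ 2)) = 2 * π * m := by
  rw [intervalIntegral.integral_add (by simp) (Continuous.intervalIntegrable (by fun_prop) _ _),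
    intervalIntegral.integral_div, integral_cos]
  simp only [intervalIntegral.integral_const, smul_eq_mul, sin_neg, sin_pi, neg_zero, sub_zero,
    zero_div, add_zero]
  ring

lemma eq_of_tau_eq_pi (h : IsDroplet α lam M π u) (hα : 0 ≤ α) :
    (∀ t, u t = (1 + cos t) / (1 - α ^ 2)) ∧ M * (1 - α ^ 2) = 2 * π := by
  have hα1 := h.alpha_lt_of_tau_eq rfl
  have hd : 0 < 1 - α ^ 2 := by nlinarith
  have e : ∀ t, |t| ≤ π → u t = 1 / (1 - α ^ 2) + cos t / (1 - α ^ 2) := fun t ht =>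
    h.eq_of_contact hα (fun s _ => (critical_ode hd.ne' s _).1) (fun s _ => (critical_ode hd.ne' s _).2)
      (by simp) (by rw [cos_pi]; ring) (by simp) (fun s => by simp) ht
  have e' : ∀ t, u t = 1 / (1 - α ^ 2) + cos t / (1 - α ^ 2) := by
    intro t
    obtain ⟨n, hn⟩ := exists_int_abs_le t
    rw [← h.int_shift n t, e _ hn, cos_sub_int_mul_two_pi]
  refine ⟨fun t => by rw [e' t, ← add_div], ?_⟩
  rw [← h.mass, intervalIntegral.integral_congr fun t _ => e' t, integral_critical]
  field_simp

/-- For `α < 1` the droplet lies below the critical film, whose mass is `2 * π / (1 - α ^ 2)`; for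
`α ≥ 1` the left side is not positive. -/
lemma mass_lt_of_tau_lt_pi (h : IsDroplet α lam M τ u) (hα : 0 ≤ α) (hM : 0 < M) (hτ : τ < π) :
    M * (1 - α ^ 2) < 2 * π := by
  rcases le_or_gt 1 α with h1 | h1
  · have : M * (1 - α ^ 2) ≤ 0 := mul_nonpos_of_nonneg_of_nonpos hM.le (by nlinarith)
    linarith [pi_pos]
  · have hd : 0 < 1 - α ^ 2 := by nlinarith
    have hv0 : ∀ t, 0 ≤ 1 / (1 - α ^ 2) + cos t / (1 - α ^ 2) := fun t => by
      rw [← add_div]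
      exact div_nonneg (by linarith [neg_one_le_cos t]) hd.le
    have hcos : -1 < cos τ := by
      rw [← cos_pi]
      exact strictAntiOn_cos ⟨h.tau_pos.le, hτ.le⟩ (right_mem_Icc.2 pi_pos.le) hτ
    have hlt : ∀ t, |t| ≤ τ → u t < 1 / (1 - α ^ 2) + cos t / (1 - α ^ 2) := fun t ht =>
      h.lt_of_contact hα (fun s _ => (critical_ode hd.ne' s _).1)
        (fun s _ => (critical_ode hd.ne' s _).2) (by simp)
        (by rw [← add_div]; exact div_pos (by linarith) hd)
        (div_neg_of_neg_of_pos (neg_lt_zero.2 (sin_pos_of_pos_of_lt_pi h.tau_pos hτ)) hd)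
        (fun s => by simp) ht
    have := h.mass_lt_of_forall_lt hv0 (by fun_prop) (fun t => by simp) hlt
    rw [integral_critical, mul_one_div, lt_div_iff₀ hd] at this
    exact this

lemma mass_le (h : IsDroplet α lam M τ u) (hα : 0 ≤ α) (hM : 0 < M) :
    M * (1 - α ^ 2) ≤ 2 * π := by
  rcases h.tau_le.eq_or_lt with heq | hlt
  · subst heq
    exact (h.eq_of_tau_eq_pi hα).2.le
  · exact (h.mass_lt_of_tau_lt_pi hα hM hlt).le

end IsDroplet

namespace IsFull
variable {α lam M : ℝ} {u : ℝ → ℝ}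

lemma one_sub_pos (h : IsFull α lam M u) (hα : 0 ≤ α) : 0 < 1 - α ^ 2 := by
  nlinarith [h.alpha_lt]

lemma eq' (h : IsFull α lam M u) (t : ℝ) : u t = M / (2 * π) + cos t / (1 - α ^ 2) := by
  rw [h.eq t, one_div_mul_eq_div]

lemma mass_gt (h : IsFull α lam M u) (hα : 0 ≤ α) : 2 * π < M * (1 - α ^ 2) := by
  have h1 := h.pos π
  have hd := h.one_sub_pos hα
  rw [h.eq' π, cos_pi] at h1
  have h2 : 1 / (1 - α ^ 2) < M / (2 * π) := by
    rw [neg_div] at h1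
    linarith
  rw [div_lt_div_iff₀ hd (by positivity)] at h2
  linarith

end IsFull

/-! ### The explicit wet profile -/

lemma hasDerivAt_specialSolution {α : ℝ} (hα : α ≠ 0) (hα0 : 0 ≤ α) : ∃ p : ℝ → ℝ, p 0 = 0 ∧
    (∀ t, HasDerivAt (specialSolution α) (p t) t) ∧
    (∀ t, HasDerivAt p (-(α ^ 2 * specialSolution α t + cos t)) t) ∧
    ∀ t, specialSolution α (-t) = specialSolution α t := by
  by_cases h1 : α = 1
  · subst h1
    have e : specialSolution 1 = fun t => -(1 / 2) * t * sin t := by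
      funext t
      simp [specialSolution]
    rw [e]
    refine ⟨fun t => -(1 / 2) * (sin t + t * cos t), by simp, fun t => ?_, fun t => ?_, fun t => ?_⟩
    · exact (((hasDerivAt_id' t).const_mul (-(1 / 2))).mul (hasDerivAt_sin t)).congr_deriv (by ring)
    · exact (((hasDerivAt_sin t).add ((hasDerivAt_id' t).mul (hasDerivAt_cos t))).const_mul
        (-(1 / 2))).congr_deriv (by ring)
    · beta_reduce
      rw [sin_neg]
      ring
  · have hd : 1 - α ^ 2 ≠ 0 := by
      intro h
      have : (1 - α) * (1 + α) = 0 := by linear_combination h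
      rcases mul_eq_zero.1 this with h2 | h2 <;> [exact h1 (by linarith); linarith]
    have e : specialSolution α = fun t =>
        1 / (1 - α ^ 2) * (cos t - (1 + α ^ 2) / (2 * α) * cos (α * t)) := by
      funext t
      simp [specialSolution, h1]
    have hc : ∀ t, HasDerivAt (fun t => cos (α * t)) (-(α * sin (α * t))) t := fun t =>
      (((hasDerivAt_id' t).const_mul α).cos).congr_deriv (by ring)
    have hs : ∀ t, HasDerivAt (fun t => sin (α * t)) (α * cos (α * t)) t := fun t =>
      (((hasDerivAt_id' t).const_mul α).sin).congr_deriv (by ring)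
    rw [e]
    refine ⟨fun t => 1 / (1 - α ^ 2) * (-sin t + (1 + α ^ 2) / 2 * sin (α * t)), by simp,
      fun t => ?_, fun t => ?_, fun t => ?_⟩
    · exact (((hasDerivAt_cos t).sub ((hc t).const_mul _)).const_mul _).congr_deriv (by
        field_simp
        ring)
    · exact (((hasDerivAt_sin t).neg.add ((hs t).const_mul _)).const_mul _).congr_deriv (by
        field_simp
        ring)
    · simp

/-- The coefficient `A(τ)` is the one that makes the slope vanish at `τ`; it is well defined because
`0 < α * τ < π` keeps `sin (α * τ)` positive. -/
lemma wetProfile_ode {α τ : ℝ} (hα : 0 ≤ α) (hτ : 0 < τ) (hατ : α * τ < π) :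
    ∃ (p : ℝ → ℝ) (mu : ℝ), p 0 = 0 ∧ p τ = 0 ∧
    (∀ t, HasDerivAt (wetProfile α τ) (p t) t) ∧
    (∀ t, HasDerivAt p (-(α ^ 2 * wetProfile α τ t + cos t + mu)) t) ∧
    (∀ t, wetProfile α τ (-t) = wetProfile α τ t) ∧ wetProfile α τ τ = 0 := by
  by_cases h0 : α = 0
  · subst h0
    have e : wetProfile 0 τ = fun t => cos t - cos τ - sin τ / (2 * τ) * (τ ^ 2 - t ^ 2) := by
      funext t
      simp [wetProfile]
    rw [e]
    refine ⟨fun t => -sin t + sin τ / τ * t, -(sin τ / τ), by simp, ?_, fun t => ?_, fun t => ?_,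
      fun t => by simp, by simp⟩
    · field_simp
      ring
    · exact (((hasDerivAt_cos t).sub_const _).sub
        ((((hasDerivAt_id' t).pow 2).const_sub _).const_mul _)).congr_deriv (by
          field_simp
          ring)
    · exact ((hasDerivAt_sin t).neg.add ((hasDerivAt_id' t).const_mul _)).congr_deriv (by ring)
  · have hα' : 0 < α := lt_of_le_of_ne hα (Ne.symm h0)
    obtain ⟨p, hp0, hp, hp', hev⟩ := hasDerivAt_specialSolution h0 hα
    have e : wetProfile α τ = fun t => profileCoeff α τ * (cos (α * t) - cos (α * τ))
        + specialSolution α t - specialSolution α τ := by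
      funext t
      simp [wetProfile, h0]
    have hs : 0 < sin (α * τ) := sin_pos_of_pos_of_lt_pi (by positivity) hατ
    have hA : profileCoeff α τ * (α * sin (α * τ)) = p τ := by
      rw [profileCoeff, (hp τ).deriv]
      field_simp
    set A := profileCoeff α τ
    have hc : ∀ t, HasDerivAt (fun t => cos (α * t)) (-(α * sin (α * t))) t := fun t =>
      (((hasDerivAt_id' t).const_mul α).cos).congr_deriv (by ring)
    have hs : ∀ t, HasDerivAt (fun t => sin (α * t)) (α * cos (α * t)) t := fun t =>
      (((hasDerivAt_id' t).const_mul α).sin).congr_deriv (by ring)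
    rw [e]
    refine ⟨fun t => -(A * (α * sin (α * t))) + p t,
      α ^ 2 * (A * cos (α * τ) + specialSolution α τ), by simp [hp0], by simp [hA], fun t => ?_,
      fun t => ?_, fun t => by simp [hev], by simp⟩
    · exact (((((hc t).sub_const _).const_mul A).add (hp t)).sub_const _).congr_deriv (by ring)
    · exact (((((hs t).const_mul α).const_mul A).neg).add (hp' t)).congr_deriv (by ring)

lemma IsDroplet.eq_wetProfile {α lam M τ : ℝ} {u : ℝ → ℝ} (h : IsDroplet α lam M τ u) (hα : 0 ≤ α)
    {t : ℝ} (ht : |t| ≤ τ) : u t = wetProfile α τ t := by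
  obtain ⟨p, mu, hp0, hpτ, hw, hp, hev, hwτ⟩ := wetProfile_ode hα h.tau_pos h.alpha_tau
  exact h.eq_of_contact hα (fun s _ => hw s) (fun s _ => hp s) hp0 hwτ hpτ hev ht

/-! ### Multiplier bounds and ordering of profiles -/

/-- A film that is a droplet or covers the circle. -/
def IsProfile (α lam M : ℝ) (u : ℝ → ℝ) : Prop :=
  IsFull α lam M u ∨ ∃ τ, IsDroplet α lam M τ u

lemma nonpos_of_hasDerivAt_of_nonpos {q : ℝ → ℝ} {d a b : ℝ} (hab : a < b) (hq : HasDerivAt q d a)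
    (ha : q a = 0) (hle : ∀ t ∈ Ioo a b, q t ≤ 0) : d ≤ 0 := by
  have h1 := (hasDerivAt_iff_tendsto_slope.1 hq).mono_left
    (nhdsWithin_mono a (fun x (hx : a < x) => hx.ne') : 𝓝[>] a ≤ 𝓝[≠] a)
  refine le_of_tendsto h1 ?_
  filter_upwards [Ioo_mem_nhdsGT hab] with t ht
  rw [slope_def_field, ha, sub_zero]
  exact div_nonpos_of_nonpos_of_nonneg (hle t ht) (by linarith [ht.1])

lemma nonneg_of_hasDerivAt_of_nonpos {q : ℝ → ℝ} {d a b : ℝ} (hab : a < b) (hq : HasDerivAt q d b)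
    (hb : q b = 0) (hle : ∀ t ∈ Ioo a b, q t ≤ 0) : 0 ≤ d := by
  have h1 := (hasDerivAt_iff_tendsto_slope.1 hq).mono_left
    (nhdsWithin_mono b (fun x (hx : x < b) => hx.ne) : 𝓝[<] b ≤ 𝓝[≠] b)
  refine ge_of_tendsto h1 ?_
  filter_upwards [Ioo_mem_nhdsLT hab] with t ht
  rw [slope_def_field, hb, sub_zero]
  exact div_nonneg_of_nonpos (hle t ht) (by linarith [ht.2])

namespace IsDroplet
variable {α lam M τ : ℝ} {u : ℝ → ℝ}

lemma strictAntiOn (h : IsDroplet α lam M τ u) : StrictAntiOn u (Icc 0 τ) :=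
  strictAntiOn_of_hasDerivAt_neg (fun t _ => h.diff t) h.deriv_neg

/-- The slope is nonpositive on `[0, τ]` and zero at both ends, which fixes the sign of its
derivative at each end; the equation then bounds `lam`. -/
lemma lam_bounds (h : IsDroplet α lam M τ u) : -1 - α ^ 2 * u 0 ≤ lam ∧ lam ≤ -cos τ := by
  obtain ⟨q, hq, hu, hqu, hq0, hqτ⟩ := h.exists_ode
  have hle : ∀ t ∈ Ioo 0 τ, q t ≤ 0 := fun t ht => by
    rw [← hqu t (Ioo_subset_Icc_self ht)]
    exact (h.deriv_neg t ht).le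
  have h1 := nonpos_of_hasDerivAt_of_nonpos h.tau_pos (hq 0) hq0 hle
  have h2 := nonneg_of_hasDerivAt_of_nonpos h.tau_pos (hq τ) hqτ hle
  rw [cos_zero] at h1
  rw [h.contact] at h2
  constructor <;> linarith

lemma le_zero (h : IsDroplet α lam M τ u) (t : ℝ) : u t ≤ u 0 := by
  obtain ⟨n, hn⟩ := exists_int_abs_le t
  rw [← h.int_shift n t]
  set s := t - n * (2 * π)
  rcases le_total |s| τ with h1 | h1
  · have := h.strictAntiOn.antitoneOn (left_mem_Icc.2 h.tau_pos.le) ⟨abs_nonneg s, h1⟩ (abs_nonneg s)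
    rcases abs_choice s with h2 | h2 <;> rw [h2] at this
    · exact this
    · rwa [h.even] at this
  · rw [h.zero_out s h1 hn]
    exact h.nonneg 0

end IsDroplet

namespace IsFull
variable {α lam M : ℝ} {u : ℝ → ℝ}

lemma hasDerivAt (h : IsFull α lam M u) (t : ℝ) : HasDerivAt u (-sin t / (1 - α ^ 2)) t := by
  rw [funext h.eq']
  exact ((hasDerivAt_cos t).div_const _).const_add _

lemma deriv_eq (h : IsFull α lam M u) : deriv u = fun t => -sin t / (1 - α ^ 2) :=
  funext fun t => (h.hasDerivAt t).deriv

lemma even (h : IsFull α lam M u) (t : ℝ) : u (-t) = u t := by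
  rw [h.eq', h.eq', cos_neg]

lemma le_zero (h : IsFull α lam M u) (hα : 0 ≤ α) (t : ℝ) : u t ≤ u 0 := by
  rw [h.eq', h.eq', cos_zero]
  have := h.one_sub_pos hα
  gcongr
  exact cos_le_one t

lemma lam_bounds (h : IsFull α lam M u) (hα : 0 ≤ α) : -1 - α ^ 2 * u 0 ≤ lam ∧ lam ≤ 1 := by
  have hd := h.one_sub_pos hα
  have key : ∀ t, -cos t / (1 - α ^ 2) = -(α ^ 2 * u t + cos t + lam) := by
    intro t
    have h1 := h.hasDerivAt_deriv (h.pos t)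
    rw [h.deriv_eq] at h1
    exact ((hasDerivAt_sin t).neg.div_const _).unique h1
  have h0 := key 0
  have hπ := key π
  rw [cos_zero] at h0
  rw [cos_pi, neg_neg] at hπ
  have h3 : 0 < 1 / (1 - α ^ 2) := by positivity
  rw [neg_div] at h0
  have h4 : 0 ≤ α ^ 2 * u π := mul_nonneg (sq_nonneg α) (h.nonneg π)
  constructor <;> linarith

end IsFull

namespace IsProfile
variable {α lam M lam' M' : ℝ} {u v : ℝ → ℝ}

lemma film (h : IsProfile α lam M u) : IsFilm α lam M u := by
  rcases h with h | ⟨τ, h⟩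
  · exact h.toIsFilm
  · exact h.toIsFilm

lemma even (h : IsProfile α lam M u) (t : ℝ) : u (-t) = u t := by
  rcases h with h | ⟨τ, h⟩
  · exact h.even t
  · exact h.even t

lemma le_zero (h : IsProfile α lam M u) (hα : 0 ≤ α) (t : ℝ) : u t ≤ u 0 := by
  rcases h with h | ⟨τ, h⟩
  · exact h.le_zero hα t
  · exact h.le_zero t

lemma lam_bounds (h : IsProfile α lam M u) (hα : 0 ≤ α) : -1 - α ^ 2 * u 0 ≤ lam ∧ lam ≤ 1 := by
  rcases h with h | ⟨τ, h⟩
  · exact h.lam_bounds hα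
  · exact ⟨h.lam_bounds.1, by linarith [h.lam_bounds.2, neg_one_le_cos τ]⟩

/-- The bound depends on the profile only through its height at `0`, so it gives Lipschitz constants
for the derivative that are uniform over profiles of bounded height. -/
lemma abs_force_le (h : IsProfile α lam M u) (hα : 0 ≤ α) {B : ℝ} (hB : u 0 ≤ B) (t : ℝ) :
    |α ^ 2 * u t + cos t + lam| ≤ 2 + 2 * α ^ 2 * B := by
  have h1 := h.lam_bounds hα
  have h2 : α ^ 2 * u t ≤ α ^ 2 * u 0 := mul_le_mul_of_nonneg_left (h.le_zero hα t) (sq_nonneg α)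
  have h3 : α ^ 2 * u 0 ≤ α ^ 2 * B := mul_le_mul_of_nonneg_left hB (sq_nonneg α)
  have h4 : 0 ≤ α ^ 2 * u t := mul_nonneg (sq_nonneg α) (h.film.nonneg t)
  rw [abs_le]
  constructor <;> linarith [cos_le_one t, neg_one_le_cos t, h1.1, h1.2]

lemma deriv_nonpos (h : IsProfile α lam M u) (hα : 0 ≤ α) {t : ℝ} (ht : t ∈ Icc 0 π)
    (hpos : 0 < u t) : deriv u t ≤ 0 := by
  rcases h with h | ⟨τ, h⟩
  · rw [h.deriv_eq]
    exact div_nonpos_of_nonpos_of_nonneg (neg_nonpos.2 (sin_nonneg_of_mem_Icc ht))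
      (h.one_sub_pos hα).le
  · rcases ht.1.eq_or_lt with h0 | h0
    · rw [← h0, h.deriv_zero h.even]
    · refine (h.deriv_neg t ⟨h0, ?_⟩).le
      by_contra! hle
      rw [h.zero_out t (by rwa [abs_of_pos h0]) (by rw [abs_of_pos h0]; exact ht.2)] at hpos
      exact lt_irrefl _ hpos

lemma pos_of_abs_le (h : IsProfile α lam M u) {s t : ℝ} (ht : |t| ≤ π)
    (hpos : 0 < u t) (hst : |s| ≤ |t|) : 0 < u s := by
  rcases h with h | ⟨τ, h⟩
  · exact h.pos s
  · refine h.pos s (hst.trans_lt ?_)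
    by_contra! hle
    rw [h.zero_out t hle ht] at hpos
    exact lt_irrefl _ hpos

/-- A full film cannot be lighter than a droplet by the mass thresholds. A droplet below a full film
is compared at its contact point, except for `τ = π`, where that slope is zero and the explicit
formulas are used. -/
lemma lt_of_mass_lt (h : IsProfile α lam M u) (h' : IsProfile α lam' M' v) (hα : 0 ≤ α)
    (hM : 0 < M) (hMM : M < M') {t : ℝ} (ht : t ∈ tsupport u) : u t < v t := by
  rcases h with h | ⟨τ, h⟩ <;> rcases h' with h' | ⟨τ', h'⟩
  · rw [h.eq', h'.eq']
    gcongr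
  · have h1 := h.mass_gt hα
    have h2 := h'.mass_le hα (hM.trans hMM)
    have h3 := h.one_sub_pos hα
    nlinarith
  · have hd := h'.one_sub_pos hα
    rcases h.tau_le.eq_or_lt with heq | hlt
    · subst heq
      obtain ⟨h1, h2⟩ := h.eq_of_tau_eq_pi hα
      rw [h1, h'.eq', add_div]
      have : 1 / (1 - α ^ 2) < M' / (2 * π) := by
        rw [div_lt_div_iff₀ hd (by positivity), one_mul]
        exact h'.mass_gt hα
      linarith
    · refine h.lt_of_mem_tsupport h'.per (fun s hs => ?_) ht
      refine h.lt_of_contact hα (fun s _ => h'.diff s)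
        (fun s _ => h'.hasDerivAt_deriv (h'.pos s)) (h'.deriv_zero h'.even) (h'.pos τ) ?_ h'.even hs
      rw [h'.deriv_eq]
      exact div_neg_of_neg_of_pos (neg_lt_zero.2 (sin_pos_of_pos_of_lt_pi h.tau_pos hlt)) hd
  · exact h.lt_of_mem_tsupport h'.per
      (fun s hs => h.lt_of_tau_lt hα h' (h.tau_lt_of_mass_lt hα h' hMM) hs) ht

lemma eq_of_mass_eq (h : IsProfile α lam M u) (h' : IsProfile α lam' M v) (hα : 0 ≤ α)
    (hM : 0 < M) : u = v := by
  rcases h with h | ⟨τ, h⟩ <;> rcases h' with h' | ⟨τ', h'⟩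
  · funext t
    rw [h.eq', h'.eq']
  · linarith [h.mass_gt hα, h'.mass_le hα hM]
  · linarith [h'.mass_gt hα, h.mass_le hα hM]
  · exact h.eq_of_mass_eq hα h'

lemma le_of_mass_le (h : IsProfile α lam M u) (h' : IsProfile α lam' M' v) (hα : 0 ≤ α)
    (hM : 0 < M) (hMM : M ≤ M') (t : ℝ) : u t ≤ v t := by
  rcases hMM.eq_or_lt with heq | hlt
  · subst heq
    rw [h.eq_of_mass_eq h' hα hM]
  · by_cases ht : t ∈ tsupport u
    · exact (h.lt_of_mass_lt h' hα hM hlt ht).le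
    · rw [image_eq_zero_of_notMem_tsupport ht]
      exact h'.film.nonneg t

end IsProfile

/-! ### Quantitative continuity in the mass -/

namespace IsFilm
variable {α lam M lam' M' : ℝ} {u v : ℝ → ℝ}

lemma abs_deriv_le (h : IsFilm α lam M u) (he : ∀ t, u (-t) = u t) {K : NNReal}
    (hK : LipschitzWith K (deriv u)) (t : ℝ) : |deriv u t| ≤ K * π := by
  obtain ⟨n, hn⟩ := exists_int_abs_le t
  rw [← h.deriv_per.sub_int_mul_eq n (x := t)]
  have h1 := hK.dist_le_mul (t - n * (2 * π)) 0
  rw [h.deriv_zero he, dist_zero_right, dist_zero_right, norm_eq_abs, norm_eq_abs] at h1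
  exact h1.trans (mul_le_mul_of_nonneg_left hn K.coe_nonneg)

lemma abs_sub_le (h : IsFilm α lam M u) (he : ∀ t, u (-t) = u t) {K : NNReal}
    (hK : LipschitzWith K (deriv u)) (s t : ℝ) : |u t - u s| ≤ K * π * |t - s| :=
  convex_univ.norm_image_sub_le_of_norm_hasDerivWithin_le (fun t _ => (h.diff t).hasDerivWithinAt)
    (fun t _ => h.abs_deriv_le he hK t) (mem_univ s) (mem_univ t)

/-- The difference is nonnegative with integral `M' - M` and Lipschitz constant `2 * K * π`, so its
value at `t` is at most its mean over a window of length `ρ` plus the variation there. -/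
lemma sub_le_of_mass (h : IsFilm α lam M u) (h' : IsFilm α lam' M' v) (he : ∀ t, u (-t) = u t)
    (he' : ∀ t, v (-t) = v t) {K : NNReal} (hK : LipschitzWith K (deriv u))
    (hK' : LipschitzWith K (deriv v)) (hle : ∀ t, u t ≤ v t) {ρ : ℝ} (hρ : 0 < ρ) (hρπ : ρ ≤ 2 * π)
    (t : ℝ) : v t - u t ≤ 2 * (K * π) * ρ + (M' - M) / ρ := by
  have hcu := h.cont
  have hcv := h'.cont
  have hc : Continuous fun s => v s - u s := by fun_prop
  have h1 : ∫ s in t..(t + ρ), (v s - u s) ≤ M' - M := by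
    have e : ∫ s in (-π)..π, (v s - u s) = M' - M := by
      rw [intervalIntegral.integral_sub (hcv.intervalIntegrable _ _) (hcu.intervalIntegrable _ _),
        h.mass, h'.mass]
    rw [← e, integral_eq_of_periodic (f := fun s => v s - u s)
      (fun s => by simp only [h.per s, h'.per s]) t]
    exact intervalIntegral.integral_mono_interval le_rfl (by linarith) (by linarith)
      (Eventually.of_forall fun s => sub_nonneg.2 (hle s)) (hc.intervalIntegrable _ _)
  have h2 : ∫ s in t..(t + ρ), ((v t - u t) - 2 * (K * π) * ρ) ≤ ∫ s in t..(t + ρ), (v s - u s) := by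
    refine intervalIntegral.integral_mono_on (by linarith) (by simp) (hc.intervalIntegrable _ _)
      fun s hs => ?_
    have e1 := (abs_le.1 (h.abs_sub_le he hK s t)).1
    have e2 := (abs_le.1 (h'.abs_sub_le he' hK' s t)).2
    have e3 : |t - s| ≤ ρ := by
      rw [abs_le]
      constructor <;> linarith [hs.1, hs.2]
    have e4 : K * π * |t - s| ≤ K * π * ρ :=
      mul_le_mul_of_nonneg_left e3 (mul_nonneg K.coe_nonneg pi_pos.le)
    linarith
  rw [intervalIntegral.integral_const, smul_eq_mul, add_sub_cancel_left] at h2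
  have h3 : (v t - u t) - 2 * (K * π) * ρ ≤ (M' - M) / ρ := by
    rw [le_div_iff₀ hρ]
    linarith
  linarith

/-- Interpolation: the mean value theorem on a window of length `ρ` finds a point where the
derivatives are close, and the Lipschitz bounds carry this to `t`. -/
lemma abs_deriv_sub_le_of_sub_le (h : IsFilm α lam M u) (h' : IsFilm α lam' M' v) {K : NNReal}
    (hK : LipschitzWith K (deriv u)) (hK' : LipschitzWith K (deriv v)) {η ρ : ℝ}
    (hη : ∀ t, |v t - u t| ≤ η) (hρ : 0 < ρ) (t : ℝ) :
    |deriv v t - deriv u t| ≤ 2 * η / ρ + 2 * K * ρ := by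
  have hd : ∀ s, HasDerivAt (fun s => v s - u s) (deriv v s - deriv u s) s := fun s =>
    (h'.diff s).sub (h.diff s)
  obtain ⟨ξ, hξ, hs⟩ := exists_hasDerivAt_eq_slope (fun s => v s - u s)
    (fun s => deriv v s - deriv u s) (by linarith : t < t + ρ)
    (fun s _ => (hd s).continuousAt.continuousWithinAt) fun s _ => hd s
  rw [add_sub_cancel_left] at hs
  have h1 : |deriv v ξ - deriv u ξ| ≤ 2 * η / ρ := by
    rw [hs, abs_div, abs_of_pos hρ]
    gcongr
    refine (abs_sub _ _).trans ?_
    linarith [hη (t + ρ), hη t]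
  have hdist : |t - ξ| ≤ ρ := by
    rw [abs_le]
    constructor <;> linarith [hξ.1, hξ.2]
  have h2 : |deriv u t - deriv u ξ| ≤ K * ρ := by
    have := hK.dist_le_mul t ξ
    rw [Real.dist_eq, Real.dist_eq] at this
    exact this.trans (mul_le_mul_of_nonneg_left hdist K.coe_nonneg)
  have h3 : |deriv v t - deriv v ξ| ≤ K * ρ := by
    have := hK'.dist_le_mul t ξ
    rw [Real.dist_eq, Real.dist_eq] at this
    exact this.trans (mul_le_mul_of_nonneg_left hdist K.coe_nonneg)
  rw [abs_le] at *
  constructor <;> linarith [h1.1, h1.2, h2.1, h2.2, h3.1, h3.2]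

end IsFilm

/-- Profiles with Lipschitz derivatives depend continuously on the mass in `C¹`. -/
lemma exists_delta_C1 {α : ℝ} (hα : 0 ≤ α) (K : NNReal) {ε : ℝ} (hε : 0 < ε) : ∃ δ > 0,
    ∀ lam M u lam' M' v, IsProfile α lam M u → IsProfile α lam' M' v → 0 < M → 0 < M' →
      LipschitzWith K (deriv u) → LipschitzWith K (deriv v) → |M' - M| < δ →
      ∀ t, |v t - u t| ≤ ε ∧ |deriv v t - deriv u t| ≤ ε := by
  have hK0 : (0 : ℝ) ≤ K := K.coe_nonneg
  -- control of the supremum norm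
  have sup : ∀ η > 0, ∃ δ > 0, ∀ lam M u lam' M' v, IsProfile α lam M u → IsProfile α lam' M' v →
      0 < M → M ≤ M' → LipschitzWith K (deriv u) → LipschitzWith K (deriv v) → M' - M < δ →
      ∀ t, |v t - u t| ≤ η := by
    intro η hη
    -- Makes the Lipschitz error at most `η / 2`; the mass term is handled by `δ`.
    set ρ := min (2 * π) (η / (4 * (K * π) + 1)) with hρ
    have hρ0 : 0 < ρ := lt_min (by positivity) (by positivity)
    refine ⟨ρ * (η / 2), by positivity, ?_⟩
    intro lam M u lam' M' v hu hv hM hMM hKu hKv hδ t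
    have hle := hu.le_of_mass_le hv hα hM hMM
    have h1 := hu.film.sub_le_of_mass hv.film hu.even hv.even hKu hKv hle hρ0 (min_le_left _ _) t
    have h2 : (M' - M) / ρ ≤ η / 2 := by
      rw [div_le_iff₀ hρ0]
      linarith
    have h3 : ρ * (4 * (K * π) + 1) ≤ η := by
      rw [← le_div_iff₀ (by positivity)]
      exact min_le_right _ _
    rw [abs_of_nonneg (sub_nonneg.2 (hle t))]
    linarith
  -- With `η = ρ * ε / 4` both terms of the interpolation bound are at most `ε / 2`.
  set ρ := ε / (4 * K + 1) with hρ
  have hρ0 : 0 < ρ := by positivity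
  have hρK : ρ * (4 * K + 1) = ε := by rw [hρ]; field_simp
  obtain ⟨δ, hδ, hsup⟩ := sup (min ε (ρ * ε / 4)) (lt_min hε (by positivity))
  refine ⟨δ, hδ, ?_⟩
  have key : ∀ lam M u lam' M' v, IsProfile α lam M u → IsProfile α lam' M' v → 0 < M → M ≤ M' →
      LipschitzWith K (deriv u) → LipschitzWith K (deriv v) → M' - M < δ →
      ∀ t, |v t - u t| ≤ ε ∧ |deriv v t - deriv u t| ≤ ε := by
    intro lam M u lam' M' v hu hv hM hMM hKu hKv hd t
    have h1 := hsup lam M u lam' M' v hu hv hM hMM hKu hKv hd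
    refine ⟨(h1 t).trans (min_le_left _ _), ?_⟩
    refine (hu.film.abs_deriv_sub_le_of_sub_le hv.film hKu hKv
      (fun s => (h1 s).trans (min_le_right _ _)) hρ0 t).trans ?_
    have : 2 * (ρ * ε / 4) / ρ = ε / 2 := by
      field_simp
      ring
    rw [this]
    linarith
  intro lam M u lam' M' v hu hv hM hM' hKu hKv hd t
  rcases le_total M M' with hMM | hMM
  · exact key lam M u lam' M' v hu hv hM hMM hKu hKv ((le_abs_self _).trans_lt hd) t
  · rw [abs_sub_comm (v t), abs_sub_comm (deriv v t)]
    rw [abs_sub_comm] at hd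
    exact key lam' M' v lam M u hv hu hM' hMM hKv hKu ((le_abs_self _).trans_lt hd) t

lemma IsEnergyMinimizer.exists_isProfile {α M : ℝ} {u : ℝ → ℝ} (hu : IsEnergyMinimizer α M u)
    (hα : 0 ≤ α) (hM : 0 < M) : ∃ lam, IsProfile α lam M u := by
  obtain ⟨lam, h⟩ := exists_isFilm hα hM hu
  exact ⟨lam, h.classification hα hM⟩

/-! ### Profiles with mass close to `M₀` -/

/-- A property holds for all profiles with mass close to `M₀`. -/
def NearMass (α M₀ : ℝ) (P : ℝ → ℝ → (ℝ → ℝ) → Prop) : Prop :=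
  ∃ δ > 0, ∀ lam M u, IsProfile α lam M u → 0 < M → |M - M₀| < δ → P lam M u

namespace NearMass
variable {α M₀ : ℝ} {P Q : ℝ → ℝ → (ℝ → ℝ) → Prop}

lemma and (hP : NearMass α M₀ P) (hQ : NearMass α M₀ Q) :
    NearMass α M₀ fun lam M u => P lam M u ∧ Q lam M u := by
  obtain ⟨δ₁, h₁, hP⟩ := hP
  obtain ⟨δ₂, h₂, hQ⟩ := hQ
  exact ⟨min δ₁ δ₂, lt_min h₁ h₂, fun lam M u hu hM hd =>
    ⟨hP lam M u hu hM (hd.trans_le (min_le_left _ _)),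
      hQ lam M u hu hM (hd.trans_le (min_le_right _ _))⟩⟩

lemma mono (hP : NearMass α M₀ P)
    (h : ∀ lam M u, IsProfile α lam M u → 0 < M → P lam M u → Q lam M u) : NearMass α M₀ Q := by
  obtain ⟨δ, hδ, hP⟩ := hP
  exact ⟨δ, hδ, fun lam M u hu hM hd => h lam M u hu hM (hP lam M u hu hM hd)⟩

end NearMass

section
variable {α M₀ lam₀ : ℝ} {u₀ : ℝ → ℝ}

/-- A profile of mass `M₀ + 1` dominates all profiles of smaller mass, which bounds their heights
uniformly. -/
lemma nearMass_lipschitz (hα : 0 ≤ α) (hM₀ : 0 < M₀) :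
    ∃ K : NNReal, NearMass α M₀ fun _ _ u => LipschitzWith K (deriv u) := by
  obtain ⟨v, hv⟩ := exists_minimizer (α := α) (by linarith : 0 < M₀ + 1)
  obtain ⟨mu, hv⟩ := hv.exists_isProfile hα (by linarith)
  have hB := hv.film.nonneg 0
  refine ⟨⟨2 + 2 * α ^ 2 * v 0, by positivity⟩, 1, one_pos, fun lam M u hu hM hd => ?_⟩
  have hle := hu.le_of_mass_le hv hα hM (by linarith [le_abs_self (M - M₀)]) 0
  exact hu.film.lipschitz fun t => hu.abs_force_le hα hle t

lemma nearMass_C1 (hα : 0 ≤ α) (hM₀ : 0 < M₀) (h₀ : IsProfile α lam₀ M₀ u₀) {ε : ℝ} (hε : 0 < ε) :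
    NearMass α M₀ fun _ _ u => ∀ t, |u t - u₀ t| ≤ ε ∧ |deriv u t - deriv u₀ t| ≤ ε := by
  obtain ⟨K, hK⟩ := nearMass_lipschitz hα hM₀
  obtain ⟨δ₁, hδ₁, hK⟩ := hK
  obtain ⟨δ₂, hδ₂, h2⟩ := exists_delta_C1 hα K hε
  refine ⟨min δ₁ δ₂, lt_min hδ₁ hδ₂, fun lam M u hu hM hd => ?_⟩
  refine h2 lam₀ M₀ u₀ lam M u h₀ hu hM₀ hM (hK _ _ _ h₀ hM₀ (by simpa using hδ₁))
    (hK _ _ _ hu hM (hd.trans_le (min_le_left _ _))) (hd.trans_le (min_le_right _ _))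

variable {τ₀ : ℝ}

/-- Positivity at the single point `σ` suffices, since positivity at a point of `[-π, π]` spreads to
all points closer to `0`. -/
lemma nearMass_wet (hα : 0 ≤ α) (hM₀ : 0 < M₀) (h₀ : IsDroplet α lam₀ M₀ τ₀ u₀) {σ : ℝ}
    (hσ : σ ∈ Ico 0 τ₀) : NearMass α M₀ fun _ _ u => ∀ t, |t| ≤ σ → 0 < u t := by
  have hpos := h₀.pos σ (by rw [abs_of_nonneg hσ.1]; exact hσ.2)
  refine (nearMass_C1 hα hM₀ (Or.inr ⟨τ₀, h₀⟩) (half_pos hpos)).mono fun lam M u hu hM h t ht => ?_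
  refine hu.pos_of_abs_le (t := σ) (by rw [abs_of_nonneg hσ.1]; linarith [hσ.2, h₀.tau_le]) ?_
    (by rwa [abs_of_nonneg hσ.1])
  linarith [(abs_le.1 (h σ).1).1]

/-- Integrating the equation over `[0, τ₀ / 2]`, where both profiles are positive, expresses `lam -
lam₀` through quantities that are small in `C¹`. -/
lemma nearMass_lam (hα : 0 ≤ α) (hM₀ : 0 < M₀) (h₀ : IsDroplet α lam₀ M₀ τ₀ u₀) {ε : ℝ}
    (hε : 0 < ε) : NearMass α M₀ fun lam _ _ => |lam - lam₀| ≤ ε := by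
  have hτ := h₀.tau_pos
  set σ := τ₀ / 2 with hσ
  have hσ0 : 0 < σ := by rw [hσ]; linarith
  set η := ε * σ / (1 + α ^ 2 * σ) with hη
  have hη0 : 0 < η := by positivity
  have hησ : η * (1 + α ^ 2 * σ) = ε * σ := by rw [hη]; field_simp
  refine ((nearMass_C1 hα hM₀ (Or.inr ⟨τ₀, h₀⟩) hη0).and (nearMass_wet hα hM₀ h₀
    (σ := σ) ⟨hσ0.le, by rw [hσ]; linarith⟩)).mono fun lam M u hu hM h => ?_
  obtain ⟨hC, hwet⟩ := h
  have habs : ∀ t ∈ Ioo 0 σ, |t| ≤ σ := fun t ht => by rw [abs_of_pos ht.1]; exact ht.2.le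
  have e1 := hu.film.ode 0 σ hσ0 (fun t ht => hwet t (habs t ht)) σ (right_mem_Icc.2 hσ0.le)
  have e2 := h₀.ode 0 σ hσ0 (fun t ht => h₀.pos t (by
    rw [abs_of_pos ht.1]; linarith [ht.2])) σ (right_mem_Icc.2 hσ0.le)
  rw [hu.film.deriv_zero hu.even] at e1
  rw [h₀.deriv_zero h₀.even] at e2
  have hcu := hu.film.cont
  have hcu₀ := h₀.cont
  have e3 : (lam - lam₀) * σ = -(deriv u σ - deriv u₀ σ)
      - ∫ s in (0 : ℝ)..σ, α ^ 2 * (u s - u₀ s) := by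
    rw [e1, e2]
    have : ∫ s in (0 : ℝ)..σ, (α ^ 2 * u s + cos s + lam) = (∫ s in (0 : ℝ)..σ, α ^ 2 * (u s - u₀ s))
        + (∫ s in (0 : ℝ)..σ, (α ^ 2 * u₀ s + cos s + lam₀)) + ∫ s in (0 : ℝ)..σ, (lam - lam₀) := by
      rw [← intervalIntegral.integral_add (Continuous.intervalIntegrable (by fun_prop) _ _)
        (Continuous.intervalIntegrable (by fun_prop) _ _),
        ← intervalIntegral.integral_add (Continuous.intervalIntegrable (by fun_prop) _ _)
        (Continuous.intervalIntegrable (by fun_prop) _ _)]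
      exact intervalIntegral.integral_congr fun s _ => by ring
    rw [this, intervalIntegral.integral_const, smul_eq_mul]
    ring
  have e4 : |∫ s in (0 : ℝ)..σ, α ^ 2 * (u s - u₀ s)| ≤ α ^ 2 * η * σ := by
    have := intervalIntegral.norm_integral_le_of_norm_le_const (a := 0) (b := σ) (C := α ^ 2 * η)
      (f := fun s => α ^ 2 * (u s - u₀ s)) fun s _ => by
        rw [norm_mul, norm_of_nonneg (sq_nonneg α)]
        exact mul_le_mul_of_nonneg_left (hC s).1 (sq_nonneg α)
    rwa [sub_zero, abs_of_pos hσ0] at this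
  have e5 : |lam - lam₀| * σ ≤ ε * σ := by
    rw [← abs_of_pos hσ0, ← abs_mul, abs_of_pos hσ0, e3]
    refine (abs_sub _ _).trans ?_
    rw [abs_neg]
    linarith [(hC σ).2]
  exact le_of_mul_le_mul_right e5 hσ0

/-- Beyond `τ₀` the profile is small and `lam₀ ≤ -cos τ₀`, so the force is close to or below `cos s
- cos τ₀ < 0`. If `u` were positive up to `τ₀ + ρ`, its slope would gain almost `κ` from a value
near zero and become positive, against monotonicity. -/
lemma nearMass_dry (hα : 0 ≤ α) (hM₀ : 0 < M₀) (h₀ : IsDroplet α lam₀ M₀ τ₀ u₀) {ρ : ℝ}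
    (hρ : 0 < ρ) : NearMass α M₀ fun _ _ u => ∀ t, τ₀ + ρ ≤ |t| → |t| ≤ π → u t = 0 := by
  rcases le_or_gt (τ₀ + ρ) π with hle | hlt
  swap
  · exact ⟨1, one_pos, fun _ _ _ _ _ _ t h1 h2 => absurd (h1.trans h2) (not_le.2 hlt)⟩
  have hτ := h₀.tau_pos
  set κ := ∫ s in τ₀..(τ₀ + ρ), (cos τ₀ - cos s) with hκ
  have hκ0 : 0 < κ := by
    refine intervalIntegral.intervalIntegral_pos_of_pos_on
      (Continuous.intervalIntegrable (by fun_prop) _ _) (fun s hs => ?_) (by linarith)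
    exact sub_pos.2 (strictAntiOn_cos ⟨hτ.le, h₀.tau_le⟩
      ⟨by linarith [hs.1], by linarith [hs.2]⟩ hs.1)
  -- Leaves room for the slope error `ε` at `τ₀` and the force error `(α ^ 2 + 1) * ε` over the
  -- length `ρ`.
  set ε := κ / (2 * (1 + ρ * (α ^ 2 + 1))) with hε
  have hε0 : 0 < ε := by positivity
  have hεκ : ε * (1 + ρ * (α ^ 2 + 1)) < κ := by
    have : ε * (1 + ρ * (α ^ 2 + 1)) = κ / 2 := by rw [hε]; field_simp
    linarith
  refine ((nearMass_C1 hα hM₀ (Or.inr ⟨τ₀, h₀⟩) hε0).and (nearMass_lam hα hM₀ h₀ hε0)).mono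
    fun lam M u hu hM h t ht htπ => ?_
  obtain ⟨hC, hlam⟩ := h
  by_contra hne
  have hpos : 0 < u t := (hu.film.nonneg t).lt_of_ne (Ne.symm hne)
  have hwet : ∀ s ∈ Icc τ₀ (τ₀ + ρ), 0 < u s := fun s hs =>
    hu.pos_of_abs_le htπ hpos (by rw [abs_of_pos (hτ.trans_le hs.1)]; linarith [hs.2])
  have e1 := hu.film.ode τ₀ (τ₀ + ρ) (by linarith) (fun s hs => hwet s (Ioo_subset_Icc_self hs))
    (τ₀ + ρ) (right_mem_Icc.2 (by linarith))
  have e2 := hu.deriv_nonpos hα (t := τ₀ + ρ) ⟨by linarith, hle⟩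
    (hwet _ (right_mem_Icc.2 (by linarith)))
  have e3 := (hC τ₀).2
  rw [h₀.zero τ₀ h₀.contact, sub_zero] at e3
  have hcu := hu.film.cont
  have e4 : ∫ s in τ₀..(τ₀ + ρ), (α ^ 2 * u s + cos s + lam)
      ≤ ∫ s in τ₀..(τ₀ + ρ), ((α ^ 2 + 1) * ε - (cos τ₀ - cos s)) := by
    refine intervalIntegral.integral_mono_on (by linarith)
      (Continuous.intervalIntegrable (by fun_prop) _ _)
      (Continuous.intervalIntegrable (by fun_prop) _ _) fun s hs => ?_
    have h1 := (abs_le.1 (hC s).1).2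
    have hs0 : 0 < s := hτ.trans_le hs.1
    rw [h₀.zero_out s (by rw [abs_of_pos hs0]; exact hs.1) (by rw [abs_of_pos hs0]; linarith [hs.2]),
      sub_zero] at h1
    have h2 := (abs_le.1 hlam).2
    have h3 := h₀.lam_bounds.2
    have h4 := mul_le_mul_of_nonneg_left h1 (sq_nonneg α)
    linarith
  rw [intervalIntegral.integral_sub (by simp) (Continuous.intervalIntegrable (by fun_prop) _ _),
    intervalIntegral.integral_const, smul_eq_mul, ← hκ, add_sub_cancel_left] at e4
  have e5 := (abs_le.1 e3).1
  linarith

/-- Contact points belong to the boundary of the wet region. -/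
lemma IsDroplet.contact_mem_frontier (h₀ : IsDroplet α lam₀ M₀ τ₀ u₀) (n : ℤ) {σ : ℝ}
    (hσ : |σ| = τ₀) : n * (2 * π) + σ ∈ frontier (Function.support u₀) := by
  have hshift : ∀ t, u₀ (n * (2 * π) + t) = u₀ t := fun t => by
    rw [← h₀.int_shift n (n * (2 * π) + t)]
    congr 1
    ring
  refine ⟨?_, fun hint => ?_⟩
  · have hlim : Tendsto (fun s : ℝ => n * (2 * π) + s * σ) (𝓝[<] 1) (𝓝 (n * (2 * π) + 1 * σ)) := by
      have : Continuous fun s : ℝ => n * (2 * π) + s * σ := by fun_prop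
      exact (this.tendsto 1).mono_left nhdsWithin_le_nhds
    rw [one_mul] at hlim
    refine mem_closure_of_tendsto hlim ?_
    filter_upwards [Ioo_mem_nhdsLT (show (0 : ℝ) < 1 by norm_num)] with s hs
    rw [Function.mem_support, hshift]
    refine (h₀.pos _ ?_).ne'
    rw [abs_mul, hσ, abs_of_pos hs.1]
    have := h₀.tau_pos
    nlinarith [hs.2]
  · have := interior_subset hint
    rw [Function.mem_support, hshift] at this
    exact this (h₀.zero_out σ hσ.ge (hσ.trans_le h₀.tau_le))

/-- Full films of different mass have the same derivative. For droplets, points away from contact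
are wet for both profiles or dry for both once the masses are close, and the second derivatives are
compared there. -/
lemma nearMass_C11 (hα : 0 ≤ α) (hM₀ : 0 < M₀) (h₀ : IsProfile α lam₀ M₀ u₀) {K : Set ℝ}
    (hK : IsCompact K) (hKd : Disjoint K (frontier (Function.support u₀))) {ε : NNReal}
    (hε : 0 < ε) :
    NearMass α M₀ fun _ _ u => LipschitzOnWith ε (fun t => deriv u t - deriv u₀ t) K := by
  rcases h₀ with h₀ | ⟨τ₀, h₀⟩
  · -- the full film stays full
    have hd := h₀.one_sub_pos hα
    have hm := h₀.mass_gt hα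
    refine ⟨M₀ - 2 * π / (1 - α ^ 2), by rw [gt_iff_lt, sub_pos, div_lt_iff₀ hd]; exact hm,
      fun lam M u hu hM hdist => ?_⟩
    have h1 : 2 * π < M * (1 - α ^ 2) := by
      rw [← div_lt_iff₀ hd]
      linarith [(abs_lt.1 hdist).1]
    rcases hu with hu | ⟨τ, hu⟩
    · have e : (fun t => deriv u t - deriv u₀ t) = fun _ => 0 := by
        funext t
        rw [hu.deriv_eq, h₀.deriv_eq, sub_self]
      beta_reduce
      rw [e]
      exact (LipschitzWith.const' (0 : ℝ)).lipschitzOnWith.weaken zero_le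
    · linarith [hu.mass_le hα hM]
  have hε' : (0 : ℝ) < ε := hε
  obtain ⟨δ, hδ, hδK⟩ := hK.exists_thickening_subset_open isClosed_frontier.isOpen_compl
    hKd.subset_compl_right
  have hτ := h₀.tau_pos
  -- Two steps shorter than `ρ` stay within the distance `δ` that separates `K` from the contact
  -- points, and `τ₀ - ρ` is positive.
  set ρ := min (δ / 2) (τ₀ / 2) with hρ
  have hρ0 : 0 < ρ := lt_min (by linarith) (by linarith)
  have hρτ : ρ < τ₀ := (min_le_right _ _).trans_lt (by linarith)
  have hρδ : ρ ≤ δ / 2 := min_le_left _ _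
  set η := min (ε * ρ / 2) (ε / (2 * (α ^ 2 + 1))) with hη
  have hη0 : 0 < η := lt_min (by positivity) (by positivity)
  have hη1 : 2 * η ≤ ε * ρ := by linarith [min_le_left (ε * ρ / 2 : ℝ) (ε / (2 * (α ^ 2 + 1)))]
  have hη2 : η * (2 * (α ^ 2 + 1)) ≤ ε := by
    rw [← le_div_iff₀ (by positivity)]
    exact min_le_right _ _
  refine (((nearMass_C1 hα hM₀ (Or.inr ⟨τ₀, h₀⟩) hη0).and (nearMass_lam hα hM₀ h₀ hη0)).and
    ((nearMass_wet hα hM₀ h₀ (σ := τ₀ - ρ) ⟨by linarith, by linarith⟩).and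
    (nearMass_dry hα hM₀ h₀ (half_pos hρ0)))).mono fun lam M u hu hM h => ?_
  obtain ⟨⟨hC, hlam⟩, hwet, hdry⟩ := h
  -- the second derivatives are close near `K`
  have hder : ∀ x ∈ K, ∀ t, |t - x| < ρ → ∃ d, HasDerivAt (fun t => deriv u t - deriv u₀ t) d t ∧
      ‖d‖ ≤ ε := by
    intro x hx t ht
    obtain ⟨n, hn⟩ := exists_int_abs_le t
    set s := t - n * (2 * π) with hs
    have hfar : ρ ≤ |(|s| - τ₀)| := by
      by_contra! hlt
      have hσ : ∃ σ, |σ| = τ₀ ∧ |σ - s| < ρ := by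
        rcases abs_choice s with h1 | h1 <;> rw [h1] at hlt
        · exact ⟨τ₀, abs_of_pos hτ, by rwa [abs_sub_comm]⟩
        · refine ⟨-τ₀, by rw [abs_neg, abs_of_pos hτ], ?_⟩
          rwa [show -τ₀ - s = -s - τ₀ by ring]
      obtain ⟨σ, hσ, hσs⟩ := hσ
      refine hδK (Metric.mem_thickening_iff.2 ⟨x, hx, ?_⟩) (h₀.contact_mem_frontier n hσ)
      rw [Real.dist_eq]
      have e : n * (2 * π) + σ - x = (σ - s) + (t - x) := by rw [hs]; ring
      rw [e]
      refine (abs_add_le _ _).trans_lt ?_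
      linarith
    rcases le_total |s| τ₀ with h1 | h1
    · rw [abs_of_nonpos (by linarith)] at hfar
      have hu0 : 0 < u t := by
        rw [← hu.film.int_shift n t]
        exact hwet s (by linarith)
      have hu₀0 : 0 < u₀ t := by
        rw [← h₀.int_shift n t]
        exact h₀.pos s (by linarith)
      refine ⟨_, (hu.film.hasDerivAt_deriv hu0).sub (h₀.hasDerivAt_deriv hu₀0), ?_⟩
      have e : -(α ^ 2 * u t + cos t + lam) - -(α ^ 2 * u₀ t + cos t + lam₀)
          = -(α ^ 2 * (u t - u₀ t) + (lam - lam₀)) := by ring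
      rw [e, norm_neg]
      refine (norm_add_le _ _).trans ?_
      rw [norm_mul, norm_of_nonneg (sq_nonneg α), norm_eq_abs, norm_eq_abs]
      have h2 := mul_le_mul_of_nonneg_left (hC t).1 (sq_nonneg α)
      nlinarith [sq_nonneg α]
    · rw [abs_of_nonneg (by linarith)] at hfar
      refine ⟨0, ?_, by simp⟩
      -- A strict cosine inequality is an open condition, so both profiles vanish near `t` and not
      -- only at it.
      have hcos : cos t < cos (τ₀ + ρ / 2) := by
        rw [← cos_sub_int_mul_two_pi t n, ← cos_abs s]
        exact strictAntiOn_cos ⟨by linarith, by linarith⟩ ⟨abs_nonneg _, hn⟩ (by linarith)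
      have hdry' : ∀ r, cos r < cos (τ₀ + ρ / 2) → u r = 0 ∧ u₀ r = 0 := by
        intro r hr
        obtain ⟨m, hm⟩ := exists_int_abs_le r
        rw [← cos_sub_int_mul_two_pi r m] at hr
        rw [← hu.film.int_shift m r, ← h₀.int_shift m r]
        have h2 : τ₀ + ρ / 2 ≤ |r - m * (2 * π)| := by
          by_contra! hlt
          rw [← cos_abs (r - _)] at hr
          exact absurd hr (not_lt.2 (strictAntiOn_cos.antitoneOn ⟨abs_nonneg _, hm⟩
            ⟨by linarith, by linarith⟩ hlt.le))
        exact ⟨hdry _ h2 hm, h₀.zero_out _ (by linarith) hm⟩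
      refine (hasDerivAt_const t (0 : ℝ)).congr_of_eventuallyEq ?_
      have hnear : ∀ᶠ r in 𝓝 t, cos r < cos (τ₀ + ρ / 2) :=
        continuous_cos.continuousAt.eventually (gt_mem_nhds hcos)
      filter_upwards [hnear] with r hr
      obtain ⟨h2, h3⟩ := hdry' r hr
      rw [hu.film.zero r h2, h₀.zero r h3, sub_zero]
  refine LipschitzOnWith.of_dist_le_mul fun x hx y hy => ?_
  rw [Real.dist_eq, Real.dist_eq]
  -- Points of `K` closer than `ρ` are treated by the mean value inequality; for the others the `C¹`
  -- bound `2 * η ≤ ε * ρ` suffices.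
  rcases lt_or_ge |x - y| ρ with hxy | hxy
  · have hconv : Convex ℝ (uIcc x y) := convex_uIcc x y
    have hin : ∀ t ∈ uIcc x y, |t - x| < ρ := fun t ht =>
      (abs_sub_left_of_mem_uIcc ht).trans_lt (by rwa [abs_sub_comm])
    choose! d hd hdε using fun t (ht : t ∈ uIcc x y) => hder x hx t (hin t ht)
    exact hconv.norm_image_sub_le_of_norm_hasDerivWithin_le (f := fun t => deriv u t - deriv u₀ t)
      (fun t ht => (hd t ht).hasDerivWithinAt) hdε right_mem_uIcc left_mem_uIcc
  · refine (abs_sub _ _).trans ?_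
    have h1 := mul_le_mul_of_nonneg_left hxy hε'.le
    linarith [(hC x).2, (hC y).2]

lemma minimizersContinuousAt (hα : 0 ≤ α) (hM₀ : 0 < M₀) (h₀ : IsProfile α lam₀ M₀ u₀) :
    MinimizersContinuousAt α M₀ u₀ := by
  refine ⟨fun ε hε => ?_, ?_, fun K hK hKd ε hε => ?_⟩
  · obtain ⟨δ, hδ, h⟩ := nearMass_C1 hα hM₀ h₀ hε
    refine ⟨δ, hδ, fun M hM hd u hu => ?_⟩
    obtain ⟨lam, hu⟩ := hu.exists_isProfile hα hM
    exact h lam M u hu hM hd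
  · obtain ⟨L, δ, hδ, h⟩ := nearMass_lipschitz hα hM₀
    refine ⟨δ, hδ, L, fun M hM hd u hu => ?_⟩
    obtain ⟨lam, hu⟩ := hu.exists_isProfile hα hM
    exact h lam M u hu hM hd
  · obtain ⟨δ, hδ, h⟩ := nearMass_C11 hα hM₀ h₀ hK hKd hε
    refine ⟨δ, hδ, fun M hM hd u hu => ?_⟩
    obtain ⟨lam, hu⟩ := hu.exists_isProfile hα hM
    exact h lam M u hu hM hd

end

/-! ### Regularity, symmetry and the main theorem -/

lemma IsProfile.isC11 {α lam M : ℝ} {u : ℝ → ℝ} (h : IsProfile α lam M u) (hα : 0 ≤ α) :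
    IsC11 u := by
  have hB := h.film.nonneg 0
  have hL : LipschitzWith ⟨2 + 2 * α ^ 2 * u 0, by positivity⟩ (deriv u) :=
    h.film.lipschitz fun t => h.abs_force_le hα le_rfl t
  exact ⟨contDiff_one_iff_deriv.2 ⟨fun t => (h.film.diff t).differentiableAt, hL.continuous⟩, _, hL⟩

lemma IsProfile.strictSymmDecreasing {α lam M : ℝ} {u : ℝ → ℝ} (h : IsProfile α lam M u)
    (hα : 0 ≤ α) : StrictSymmDecreasingOnSupport u := by
  refine ⟨h.even, ?_⟩
  rcases h with h | ⟨τ, h⟩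
  · intro x hx y hy hxy
    rw [h.eq', h.eq']
    have := h.one_sub_pos hα
    have := strictAntiOn_cos hx.2 hy.2 hxy
    gcongr
  · refine h.strictAntiOn.mono fun x hx => ⟨hx.2.1, ?_⟩
    have := abs_le_of_cos_le (s := x) (by rw [abs_of_nonneg hx.2.1]; exact hx.2.2) h.tau_pos.le
      h.tau_le (h.cos_le_of_mem_tsupport hx.1)
    rwa [abs_of_nonneg hx.2.1] at this

theorem mainTheorem1 (α : ℝ) (hα : 0 ≤ α) :
    -- existence and uniqueness
    (∀ M > 0, ∃! u : ℝ → ℝ, IsEnergyMinimizer α M u) ∧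
    -- regularity, symmetry and continuous dependence on the mass
    (∀ M > 0, ∀ u, IsEnergyMinimizer α M u →
      IsC11 u ∧ StrictSymmDecreasingOnSupport u ∧ MinimizersContinuousAt α M u) ∧
    -- strict monotonicity in the mass
    (∀ M₁ > 0, ∀ M₂, M₁ < M₂ → ∀ u₁ u₂,
      IsEnergyMinimizer α M₁ u₁ → IsEnergyMinimizer α M₂ u₂ →
        ∀ θ ∈ tsupport u₁, u₁ θ < u₂ θ) ∧
    -- supercritical mass
    (∀ M > 0, M * (1 - α ^ 2) > 2 * π → ∀ u, IsEnergyMinimizer α M u →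
      ∀ θ, u θ = M / (2 * π) + 1 / (1 - α ^ 2) * cos θ ∧ 0 < u θ) ∧
    -- subcritical mass
    (∀ M > 0, M * (1 - α ^ 2) < 2 * π → ∀ u, IsEnergyMinimizer α M u →
      ∃ τ > 0, max α 1 * τ < π ∧
        (∀ θ, |θ| ≤ τ → u θ = wetProfile α τ θ) ∧
        (∀ θ, |θ| < τ → 0 < u θ) ∧
        (∀ θ, τ ≤ |θ| → |θ| ≤ π → u θ = 0) ∧
        HasDerivAt u 0 τ ∧ HasDerivAt u 0 (-τ)) ∧
    -- critical mass
    (∀ M > 0, M * (1 - α ^ 2) = 2 * π → ∀ u, IsEnergyMinimizer α M u →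
      (∀ θ, u θ = (1 + cos θ) / (1 - α ^ 2)) ∧
      (∀ θ, u θ = M / (2 * π) + 1 / (1 - α ^ 2) * cos θ) ∧
      (∀ θ, |θ| ≤ π → u θ = wetProfile α π θ) ∧
      (∀ θ, |θ| < π → 0 < u θ) ∧ u π = 0) := by
  refine ⟨fun M hM => ?_, fun M hM u hu => ?_, fun M₁ hM₁ M₂ hM u₁ u₂ hu₁ hu₂ θ hθ => ?_,
    fun M hM hMα u hu θ => ?_, fun M hM hMα u hu => ?_, fun M hM hMα u hu => ?_⟩
  · obtain ⟨u, hu⟩ := exists_minimizer (α := α) hM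
    refine ⟨u, hu, fun v hv => ?_⟩
    obtain ⟨lam, hu⟩ := hu.exists_isProfile hα hM
    obtain ⟨mu, hv⟩ := IsEnergyMinimizer.exists_isProfile hv hα hM
    exact hv.eq_of_mass_eq hu hα hM
  · obtain ⟨lam, hu⟩ := hu.exists_isProfile hα hM
    exact ⟨hu.isC11 hα, hu.strictSymmDecreasing hα, minimizersContinuousAt hα hM hu⟩
  · obtain ⟨lam, hu₁⟩ := hu₁.exists_isProfile hα hM₁
    obtain ⟨mu, hu₂⟩ := hu₂.exists_isProfile hα (hM₁.trans hM)
    exact hu₁.lt_of_mass_lt hu₂ hα hM₁ hM hθ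
  · obtain ⟨lam, hu | ⟨τ, hu⟩⟩ := hu.exists_isProfile hα hM
    · exact ⟨hu.eq θ, hu.pos θ⟩
    · linarith [hu.mass_le hα hM]
  · obtain ⟨lam, hu | ⟨τ, hu⟩⟩ := hu.exists_isProfile hα hM
    · linarith [hu.mass_gt hα]
    · have hτ : τ < π := by
        refine hu.tau_le.lt_of_ne ?_
        rintro rfl
        linarith [(hu.eq_of_tau_eq_pi hα).2]
      have hd : ∀ t, u t = 0 → HasDerivAt u 0 t := fun t ht =>
        (hu.diff t).congr_deriv (hu.zero t ht)
      refine ⟨τ, hu.tau_pos, ?_, fun θ hθ => hu.eq_wetProfile hα hθ, hu.pos, hu.zero_out,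
        hd τ hu.contact, hd (-τ) (by rw [hu.even]; exact hu.contact)⟩
      rcases max_cases α 1 with h | h <;> rw [h.1]
      · exact hu.alpha_tau
      · rwa [one_mul]
  · obtain ⟨lam, hu | ⟨τ, hu⟩⟩ := hu.exists_isProfile hα hM
    · linarith [hu.mass_gt hα]
    · have hτ : τ = π := by
        refine hu.tau_le.eq_or_lt.resolve_right fun hlt => ?_
        linarith [hu.mass_lt_of_tau_lt_pi hα hM hlt]
      subst hτ
      have h1 := (hu.eq_of_tau_eq_pi hα).1
      refine ⟨h1, fun θ => ?_, fun θ hθ => hu.eq_wetProfile hα hθ, hu.pos, hu.contact⟩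
      have hd : 1 - α ^ 2 ≠ 0 := by
        intro h0
        rw [h0, mul_zero] at hMα
        linarith [pi_pos]
      rw [h1, show M / (2 * π) = 1 / (1 - α ^ 2) by
        rw [div_eq_div_iff (by positivity) hd]
        linarith]
      ring
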